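/- Let $N\ge 2$, let $X_N=\{z\in\mathbb C^N: z_i\ne z_j \text{ for } i\neq j\}$, and let $W=W^{(N-1,1)}$ be the reflection representation of $S_N$: the hyperplane $\{x_1+\dots+x_N=0\}\subset\mathbb C^N$ with $S_N$ permuting the standard basis vectors $\epsilon_1,\dots,\epsilon_N$. For an integer $\kappa$ let $\mathit{KZ}(\lambda,\kappa)$, $\lambda=(N-1,1)$, be the space of holomorphic $\psi\colon X_N\to W$ with $$\partial_i\psi=\kappa\sum_{j\ne i}\frac{s_{ij}+1}{z_i-z_j}\,\psi,\qquad i=1,\dots,N,$$ where $s_{ij}\in S_N$ is the transposition of $i$ and $j$. Fix an isomorphism of $S_N$-modules $\theta\colon W^*\to W$ and write $\langle v,w\rangle=(\theta^{-1}w)(v)$ for $v,w\in W$. For an integer $m>0$, $z\in X_N$, $\sigma\in H_1(\mathbb C\smallsetminus\{z_1,\dots,z_N\};\mathbb Z)$ and $\tau\in H_1(\mathbb C,\{z_1,\dots,z_N\};\mathbb Z)$ put $$\psi_\sigma(z)=\prod_{i<j}(z_i-z_j)^{2m}\,\frac1{2\pi i}\int_\sigma\prod_{i=1}^N(t-z_i)^{-m}\sum_{b=1}^N\frac{\epsilon_b}{t-z_b}\,dt,$$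 $$\phi_\tau(z)=\prod_{i<j}(z_i-z_j)^{-2m}\int_\tau\prod_{i=1}^N(t-z_i)^{m}\sum_{b=1}^N\frac{\epsilon_b}{t-z_b}\,dt .$$ Both vectors lie in $W$. Let $\sigma\cdot\tau\in\mathbb Z$ be the intersection number: the number of crossings of representatives in general position, a crossing counting $+1$ or $-1$ as the tangent vectors of $\sigma$ and $\tau$ (in this order) form a positively or negatively oriented basis of $\mathbb C$. Families $\sigma=\sigma(z)$, $\tau=\tau(z)$, $z\in X_N$, of such classes are called horizontal if they are flat for the Gauss--Manin connection. Then there is a constant $C_N\ne0$, depending only on $N$ and on $\theta$, and equal to $-1$ if $\langle v,w\rangle=\sum_b v_bw_b$ for all $v,w\in W$, such that the following holds for every integer $m>0$. 1. For $\psi\in \mathit{KZ}(\lambda,m)$ and $\phi\in \mathit{KZ}(\lambda,-m)$ the number $\langle\psi(z),\phi(z)\rangle$ does not depend on $z\in X_N$; this is the canonical pairing $\mathit{KZ}(\lambda,m)\times \mathit{KZ}(\lambda,-m)\to\mathbb C$. 2. The functions $\psi_\sigma$ with $\sigma$ horizontal lie in $\mathit{KZ}(\lambda,m)$ and span it over $\mathbb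 C$; the functions $\phi_\tau$ with $\tau$ horizontal lie in $\mathit{KZ}(\lambda,-m)$ and span it over $\mathbb C$. 3. For all horizontal $\sigma,\tau$ and all $z\in X_N$, $$\langle\psi_\sigma(z),\phi_\tau(z)\rangle=C_N\,\frac1m\,(\sigma\cdot\tau).$$ 4. The functions $$\psi_a=\prod_{i<j}(z_i-z_j)^{2m}\,\mathrm{res}_{t=z_a}\prod_{i=1}^N(t-z_i)^{-m}\sum_{b=1}^N\frac{\epsilon_b}{t-z_b}\,dt,\qquad \phi_a=\prod_{i<j}(z_i-z_j)^{-2m}\int_{z_a}^{z_N}\prod_{i=1}^N(t-z_i)^{m}\sum_{b=1}^N\frac{\epsilon_b}{t-z_b}\,dt$$ lie in $\mathit{KZ}(\lambda,m)$ and $\mathit{KZ}(\lambda,-m)$ respectively, and $$\langle\psi_a(z),\phi_b(z)\rangle=-C_N\,\frac1m\,\delta_{ab},\qquad 1\le a,b\le N-1,\ z\in X_N.$$ -/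

import Mathlib

noncomputable section

open scoped ContDiff

/-! ## Smooth singular chains and first homology of pairs

`X` and `A` are subsets of a real normed space `E`.  A smooth singular simplex is a map from the
standard simplex which extends to a smooth map on the ambient affine space.  -/

/-- The standard triangle, with vertices `(0,0)`, `(1,0)`, `(0,1)`. -/
abbrev Triangle : Type := {p : ℝ × ℝ // 0 ≤ p.1 ∧ 0 ≤ p.2 ∧ p.1 + p.2 ≤ 1}

/-- The face from `(1,0)` to `(0,1)`. -/
def Triangle.face₀ (t : unitInterval) : Triangle := ⟨(1 - t, t), by
  refine ⟨?_, ?_, ?_⟩ <;> have := t.2.1 <;> have := t.2.2 <;> simp <;> linarith⟩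

/-- The face from `(0,0)` to `(0,1)`. -/
def Triangle.face₁ (t : unitInterval) : Triangle := ⟨(0, t), by
  refine ⟨?_, ?_, ?_⟩ <;> have := t.2.1 <;> have := t.2.2 <;> simp <;> linarith⟩

/-- The face from `(0,0)` to `(1,0)`. -/
def Triangle.face₂ (t : unitInterval) : Triangle := ⟨(t, 0), by
  refine ⟨?_, ?_, ?_⟩ <;> have := t.2.1 <;> have := t.2.2 <;> simp <;> linarith⟩

section Homology

variable {E : Type*} [NormedAddCommGroup E] [NormedSpace ℝ E]
variable {F : Type*} [NormedAddCommGroup F] [NormedSpace ℝ F]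

/-- Smooth singular `1`-simplices of `X`. -/
def IsSmoothPath (X : Set E) (γ : unitInterval → E) : Prop :=
  (∃ g : ℝ → E, ContDiff ℝ ∞ g ∧ ∀ t : unitInterval, g t = γ t) ∧ ∀ t, γ t ∈ X

/-- Smooth singular `2`-simplices of `X`. -/
def IsSmoothTriangle (X : Set E) (s : Triangle → E) : Prop :=
  (∃ g : ℝ × ℝ → E, ContDiff ℝ ∞ g ∧ ∀ p : Triangle, g p = s p) ∧ ∀ p, s p ∈ X

/-- The group of smooth singular `1`-chains of `X`. -/
def chains₁ (X : Set E) : AddSubgroup ((unitInterval → E) →₀ ℤ) where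
  carrier := {c | ∀ γ ∈ c.support, IsSmoothPath X γ}
  zero_mem' := by simp
  add_mem' := by
    classical
    intro a b ha hb γ hγ
    rcases Finset.mem_union.1 (Finsupp.support_add hγ) with h | h
    exacts [ha γ h, hb γ h]
  neg_mem' := by intro a ha γ hγ; exact ha γ (by simpa using hγ)

/-- The group of smooth singular `2`-chains of `X`. -/
def chains₂ (X : Set E) : AddSubgroup ((Triangle → E) →₀ ℤ) where
  carrier := {c | ∀ s ∈ c.support, IsSmoothTriangle X s}
  zero_mem' := by simp
  add_mem' := by
    classical
    intro a b ha hb γ hγ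
    rcases Finset.mem_union.1 (Finsupp.support_add hγ) with h | h
    exacts [ha γ h, hb γ h]
  neg_mem' := by intro a ha γ hγ; exact ha γ (by simpa using hγ)

/-- The boundary of a `1`-chain: `∂γ = γ(1) - γ(0)`. -/
def boundary₁ (E : Type*) : ((unitInterval → E) →₀ ℤ) →+ (E →₀ ℤ) :=
  Finsupp.mapDomain.addMonoidHom (fun γ : unitInterval → E => γ 1)
    - Finsupp.mapDomain.addMonoidHom (fun γ : unitInterval → E => γ 0)

/-- The boundary of a `2`-chain: `∂s = s ∘ face₀ - s ∘ face₁ + s ∘ face₂`. -/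
def boundary₂ (E : Type*) : ((Triangle → E) →₀ ℤ) →+ ((unitInterval → E) →₀ ℤ) :=
  Finsupp.mapDomain.addMonoidHom (fun s : Triangle → E => s ∘ Triangle.face₀)
    - Finsupp.mapDomain.addMonoidHom (fun s : Triangle → E => s ∘ Triangle.face₁)
    + Finsupp.mapDomain.addMonoidHom (fun s : Triangle → E => s ∘ Triangle.face₂)

/-- Relative `1`-cycles of `(X, A)`: chains of `X` whose boundary is supported in `A`. -/
def cycles₁ (X A : Set E) : AddSubgroup ((unitInterval → E) →₀ ℤ) where
  carrier := {c | c ∈ chains₁ X ∧ ∀ x ∈ (boundary₁ E c).support, x ∈ A}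
  zero_mem' := by simp [zero_mem]
  add_mem' := by
    classical
    rintro a b ⟨ha, ha'⟩ ⟨hb, hb'⟩
    refine ⟨add_mem ha hb, fun x hx => ?_⟩
    rw [map_add] at hx
    rcases Finset.mem_union.1 (Finsupp.support_add hx) with h | h
    exacts [ha' x h, hb' x h]
  neg_mem' := by
    rintro a ⟨ha, ha'⟩
    exact ⟨neg_mem ha, fun x hx => ha' x (by simpa using hx)⟩

/-- Relative `1`-boundaries of `(X, A)`: boundaries of `2`-chains of `X` plus chains of `A`. -/
def boundaries₁ (X A : Set E) : AddSubgroup ((unitInterval → E) →₀ ℤ) :=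
  (chains₂ X).map (boundary₂ E) ⊔ chains₁ A

/-- The first smooth singular homology group `H₁(X, A)` with integer coefficients; the absolute
group `H₁(X)` is `H₁(X, ∅)`. -/
abbrev H₁ (X A : Set E) : Type _ :=
  cycles₁ X A ⧸ (boundaries₁ X A).addSubgroupOf (cycles₁ X A)

/-- The homology class of a relative cycle. -/
def H₁.mk {X A : Set E} (c : cycles₁ X A) : H₁ X A := QuotientAddGroup.mk c

/-- A relative cycle representing a homology class. -/
def H₁.rep {X A : Set E} (σ : H₁ X A) : cycles₁ X A := Quotient.out σ

/-- Push-forward of `1`-chains. -/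
def push₁ (f : E → F) : ((unitInterval → E) →₀ ℤ) →+ ((unitInterval → F) →₀ ℤ) :=
  Finsupp.mapDomain.addMonoidHom (fun γ => f ∘ γ)

theorem push₁_mem_chains {f : E → F} (hf : ContDiff ℝ ∞ f) {X : Set E} {Y : Set F}
    (h : Set.MapsTo f X Y) {c : (unitInterval → E) →₀ ℤ} (hc : c ∈ chains₁ X) : push₁ f c ∈ chains₁ Y := by
  classical
  intro γ hγ
  obtain ⟨γ', h', rfl⟩ := Finset.mem_image.1 (Finsupp.mapDomain_support hγ)
  obtain ⟨⟨g, hg, hgγ⟩, hX⟩ := hc γ' h'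
  exact ⟨⟨f ∘ g, hf.comp hg, fun t => by simp [hgγ]⟩, fun t => h (hX t)⟩

theorem push₁_mem_cycles {f : E → F} (hf : ContDiff ℝ ∞ f) {X A : Set E} {Y B : Set F}
    (h : Set.MapsTo f X Y) (h' : Set.MapsTo f A B) {c : (unitInterval → E) →₀ ℤ} (hc : c ∈ cycles₁ X A) :
    push₁ f c ∈ cycles₁ Y B := by
  classical
  refine ⟨push₁_mem_chains hf h hc.1, fun x hx => ?_⟩
  have e : boundary₁ F (push₁ f c) = Finsupp.mapDomain f (boundary₁ E c) := by
    have : (boundary₁ F).comp (push₁ f)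
        = (Finsupp.mapDomain.addMonoidHom f).comp (boundary₁ E) := by
      ext γ : 2
      simp [boundary₁, push₁, Finsupp.mapDomain_single, sub_eq_add_neg, map_add, map_neg]
    exact DFunLike.congr_fun this c
  rw [e] at hx
  obtain ⟨y, hy, rfl⟩ := Finset.mem_image.1 (Finsupp.mapDomain_support hx)
  exact h' (hc.2 y hy)

theorem push₁_mem_boundaries {f : E → F} (hf : ContDiff ℝ ∞ f) {X A : Set E} {Y B : Set F}
    (h : Set.MapsTo f X Y) (h' : Set.MapsTo f A B) {c : (unitInterval → E) →₀ ℤ}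
    (hc : c ∈ boundaries₁ X A) : push₁ f c ∈ boundaries₁ Y B := by
  classical
  obtain ⟨_, ⟨d, hd, rfl⟩, e, he, rfl⟩ := AddSubgroup.mem_sup.1 hc
  rw [map_add]
  refine add_mem (AddSubgroup.mem_sup_left ?_)
    (AddSubgroup.mem_sup_right (push₁_mem_chains hf h' he))
  refine ⟨Finsupp.mapDomain.addMonoidHom (fun s : Triangle → E => f ∘ s) d, ?_, ?_⟩
  · intro s hs
    obtain ⟨s', h1, rfl⟩ := Finset.mem_image.1 (Finsupp.mapDomain_support hs)
    obtain ⟨⟨g, hg, hgγ⟩, hX⟩ := hd s' h1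
    exact ⟨⟨f ∘ g, hf.comp hg, fun t => by simp [hgγ]⟩, fun t => h (hX t)⟩
  · have : (boundary₂ F).comp
          (Finsupp.mapDomain.addMonoidHom (fun s : Triangle → E => f ∘ s))
        = (push₁ f).comp (boundary₂ E) := by
      ext s : 2
      simp [boundary₂, push₁, Finsupp.mapDomain_single, sub_eq_add_neg, map_add, map_neg,
        Function.comp_assoc]
    exact DFunLike.congr_fun this d

/-- The map in homology induced by a smooth map of pairs. -/
def H₁.map (f : E → F) (hf : ContDiff ℝ ∞ f) {X A : Set E} {Y B : Set F}
    (h : Set.MapsTo f X Y) (h' : Set.MapsTo f A B) : H₁ X A →+ H₁ Y B :=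
  QuotientAddGroup.map _ _
    (((push₁ f).comp (cycles₁ X A).subtype).codRestrict (cycles₁ Y B)
      (fun c => push₁_mem_cycles hf h h' c.2))
    (fun c hc => by
      simp only [AddSubgroup.mem_comap, AddSubgroup.mem_addSubgroupOf] at hc ⊢
      exact push₁_mem_boundaries hf h h' hc)

end Homology

/-! ## Integrals over chains in the plane -/

/-- `∫_γ f(t) dt`. -/
def pathIntegral (f : ℂ → ℂ) (γ : unitInterval → ℂ) : ℂ :=
  ∫ s in (0 : ℝ)..1, f (Set.IccExtend zero_le_one γ s) *
    derivWithin (Set.IccExtend zero_le_one γ) (Set.Icc 0 1) s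

/-- `∫_c f(t) dt` for a `1`-chain `c`. -/
def chainIntegral (f : ℂ → ℂ) (c : (unitInterval → ℂ) →₀ ℤ) : ℂ :=
  c.sum fun γ n => (n : ℂ) * pathIntegral f γ

theorem pathIntegral_eq {f : ℂ → ℂ} {γ : unitInterval → ℂ} {g : ℝ → ℂ} (hg : ContDiff ℝ ∞ g)
    (h : ∀ t : unitInterval, g t = γ t) :
    pathIntegral f γ = ∫ s in (0 : ℝ)..1, f (g s) * deriv g s := by
  have e : Set.EqOn (Set.IccExtend zero_le_one γ) g (Set.Icc 0 1) := fun s hs => by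
    rw [Set.IccExtend_of_mem _ _ hs]; exact (h ⟨s, hs⟩).symm
  refine intervalIntegral.integral_congr fun s hs => ?_
  rw [Set.uIcc_of_le zero_le_one] at hs
  rw [e hs, derivWithin_congr e (e hs),
    (hg.differentiable (by simp)).differentiableAt.derivWithin
      (uniqueDiffOn_Icc zero_lt_one s hs)]

theorem intervalIntegrable_path {f : ℂ → ℂ} {X : Set ℂ} (hf : ContinuousOn f X) {g : ℝ → ℂ}
    (hg : ContDiff ℝ ∞ g) (hX : ∀ s ∈ Set.Icc (0 : ℝ) 1, g s ∈ X) :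
    IntervalIntegrable (fun s => f (g s) * deriv g s) MeasureTheory.volume 0 1 := by
  apply ContinuousOn.intervalIntegrable
  rw [Set.uIcc_of_le zero_le_one]
  exact (hf.comp hg.continuous.continuousOn hX).mul
    (hg.continuous_deriv (by simp)).continuousOn

theorem chainIntegral_sum {ι : Type*} (s : Finset ι) {f : ι → ℂ → ℂ} {X : Set ℂ}
    (hf : ∀ i ∈ s, ContinuousOn (f i) X) {c : (unitInterval → ℂ) →₀ ℤ} (hc : c ∈ chains₁ X) :
    ∑ i ∈ s, chainIntegral (f i) c = chainIntegral (fun t => ∑ i ∈ s, f i t) c := by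
  simp only [chainIntegral, Finsupp.sum]
  rw [Finset.sum_comm]
  refine Finset.sum_congr rfl fun γ hγ => ?_
  obtain ⟨⟨g, hg, hgγ⟩, hX⟩ := hc γ hγ
  have hX' : ∀ s ∈ Set.Icc (0 : ℝ) 1, g s ∈ X := fun s hs => by
    rw [hgγ ⟨s, hs⟩]; exact hX _
  simp only [pathIntegral_eq hg hgγ, ← Finset.mul_sum]
  rw [← intervalIntegral.integral_finsetSum
    (fun i hi => intervalIntegrable_path (hf i hi) hg hX')]
  simp only [Finset.sum_mul]

/-- The integral of an exact form over a relative cycle vanishes if the primitive vanishes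
on the subspace. -/
theorem chainIntegral_exact {f G : ℂ → ℂ} {X A : Set ℂ} (hf : ContinuousOn f X)
    (hG : ∀ x ∈ X, HasDerivAt G (f x) x) (hA : ∀ x ∈ A, G x = 0) {c : (unitInterval → ℂ) →₀ ℤ}
    (hc : c ∈ cycles₁ X A) : chainIntegral f c = 0 := by
  let L : (ℂ →₀ ℤ) →+ ℂ := Finsupp.liftAddHom fun x => (AddMonoidHom.mulRight (G x)).comp
    (Int.castAddHom ℂ)
  have hL : ∀ d : ℂ →₀ ℤ, L d = d.sum fun x n => (n : ℂ) * G x := fun d => rfl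
  have e : chainIntegral f c = L (boundary₁ ℂ c) := by
    have h1 : L (boundary₁ ℂ c) = c.sum fun γ n => (n : ℂ) * (G (γ 1) - G (γ 0)) := by
      have : L.comp (boundary₁ ℂ) = Finsupp.liftAddHom fun γ : unitInterval → ℂ =>
          (AddMonoidHom.mulRight (G (γ 1) - G (γ 0))).comp (Int.castAddHom ℂ) := by
        ext γ : 2
        simp [boundary₁, hL, Finsupp.mapDomain_single]
      exact DFunLike.congr_fun this c
    rw [h1]
    refine Finset.sum_congr rfl fun γ hγ => ?_
    obtain ⟨⟨g, hg, hgγ⟩, hX⟩ := hc.1 γ hγ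
    have hX' : ∀ s ∈ Set.Icc (0 : ℝ) 1, g s ∈ X := fun s hs => by
      rw [hgγ ⟨s, hs⟩]; exact hX _
    simp only
    rw [pathIntegral_eq hg hgγ, intervalIntegral.integral_eq_sub_of_hasDerivAt
      (f := fun s => G (g s)) (fun s hs => ?_) (intervalIntegrable_path hf hg hX')]
    · rw [← hgγ 1, ← hgγ 0]; simp
    · rw [Set.uIcc_of_le zero_le_one] at hs
      exact (hG _ (hX' s hs)).comp s (hg.differentiable (by simp) s).hasDerivAt
  rw [e, hL]
  refine Finset.sum_eq_zero fun x hx => ?_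
  simp [hA x (hc.2 x hx)]

/-! ## The Knizhnik–Zamolodchikov equation -/

/-- The configuration space of `N` labelled distinct points in the plane. -/
abbrev Conf (N : ℕ) : Type := {z : Fin N → ℂ // Function.Injective z}

/-- A function on the configuration space, extended by zero to `ℂ^N`. -/
def extendConf {N : ℕ} {V : Type*} [Zero V] (ψ : Conf N → V) : (Fin N → ℂ) → V :=
  Function.extend Subtype.val ψ 0

theorem extendConf_apply {N : ℕ} {V : Type*} [Zero V] (ψ : Conf N → V) (z : Conf N) :
    extendConf ψ z.1 = ψ z := Subtype.val_injective.extend_apply ψ 0 z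

theorem extendConf_add {N : ℕ} {V : Type*} [AddZeroClass V] (ψ φ : Conf N → V) :
    extendConf (ψ + φ) = extendConf ψ + extendConf φ := by
  funext z
  by_cases h : Function.Injective z
  · simp [extendConf_apply _ (⟨z, h⟩ : Conf N)]
  · have : ¬ ∃ a : Conf N, a.1 = z := by rintro ⟨a, rfl⟩; exact h a.2
    simp [extendConf, Function.extend_apply' _ _ _ this]

theorem extendConf_smul {N : ℕ} {V : Type*} [AddCommGroup V] [Module ℂ V] (c : ℂ)
    (ψ : Conf N → V) : extendConf (c • ψ) = c • extendConf ψ := by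
  funext z
  by_cases h : Function.Injective z
  · simp [extendConf_apply _ (⟨z, h⟩ : Conf N)]
  · have : ¬ ∃ a : Conf N, a.1 = z := by rintro ⟨a, rfl⟩; exact h a.2
    simp [extendConf, Function.extend_apply' _ _ _ this]

theorem isOpen_conf (N : ℕ) : IsOpen {z : Fin N → ℂ | Function.Injective z} := by
  have : {z : Fin N → ℂ | Function.Injective z}
      = ⋂ i, ⋂ j, ⋂ _ : i ≠ j, {z : Fin N → ℂ | z i ≠ z j} := by
    ext z
    simp only [Set.mem_ofPred_eq, Set.mem_iInter, Function.Injective]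
    exact ⟨fun h i j hij e => hij (h e), fun h i j e => by_contra fun hij => h i j hij e⟩
  rw [this]
  refine isOpen_iInter_of_finite fun i => isOpen_iInter_of_finite fun j =>
    isOpen_iInter_of_finite fun _ => ?_
  exact isOpen_ne_fun (continuous_apply i) (continuous_apply j)

/-- The space `KZ(V, κ)` of holomorphic functions `ψ` on the configuration space with values in
the `S_N`-module `V` such that `∂ᵢ ψ = κ ∑_{j ≠ i} (s_{ij} + 1) ψ / (zᵢ - zⱼ)` for all `i`. -/
def KZ {N : ℕ} {V : Type*} [NormedAddCommGroup V] [NormedSpace ℂ V]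
    (ρ : Representation ℂ (Equiv.Perm (Fin N)) V) (κ : ℤ) : Submodule ℂ (Conf N → V) where
  carrier := {ψ | DifferentiableOn ℂ (extendConf ψ) {z | Function.Injective z} ∧
    ∀ (z : Conf N) (i : Fin N), fderiv ℂ (extendConf ψ) z.1 (Pi.single i 1)
      = (κ : ℂ) • ∑ j ∈ Finset.univ.erase i,
          (z.1 i - z.1 j)⁻¹ • (ρ (Equiv.swap i j) (ψ z) + ψ z)}
  zero_mem' := by
    have : extendConf (0 : Conf N → V) = 0 := by
      simpa using extendConf_smul (0 : ℂ) (0 : Conf N → V)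
    simp only [Set.mem_ofPred_eq, this]
    exact ⟨differentiableOn_const _, fun z i => by simp [fderiv_zero]⟩
  add_mem' := by
    rintro a b ⟨ha, ha'⟩ ⟨hb, hb'⟩
    simp only [Set.mem_ofPred_eq, extendConf_add]
    refine ⟨ha.add hb, fun z i => ?_⟩
    rw [fderiv_add (ha.differentiableAt ((isOpen_conf N).mem_nhds z.2))
      (hb.differentiableAt ((isOpen_conf N).mem_nhds z.2)), add_apply,
      ha', hb', ← smul_add, ← Finset.sum_add_distrib]
    congr 1
    refine Finset.sum_congr rfl fun j _ => ?_
    rw [← smul_add]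
    simp only [Pi.add_apply, map_add]
    congr 1
    abel
  smul_mem' := by
    rintro c a ⟨ha, ha'⟩
    simp only [Set.mem_ofPred_eq, extendConf_smul]
    refine ⟨ha.const_smul c, fun z i => ?_⟩
    rw [fderiv_const_smul (ha.differentiableAt ((isOpen_conf N).mem_nhds z.2)),
      smul_apply, ha', smul_comm, Finset.smul_sum]
    congr 1
    refine Finset.sum_congr rfl fun j _ => ?_
    simp only [Pi.smul_apply, map_smul]
    rw [← smul_add, smul_comm]

/-- The hyperplane `x₁ + ⋯ + x_N = 0` in `ℂ^N`. -/
def reflSpace (N : ℕ) : Submodule ℂ (Fin N → ℂ) where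
  carrier := {x | ∑ i, x i = 0}
  zero_mem' := by simp
  add_mem' := by
    intro a b ha hb
    simp only [Set.mem_ofPred_eq, Pi.add_apply, Finset.sum_add_distrib] at *
    simp [ha, hb]
  smul_mem' := by
    intro c a ha
    simp only [Set.mem_ofPred_eq, Pi.smul_apply, ← Finset.smul_sum] at *
    simp [ha]

/-- The reflection representation of `S_N`, of Young diagram `(N-1,1)`: permutation of
coordinates (`ε_b ↦ ε_{g(b)}`) on the hyperplane `x₁ + ⋯ + x_N = 0`. -/
def reflRep (N : ℕ) : Representation ℂ (Equiv.Perm (Fin N)) (reflSpace N) where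
  toFun g :=
    { toFun := fun x => ⟨fun i => x.1 (g⁻¹ i), by
        have : ∑ i, x.1 (g⁻¹ i) = ∑ i, x.1 i := Equiv.sum_comp g⁻¹ x.1
        exact this.trans x.2⟩
      map_add' := fun _ _ => rfl
      map_smul' := fun _ _ => rfl }
  map_one' := rfl
  map_mul' g h := by
    ext x i
    simp [mul_inv_rev]

/-! ## Cycles depending on the points -/

/-- The plane without the points `z₁, …, z_N`. -/
def punctured {N : ℕ} (z : Fin N → ℂ) : Set ℂ := {t | ∀ i, t ≠ z i}

/-- The total space over `U` of the bundle with fibre `ℂ ∖ {z₁, …, z_N}`. -/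
def puncturedTotal {N : ℕ} (U : Set (Fin N → ℂ)) : Set ((Fin N → ℂ) × ℂ) :=
  {p | p.1 ∈ U ∧ p.2 ∈ punctured p.1}

/-- The total space over `U` of the bundle with fibre `{z₁, …, z_N}`. -/
def pointsTotal {N : ℕ} (U : Set (Fin N → ℂ)) : Set ((Fin N → ℂ) × ℂ) :=
  {p | p.1 ∈ U ∧ p.2 ∈ Set.range p.1}

/-- The inclusion of the fibre over `z`, as a map `H₁(ℂ ∖ {zᵢ}) → H₁(total space)`. -/
def puncturedIncl {N : ℕ} (U : Set (Fin N → ℂ)) (z : Fin N → ℂ) (hz : z ∈ U) :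
    H₁ (punctured z) ∅ →+ H₁ (puncturedTotal U) ∅ :=
  H₁.map (fun t => (z, t)) (contDiff_const.prodMk contDiff_id)
    (fun _ ht => ⟨hz, ht⟩) (fun _ ht => ht)

/-- The inclusion of the fibre over `z`, as a map from `H₁(ℂ, {zᵢ})` to `H₁` of the total pair. -/
def relativeIncl {N : ℕ} (U : Set (Fin N → ℂ)) (z : Fin N → ℂ) (hz : z ∈ U) :
    H₁ (Set.univ : Set ℂ) (Set.range z) →+ H₁ (U ×ˢ (Set.univ : Set ℂ)) (pointsTotal U) :=
  H₁.map (fun t => (z, t)) (contDiff_const.prodMk contDiff_id)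
    (fun _ _ => ⟨hz, trivial⟩) (fun _ ht => ⟨hz, ht⟩)

/-- Horizontal (Gauss–Manin flat) sections of `H₁(ℂ ∖ {zᵢ})`: near each point of the
configuration space, the classes in the fibres are identified in the homology of the
restriction of the bundle to a ball. -/
def IsHorizontal {N : ℕ} (σ : (z : Conf N) → H₁ (punctured z.1) ∅) : Prop :=
  ∀ z₀ : Conf N, ∃ r > 0, Metric.ball z₀.1 r ⊆ {z | Function.Injective z} ∧
    ∀ (z z' : Conf N) (hz : z.1 ∈ Metric.ball z₀.1 r) (hz' : z'.1 ∈ Metric.ball z₀.1 r),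
      puncturedIncl _ z.1 hz (σ z) = puncturedIncl _ z'.1 hz' (σ z')

/-- Horizontal (Gauss–Manin flat) sections of `H₁(ℂ, {zᵢ})`. -/
def IsHorizontalRel {N : ℕ}
    (τ : (z : Conf N) → H₁ (Set.univ : Set ℂ) (Set.range z.1)) : Prop :=
  ∀ z₀ : Conf N, ∃ r > 0, Metric.ball z₀.1 r ⊆ {z | Function.Injective z} ∧
    ∀ (z z' : Conf N) (hz : z.1 ∈ Metric.ball z₀.1 r) (hz' : z'.1 ∈ Metric.ball z₀.1 r),
      relativeIncl _ z.1 hz (τ z) = relativeIncl _ z'.1 hz' (τ z')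

/-! ## The intersection number -/

/-- The path running along the segment from `e.1` to `e.2`. -/
def segmentPath (e : ℂ × ℂ) : unitInterval → ℂ := fun t => e.1 + ((t : ℝ) : ℂ) * (e.2 - e.1)

/-- The singular chain of a formal combination of oriented segments. -/
def polygonChain (c : (ℂ × ℂ) →₀ ℤ) : (unitInterval → ℂ) →₀ ℤ := c.mapDomain segmentPath

/-- Two segments are in general position if no endpoint of one of them lies on the other; then
they are disjoint or cross transversally at one point, interior to both. -/
def GeneralPosition (e f : ℂ × ℂ) : Prop :=
  e.1 ∉ segment ℝ f.1 f.2 ∧ e.2 ∉ segment ℝ f.1 f.2 ∧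
    f.1 ∉ segment ℝ e.1 e.2 ∧ f.2 ∉ segment ℝ e.1 e.2

open Classical in
/-- The local intersection index of two oriented segments in general position: `0` if they do
not meet, and otherwise `1` or `-1` as the directions of `e` and `f` form a positively or a
negatively oriented basis of the plane. -/
def crossingIndex (e f : ℂ × ℂ) : ℤ :=
  if Disjoint (segment ℝ e.1 e.2) (segment ℝ f.1 f.2) then 0
  else SignType.sign ((e.2 - e.1).re * (f.2 - f.1).im - (e.2 - e.1).im * (f.2 - f.1).re)

/-- `k` is the number of intersections, counted with sign, of polygonal representatives of
`σ ∈ H₁(ℂ ∖ {zᵢ})` and `τ ∈ H₁(ℂ, {zᵢ})` in general position. -/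
def IsIntersectionNumber {N : ℕ} {z : Fin N → ℂ} (σ : H₁ (punctured z) ∅)
    (τ : H₁ (Set.univ : Set ℂ) (Set.range z)) (k : ℤ) : Prop :=
  ∃ (c d : (ℂ × ℂ) →₀ ℤ) (hc : polygonChain c ∈ cycles₁ (punctured z) ∅)
    (hd : polygonChain d ∈ cycles₁ (Set.univ : Set ℂ) (Set.range z)),
    σ = H₁.mk ⟨_, hc⟩ ∧ τ = H₁.mk ⟨_, hd⟩ ∧
    (∀ e ∈ c.support, ∀ f ∈ d.support, GeneralPosition e f) ∧
    k = c.sum fun e n => d.sum fun f n' => n * n' * crossingIndex e f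

open Classical in
/-- The intersection number `σ · τ`. -/
def intersectionNumber {N : ℕ} {z : Fin N → ℂ} (σ : H₁ (punctured z) ∅)
    (τ : H₁ (Set.univ : Set ℂ) (Set.range z)) : ℤ :=
  if h : ∃ k, IsIntersectionNumber σ τ k then h.choose else 0

/-! ## The integral solutions -/

/-- `∏_{i<j} (zᵢ - zⱼ)^{2m}`. -/
def discPow {N : ℕ} (m : ℕ) (z : Fin N → ℂ) : ℂ :=
  ∏ i, ∏ j ∈ Finset.Ioi i, (z i - z j) ^ (2 * m)

/-- The function `∏ᵢ (t - zᵢ)^{-m} / (t - z_b)` of `t ∈ ℂ ∖ {zᵢ}`. -/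
def psiIntegrand {N : ℕ} (m : ℕ) (z : Fin N → ℂ) (b : Fin N) (t : ℂ) : ℂ :=
  (∏ i, (t - z i) ^ m)⁻¹ * (t - z b)⁻¹

/-- The polynomial `∏ᵢ (t - zᵢ)^m / (t - z_b)` in `t`, for `m > 0`. -/
def phiIntegrand {N : ℕ} (m : ℕ) (z : Fin N → ℂ) (b : Fin N) (t : ℂ) : ℂ :=
  (∏ i ∈ Finset.univ.erase b, (t - z i) ^ m) * (t - z b) ^ (m - 1)

theorem prod_ne_zero_of_punctured {N : ℕ} (m : ℕ) {z : Fin N → ℂ} {t : ℂ}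
    (ht : t ∈ punctured z) : ∏ i, (t - z i) ^ m ≠ 0 :=
  Finset.prod_ne_zero_iff.2 fun i _ => pow_ne_zero _ (sub_ne_zero.2 (ht i))

theorem continuousOn_psiIntegrand {N : ℕ} (m : ℕ) (z : Fin N → ℂ) (b : Fin N) :
    ContinuousOn (psiIntegrand m z b) (punctured z) := by
  refine ContinuousOn.mul (ContinuousOn.inv₀ (by fun_prop)
    (fun t ht => prod_ne_zero_of_punctured m ht)) (ContinuousOn.inv₀ (by fun_prop) ?_)
  exact fun t ht => sub_ne_zero.2 (ht b)

theorem continuous_phiIntegrand {N : ℕ} (m : ℕ) (z : Fin N → ℂ) (b : Fin N) :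
    Continuous (phiIntegrand m z b) := by
  unfold phiIntegrand; fun_prop

theorem hasDerivAt_prod_pow {N : ℕ} (m : ℕ) (z : Fin N → ℂ) (t : ℂ) :
    HasDerivAt (fun t => ∏ i, (t - z i) ^ m) (m * ∑ b, phiIntegrand m z b t) t := by
  have h := HasDerivAt.fun_finsetProd (u := Finset.univ) (x := t)
    (f := fun i (t : ℂ) => (t - z i) ^ m) (f' := fun i => m * (t - z i) ^ (m - 1))
    (fun i _ => by
      simpa [Pi.pow_def] using ((hasDerivAt_id t).sub_const (z i)).pow m)
  refine h.congr_deriv ?_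
  rw [Finset.mul_sum]
  refine Finset.sum_congr rfl fun b _ => ?_
  simp only [phiIntegrand, smul_eq_mul]
  ring

theorem sum_psiIntegrand {N : ℕ} {m : ℕ} (hm : 0 < m) {z : Fin N → ℂ} {t : ℂ}
    (ht : t ∈ punctured z) : ∑ b, psiIntegrand m z b t
      = ((∏ i, (t - z i) ^ m) ^ 2)⁻¹ * ∑ b, phiIntegrand m z b t := by
  rw [Finset.mul_sum]
  refine Finset.sum_congr rfl fun b _ => ?_
  have h0 := prod_ne_zero_of_punctured m ht
  have hb : t - z b ≠ 0 := sub_ne_zero.2 (ht b)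
  have h1 : phiIntegrand m z b t * (t - z b) = ∏ i, (t - z i) ^ m := by
    rw [phiIntegrand, mul_assoc, ← pow_succ, Nat.sub_add_cancel hm,
      Finset.prod_erase_mul _ _ (Finset.mem_univ b)]
  rw [psiIntegrand, eq_comm, eq_mul_inv_iff_mul_eq₀ hb, mul_assoc, h1]
  field_simp

/-- For a class `σ ∈ H₁(ℂ ∖ {zᵢ})`, the vector
`ψ_σ(z) = ∏_{i<j} (zᵢ - zⱼ)^{2m} · (2πi)⁻¹ ∫_σ ∏ᵢ (t - zᵢ)^{-m} ∑_b ε_b dt / (t - z_b)`,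
computed on a cycle representing the class (the form is closed, so all of them give the same). -/
def psi {N : ℕ} (m : ℕ) (hm : 0 < m) (z : Conf N) (σ : H₁ (punctured z.1) ∅) : reflSpace N :=
  ⟨fun b => discPow m z.1 *
      ((2 * Real.pi * Complex.I)⁻¹ * chainIntegral (psiIntegrand m z.1 b) σ.rep.1), by
    change ∑ b, _ = (0 : ℂ)
    rw [← Finset.mul_sum, ← Finset.mul_sum, chainIntegral_sum Finset.univ
      (fun b _ => continuousOn_psiIntegrand m z.1 b) σ.rep.2.1,
      chainIntegral_exact (X := punctured z.1) (A := ∅)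
        (G := fun t => -(m : ℂ)⁻¹ * (∏ i, (t - z.1 i) ^ m)⁻¹) ?_ ?_ (by simp) σ.rep.2]
    · simp
    · exact continuousOn_finsetSum _ fun b _ => continuousOn_psiIntegrand m z.1 b
    · intro t ht
      have h0 := prod_ne_zero_of_punctured m ht
      refine (((hasDerivAt_prod_pow m z.1 t).inv h0).const_mul (-(m : ℂ)⁻¹)).congr_deriv ?_
      rw [sum_psiIntegrand hm ht]
      have : (m : ℂ) ≠ 0 := by exact_mod_cast hm.ne'
      field_simp⟩

/-- For a class `τ ∈ H₁(ℂ, {zᵢ})`, the vector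
`φ_τ(z) = ∏_{i<j} (zᵢ - zⱼ)^{-2m} ∫_τ ∏ᵢ (t - zᵢ)^m ∑_b ε_b dt / (t - z_b)`,
computed on a cycle representing the class (the form is closed, so all of them give the same). -/
def phi {N : ℕ} (m : ℕ) (hm : 0 < m) (z : Conf N)
    (τ : H₁ (Set.univ : Set ℂ) (Set.range z.1)) : reflSpace N :=
  ⟨fun b => (discPow m z.1)⁻¹ * chainIntegral (phiIntegrand m z.1 b) τ.rep.1, by
    change ∑ b, _ = (0 : ℂ)
    rw [← Finset.mul_sum, chainIntegral_sum Finset.univ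
      (fun b _ => (continuous_phiIntegrand m z.1 b).continuousOn) τ.rep.2.1,
      chainIntegral_exact (X := Set.univ) (A := Set.range z.1)
        (G := fun t => (m : ℂ)⁻¹ * ∏ i, (t - z.1 i) ^ m) ?_ ?_ ?_ τ.rep.2]
    · simp
    · exact continuousOn_finsetSum _ fun b _ => (continuous_phiIntegrand m z.1 b).continuousOn
    · intro t _
      refine ((hasDerivAt_prod_pow m z.1 t).const_mul ((m : ℂ)⁻¹)).congr_deriv ?_
      have : (m : ℂ) ≠ 0 := by exact_mod_cast hm.ne'
      field_simp
    · rintro _ ⟨i, rfl⟩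
      have : ∏ j, (z.1 i - z.1 j) ^ m = 0 :=
        Finset.prod_eq_zero (Finset.mem_univ i) (by simp [hm.ne'])
      simp [this]⟩

/-- The canonical pairing `⟨v, w⟩` of `W` and `W*`, where `W*` is identified with `W`
through `θ : W* ≃ W`. -/
def pairing {N : ℕ} (θ : Module.Dual ℂ (reflSpace N) ≃ₗ[ℂ] reflSpace N)
    (v w : reflSpace N) : ℂ := θ.symm w v

end

/-!
The solutions `ψ_σ` and `φ_τ` are governed by two families of discrete invariants: the winding
numbers `n_i(σ)` of an absolute class around the points `z_i` (`windingNumber`), and the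
multiplicities `w_i(τ)` of the points `z_i` in the boundary of a relative class (`boundaryMult`).
Both extend to the homology of the bundle over a ball, hence are constant for horizontal classes,
since the configuration space is connected.

*The pairing.* Let `P(t) = ∏ (t - z_i)^m`, and let `q(s,t) = (P(t) - P(s)) / (t - s)` be its divided
difference, a polynomial. The sum over `b` of the products of the two integrands at `s ∈ σ` and
`t ∈ τ` equals `-1/m` times `∂_t (q(s,t) / P(s)) + ∂_s (q(s,t) / P(s))` (in essence
`sum_inv_mul_phiIntegrand`). The second term is exact in `s` and does not contribute. The first is
exact in `t`, and the value of `q(s,t) / P(s)` at `t = z_i` is `1 / (s - z_i)`. The result is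
`∑_b ψ_σ,b φ_τ,b = -(1/m) ∑_i w_i(τ) n_i(σ)` (`reflDot_psi_phi`). Small circles around `z_a` and
segments from `z_b` to a fixed point `z_l` therefore give dual bases, and the `ψ_σ` and `φ_τ` of
horizontal classes are combinations of these with constant coefficients.

*The equation.* Each coordinate of the solution attached to a segment is differentiated under the
integral sign along the directions `i` different from that coordinate, and the remaining coordinate
is determined as the sum vanishes (`phiSegment_mem_KZ`). The KZ operator is symmetric for the
standard form, so the pairing of solutions for `κ` and `-κ` is constant
(`reflDot_const_of_mem_KZ`). A family dual to a basis of solutions for `-κ` consists of solutions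
for `κ` (`mem_KZ_of_dual`), which gives the circles, and the constancy of the pairing shows that
circles and segments span all solutions.

*The intersection number.* A crossing of a segment `e` with a segment from `p` to `q` is the jump
of the principal branch of `log ((t - q) / (t - p))`, whose cut is the second segment
(`crossingIndex_eq`). Over a closed polygon the values of the logarithm cancel, so that the sum of
the crossings is the difference of the winding numbers around `q` and `p`; summing over the
segments of `τ` yields `∑_i w_i(τ) n_i(σ)` (`IsIntersectionNumber.eq_sum`). Representatives in
general position exist: subdivide `σ` into a polygon, and replace `τ` by a cone over its boundary
with generic apex (`exists_isIntersectionNumber`).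

Finally, an invariant form on the reflection representation is a multiple of the standard one
(`exists_pairing_eq`).
-/

open scoped ContDiff Matrix

/-! ### Cycles, boundaries and homomorphisms out of homology -/

section HomologyLemmas

theorem push₁_single {E F : Type*} (f : E → F) (γ : unitInterval → E) (n : ℤ) :
    push₁ f (Finsupp.single γ n) = Finsupp.single (f ∘ γ) n := by
  simp [push₁, Finsupp.mapDomain_single]

variable {E : Type*} [NormedAddCommGroup E] [NormedSpace ℝ E]

theorem boundary₁_single (E : Type*) (γ : unitInterval → E) (n : ℤ) :
    boundary₁ E (Finsupp.single γ n) = Finsupp.single (γ 1) n - Finsupp.single (γ 0) n := by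
  simp [boundary₁, Finsupp.mapDomain_single]

theorem boundary₂_single (E : Type*) (s : Triangle → E) (n : ℤ) :
    boundary₂ E (Finsupp.single s n) = Finsupp.single (s ∘ Triangle.face₀) n
      - Finsupp.single (s ∘ Triangle.face₁) n + Finsupp.single (s ∘ Triangle.face₂) n := by
  simp [boundary₂, Finsupp.mapDomain_single]

theorem boundary₁_boundary₂ (E : Type*) (c : (Triangle → E) →₀ ℤ) :
    boundary₁ E (boundary₂ E c) = 0 := by
  have : (boundary₁ E).comp (boundary₂ E) = 0 := by
    refine Finsupp.addHom_ext fun s n => ?_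
    have h1 : Triangle.face₁ 1 = Triangle.face₀ 1 := by
      apply Subtype.ext; simp [Triangle.face₁, Triangle.face₀]
    have h2 : Triangle.face₂ 1 = Triangle.face₀ 0 := by
      apply Subtype.ext; simp [Triangle.face₂, Triangle.face₀]
    have h3 : Triangle.face₂ 0 = Triangle.face₁ 0 := by
      apply Subtype.ext; simp [Triangle.face₂, Triangle.face₁]
    simp [boundary₂_single, boundary₁_single, h1, h2, h3]
  exact DFunLike.congr_fun this c

theorem eq_zero_of_forall_single {ι M : Type*} [AddCommGroup M] (L : (ι →₀ ℤ) →+ M)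
    {c : ι →₀ ℤ} (h : ∀ i ∈ c.support, L (Finsupp.single i 1) = 0) : L c = 0 := by
  rw [← Finsupp.sum_single c, Finsupp.sum, map_sum]
  refine Finset.sum_eq_zero fun i hi => ?_
  have : Finsupp.single i (c i) = c i • Finsupp.single i (1 : ℤ) := by simp
  rw [this, map_zsmul, h i hi, smul_zero]

/-- A homomorphism kills all boundaries of `(X, A)` as soon as it kills the boundaries of smooth
triangles in `X` and the smooth paths in `A`. -/
theorem eq_zero_of_mem_boundaries {M : Type*} [AddCommGroup M] {X A : Set E}
    (L : ((unitInterval → E) →₀ ℤ) →+ M)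
    (h₂ : ∀ s, IsSmoothTriangle X s → L (boundary₂ E (Finsupp.single s 1)) = 0)
    (h₁ : ∀ γ, IsSmoothPath A γ → L (Finsupp.single γ 1) = 0)
    {c : (unitInterval → E) →₀ ℤ} (hc : c ∈ boundaries₁ X A) : L c = 0 := by
  obtain ⟨_, ⟨d, hd, rfl⟩, e, he, rfl⟩ := AddSubgroup.mem_sup.1 hc
  rw [map_add, eq_zero_of_forall_single L fun γ hγ => h₁ γ (he γ hγ), add_zero]
  exact eq_zero_of_forall_single (L.comp (boundary₂ E)) fun s hs => h₂ s (hd s hs)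

theorem H₁.mk_eq_mk_iff {X A : Set E} {c d : cycles₁ X A} :
    H₁.mk c = H₁.mk d ↔ (c : (unitInterval → E) →₀ ℤ) - d ∈ boundaries₁ X A := by
  rw [H₁.mk, H₁.mk, QuotientAddGroup.eq, AddSubgroup.mem_addSubgroupOf, ← neg_mem_iff]
  simp [sub_eq_add_neg, add_comm]

theorem H₁.mk_rep {X A : Set E} (σ : H₁ X A) : H₁.mk σ.rep = σ := Quotient.out_eq σ

theorem H₁.mk_surjective {X A : Set E} (σ : H₁ X A) : ∃ c, H₁.mk c = σ := ⟨_, H₁.mk_rep σ⟩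

/-- The homomorphism on `H₁(X, A)` induced by a homomorphism on chains that kills boundaries. -/
noncomputable def H₁.lift {M : Type*} [AddCommGroup M] {X A : Set E}
    (L : ((unitInterval → E) →₀ ℤ) →+ M)
    (hL : ∀ c ∈ boundaries₁ X A, L c = 0) : H₁ X A →+ M :=
  QuotientAddGroup.lift _ (L.comp (cycles₁ X A).subtype)
    (fun c hc => hL c (AddSubgroup.mem_addSubgroupOf.1 hc))

@[simp] theorem H₁.lift_mk {M : Type*} [AddCommGroup M] {X A : Set E}
    (L : ((unitInterval → E) →₀ ℤ) →+ M) (hL : ∀ c ∈ boundaries₁ X A, L c = 0)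
    (c : cycles₁ X A) : H₁.lift L hL (H₁.mk c) = L c := rfl

theorem single_mem_chains₁ {X : Set E} {γ : unitInterval → E} (h : IsSmoothPath X γ) (n : ℤ) :
    Finsupp.single γ n ∈ chains₁ X := by
  intro γ' hγ'
  rw [Finset.mem_singleton.1 (Finsupp.support_single_subset hγ')]
  exact h

theorem boundary₂_single_mem {X A : Set E} {s : Triangle → E} (h : IsSmoothTriangle X s) :
    Finsupp.single (s ∘ Triangle.face₀) (1 : ℤ) - Finsupp.single (s ∘ Triangle.face₁) 1
      + Finsupp.single (s ∘ Triangle.face₂) 1 ∈ boundaries₁ X A := by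
  rw [← boundary₂_single]
  refine AddSubgroup.mem_sup_left ⟨_, ?_, rfl⟩
  intro s' hs'
  rw [Finset.mem_singleton.1 (Finsupp.support_single_subset hs')]
  exact h

theorem single_mem_boundaries {X A : Set E} {γ : unitInterval → E} (h : IsSmoothPath A γ) :
    Finsupp.single γ (1 : ℤ) ∈ boundaries₁ X A :=
  AddSubgroup.mem_sup_right (single_mem_chains₁ h 1)

theorem single_const_mem_boundaries {X A : Set E} {p : E} (hp : p ∈ X) :
    Finsupp.single (fun _ : unitInterval => p) (1 : ℤ) ∈ boundaries₁ X A := by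
  have := boundary₂_single_mem (A := A) (X := X) (s := fun _ => p)
    ⟨⟨fun _ => p, contDiff_const, fun _ => rfl⟩, fun _ => hp⟩
  simpa [Function.comp_def] using this

/-- The boundary of a smooth square, cut into two triangles along the diagonal. -/
theorem square_mem_boundaries {X A : Set E} {h : ℝ × ℝ → E} (hh : ContDiff ℝ ∞ h)
    (hX : ∀ s ∈ Set.Icc (0 : ℝ) 1, ∀ u ∈ Set.Icc (0 : ℝ) 1, h (s, u) ∈ X) :
    Finsupp.single (fun t : unitInterval => h (1, t)) (1 : ℤ)
      + Finsupp.single (fun t : unitInterval => h (t, 0)) 1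
      - Finsupp.single (fun t : unitInterval => h (t, 1)) 1
      - Finsupp.single (fun t : unitInterval => h (0, t)) 1 ∈ boundaries₁ X A := by
  have h1 := boundary₂_single_mem (A := A) (X := X)
    (s := fun p : Triangle => h (p.1.1 + p.1.2, p.1.2))
    ⟨⟨fun p => h (p.1 + p.2, p.2), hh.comp (by fun_prop), fun _ => rfl⟩, fun p =>
      hX _ ⟨by linarith [p.2.1, p.2.2.1], p.2.2.2⟩ _
        ⟨p.2.2.1, by linarith [p.2.1, p.2.2.2]⟩⟩
  have h2 := boundary₂_single_mem (A := A) (X := X)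
    (s := fun p : Triangle => h (p.1.2, p.1.1 + p.1.2))
    ⟨⟨fun p => h (p.2, p.1 + p.2), hh.comp (by fun_prop), fun _ => rfl⟩, fun p =>
      hX _ ⟨p.2.2.1, by linarith [p.2.1, p.2.2.2]⟩ _
        ⟨by linarith [p.2.1, p.2.2.1], p.2.2.2⟩⟩
  have := sub_mem h1 h2
  simp only [Function.comp_def, Triangle.face₀, Triangle.face₁, Triangle.face₂, zero_add,
    add_zero, sub_add_cancel] at this
  convert this using 1
  abel

/-- Subdivision of a smooth path. -/
theorem subdivide_mem_boundaries {X A : Set E} {g : ℝ → E} (hg : ContDiff ℝ ∞ g)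
    {a b c : ℝ} (hab : a ≤ b) (hbc : b ≤ c) (hX : ∀ s ∈ Set.Icc a c, g s ∈ X) :
    Finsupp.single (fun t : unitInterval => g (a + t * (c - a))) (1 : ℤ)
      - Finsupp.single (fun t : unitInterval => g (a + t * (b - a))) 1
      - Finsupp.single (fun t : unitInterval => g (b + t * (c - b))) 1 ∈ boundaries₁ X A := by
  have h1 := boundary₂_single_mem (A := A) (X := X)
    (s := fun p : Triangle => g (a + p.1.1 * (b - a) + p.1.2 * (c - a)))
    ⟨⟨fun p => g (a + p.1 * (b - a) + p.2 * (c - a)), hg.comp (by fun_prop), fun _ => rfl⟩,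
      fun p => hX _ ?_⟩
  · convert neg_mem h1 using 1
    have e : ∀ t : ℝ, a + (1 - t) * (b - a) + t * (c - a) = b + t * (c - b) := fun t => by ring
    simp only [Function.comp_def, Triangle.face₀, Triangle.face₁, Triangle.face₂, zero_mul,
      add_zero, e]
    abel
  · obtain ⟨⟨x, y⟩, hx, hy, hxy⟩ := p
    simp only at hx hy hxy ⊢
    constructor
    · nlinarith
    · nlinarith

end HomologyLemmas

/-! ### Integrals of holomorphic forms and Stokes' theorem -/

/-- Integration over chains as a homomorphism. -/
noncomputable def chainIntegralHom (f : ℂ → ℂ) : ((unitInterval → ℂ) →₀ ℤ) →+ ℂ :=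
  Finsupp.liftAddHom fun γ => zmultiplesHom ℂ (pathIntegral f γ)

theorem chainIntegralHom_apply (f : ℂ → ℂ) (c : (unitInterval → ℂ) →₀ ℤ) :
    chainIntegralHom f c = chainIntegral f c := by
  simp only [chainIntegralHom, chainIntegral, Finsupp.liftAddHom_apply]
  exact Finsupp.sum_congr fun γ _ => by simp

theorem chainIntegralHom_single (f : ℂ → ℂ) (γ : unitInterval → ℂ) :
    chainIntegralHom f (Finsupp.single γ 1) = pathIntegral f γ := by
  simp [chainIntegralHom]

/-- If a 1-form `η` has the primitive `F` on a set, its integral along a segment in this set is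
the difference of the values of `F`. -/
theorem integral_segment_of_primitive {V : Type*} [NormedAddCommGroup V] [NormedSpace ℝ V]
    {T : Set V} {η : V → V →L[ℝ] ℂ} {F : V → ℂ} (hη : ContinuousOn η T)
    (hF : ∀ p ∈ T, HasFDerivWithinAt F (η p) T p) {a v : V}
    (hT : ∀ t ∈ Set.Icc (0 : ℝ) 1, a + t • v ∈ T) :
    ∫ t in (0 : ℝ)..1, η (a + t • v) v = F (a + v) - F a := by
  have hd : ∀ t ∈ Set.Icc (0 : ℝ) 1, HasDerivWithinAt (fun t : ℝ => F (a + t • v))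
      (η (a + t • v) v) (Set.Icc 0 1) t := fun t ht => by
    have h1 : HasDerivWithinAt (fun t : ℝ => a + t • v) v (Set.Icc 0 1) t := by
      simpa using (((hasDerivAt_id t).smul_const v).const_add a).hasDerivWithinAt
    exact (hF _ (hT t ht)).comp_hasDerivWithinAt t h1 hT
  have hc : ContinuousOn (fun t : ℝ => η (a + t • v) v) (Set.Icc 0 1) :=
    (hη.comp (by fun_prop) hT).clm_apply continuousOn_const
  have := intervalIntegral.integral_eq_sub_of_hasDerivAt_of_le zero_le_one
    (f := fun t : ℝ => F (a + t • v)) (f' := fun t => η (a + t • v) v)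
    (fun t ht => (hd t ht).continuousWithinAt)
    (fun t ht => (hd t (Set.Ioo_subset_Icc_self ht)).hasDerivAt (Icc_mem_nhds ht.1 ht.2))
    (hc.intervalIntegrable_of_Icc zero_le_one)
  simpa using this

/-- Stokes' theorem for a holomorphic form on a smooth triangle: the pull-back of the form to the
(convex) standard triangle is closed, hence exact. -/
theorem chainIntegral_boundary_triangle {X : Set ℂ} (hXo : IsOpen X) {f : ℂ → ℂ}
    (hf : DifferentiableOn ℂ f X) {s : Triangle → ℂ} (hs : IsSmoothTriangle X s) :
    chainIntegralHom f (boundary₂ ℂ (Finsupp.single s 1)) = 0 := by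
  obtain ⟨⟨g, hg, hgs⟩, hX⟩ := hs
  set T : Set (ℝ × ℝ) := {p | 0 ≤ p.1 ∧ 0 ≤ p.2 ∧ p.1 + p.2 ≤ 1} with hTdef
  have hgX : ∀ p ∈ T, g p ∈ X := fun p hp => by rw [hgs ⟨p, hp⟩]; exact hX _
  have hTc : Convex ℝ T := by
    rintro ⟨x, y⟩ ⟨h1, h2, h3⟩ ⟨x', y'⟩ ⟨h1', h2', h3'⟩ a b ha hb hab
    simp only at h1 h2 h3 h1' h2' h3'
    refine ⟨?_, ?_, ?_⟩
    · simp only [Prod.smul_mk, Prod.mk_add_mk, smul_eq_mul]; positivity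
    · simp only [Prod.smul_mk, Prod.mk_add_mk, smul_eq_mul]; positivity
    · simp only [Prod.smul_mk, Prod.mk_add_mk, smul_eq_mul]
      nlinarith [mul_le_mul_of_nonneg_left h3 ha, mul_le_mul_of_nonneg_left h3' hb]
  have hg1 : ∀ p, HasFDerivAt g (fderiv ℝ g p) p := fun p =>
    (hg.differentiable (by simp) p).hasFDerivAt
  have hg2 : ContDiff ℝ 1 (fderiv ℝ g) := (contDiff_infty.1 hg 2).fderiv_right (by norm_num)
  have hη : ∀ p ∈ T, HasFDerivWithinAt (fun p => f (g p) • fderiv ℝ g p)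
      (f (g p) • fderiv ℝ (fderiv ℝ g) p
        + (((deriv f (g p)) • fderiv ℝ g p).smulRight (fderiv ℝ g p))) T p := fun p hp => by
    have h1 : HasDerivAt f (deriv f (g p)) (g p) :=
      (hf.differentiableAt (hXo.mem_nhds (hgX p hp))).hasDerivAt
    have h2 : HasFDerivAt (fun p => f (g p)) (deriv f (g p) • fderiv ℝ g p) p :=
      h1.comp_hasFDerivAt_of_eq p (hg1 p) rfl
    have h3 := (hg2.differentiable (by simp) p).hasFDerivAt
    exact (h2.smul h3).hasFDerivWithinAt
  obtain ⟨F, hF⟩ := hTc.exists_forall_hasFDerivWithinAt_of_hasFDerivWithinAt_symmetric hη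
    (fun p hp x _ y _ => by
      have := ((contDiff_infty.1 hg 2).contDiffAt (x := p)).isSymmSndFDerivAt (by simp)
      simp only [add_apply, smul_apply, ContinuousLinearMap.smulRight_apply, this.eq x y,
        smul_eq_mul]
      ring)
  have hηc : ContinuousOn (fun p => f (g p) • fderiv ℝ g p) T :=
    fun p hp => (hη p hp).continuousWithinAt
  have key : ∀ (e : unitInterval → Triangle) (a v : ℝ × ℝ),
      (∀ t, (e t).1 = a + (t : ℝ) • v) →
      chainIntegralHom f (Finsupp.single (s ∘ e) 1) = F (a + v) - F a := by
    intro e a v he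
    have hT : ∀ t ∈ Set.Icc (0 : ℝ) 1, a + t • v ∈ T := fun t ht => by
      have := (e ⟨t, ht⟩).2
      rwa [he] at this
    have hl : ∀ t : ℝ, HasDerivAt (fun t : ℝ => a + t • v) v t := fun t => by
      simpa using ((hasDerivAt_id t).smul_const v).const_add a
    rw [chainIntegralHom_single, pathIntegral_eq (g := fun t => g (a + t • v))
      (hg.comp (by fun_prop)) (fun t => by rw [← he]; exact hgs _),
      ← integral_segment_of_primitive hηc hF hT]
    refine intervalIntegral.integral_congr fun t _ => ?_
    have h1 : HasDerivAt (fun t : ℝ => g (a + t • v)) (fderiv ℝ g (a + t • v) v) t :=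
      (hg1 _).comp_hasDerivAt t (hl t)
    rw [h1.deriv]
    simp
  rw [boundary₂_single, map_add, map_sub,
    key Triangle.face₀ (1, 0) (-1, 1) (fun t => by simp [Triangle.face₀, sub_eq_add_neg]),
    key Triangle.face₁ (0, 0) (0, 1) (fun t => by simp [Triangle.face₁]),
    key Triangle.face₂ (0, 0) (1, 0) (fun t => by simp [Triangle.face₂])]
  simp

/-! ### The configuration space is connected -/

theorem isPreconnected_injective (N : ℕ) :
    IsPreconnected {z : Fin N → ℂ | Function.Injective z} := by
  refine isPreconnected_of_forall_pair fun z hz z' hz' => ?_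
  -- the complex line through `z` and `z'` meets the discriminant in finitely many points
  let p : ℂ → Fin N → ℂ := fun w => z + w • (z' - z)
  let B : Set ℂ := ⋃ i, ⋃ j, {w | i ≠ j ∧ p w i = p w j}
  have hB : B.Countable := by
    refine Set.countable_iUnion fun i => Set.countable_iUnion fun j => Set.Subsingleton.countable ?_
    rintro w ⟨hij, hw⟩ w' ⟨_, hw'⟩
    simp only [p, Pi.add_apply, Pi.smul_apply, Pi.sub_apply, smul_eq_mul] at hw hw'
    by_contra hne
    have h1 : (w - w') * ((z' i - z i) - (z' j - z j)) = 0 := by linear_combination hw - hw'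
    have h2 := (mul_eq_zero.1 h1).resolve_left (sub_ne_zero.2 hne)
    exact hij (hz (by linear_combination hw - w * h2))
  have hconn : IsPathConnected Bᶜ :=
    hB.isPathConnected_compl_of_one_lt_rank (by simp [Complex.rank_real_complex])
  have hmem : ∀ w, w ∈ Bᶜ ↔ Function.Injective (p w) := fun w => by
    simp only [B, Set.mem_compl_iff, Set.mem_iUnion, Set.mem_ofPred_eq, not_exists, not_and]
    exact ⟨fun h i j hij => by_contra fun hne => h i j hne hij, fun h i j hne hij => hne (h hij)⟩
  refine ⟨p '' Bᶜ, ?_, ?_, ?_, hconn.isConnected.isPreconnected.image _ ?_⟩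
  · rintro _ ⟨w, hw, rfl⟩; exact (hmem w).1 hw
  · exact ⟨0, (hmem 0).2 (by simpa [p] using hz), by simp [p]⟩
  · exact ⟨1, (hmem 1).2 (by simpa [p] using hz'), by simp [p]⟩
  · exact Continuous.continuousOn (by fun_prop)

instance (N : ℕ) : PreconnectedSpace (Conf N) :=
  Subtype.preconnectedSpace (isPreconnected_injective N)

/-! ### Winding numbers -/

theorem isOpen_punctured {N : ℕ} (z : Fin N → ℂ) : IsOpen (punctured z) := by
  have : punctured z = ⋂ i, {t | t ≠ z i} := by ext t; simp [punctured]
  rw [this]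
  exact isOpen_iInter_of_finite fun i => isOpen_ne

theorem not_isSmoothPath_empty {E : Type*} [NormedAddCommGroup E] [NormedSpace ℝ E]
    (γ : unitInterval → E) : ¬ IsSmoothPath (∅ : Set E) γ := fun h => h.2 0

/-- Cauchy's theorem: the integral of a holomorphic form depends only on the homology class. -/
theorem chainIntegralHom_eq_zero {X : Set ℂ} (hX : IsOpen X) {f : ℂ → ℂ}
    (hf : DifferentiableOn ℂ f X) (c : (unitInterval → ℂ) →₀ ℤ) (hc : c ∈ boundaries₁ X ∅) :
    chainIntegralHom f c = 0 :=
  eq_zero_of_mem_boundaries _ (fun _ => chainIntegral_boundary_triangle hX hf)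
    (fun γ hγ => (not_isSmoothPath_empty γ hγ).elim) hc

/-- The form `(2πi)⁻¹ dt / (t - x)`. -/
noncomputable def windingForm (x t : ℂ) : ℂ := (2 * Real.pi * Complex.I)⁻¹ * (t - x)⁻¹

theorem differentiableOn_windingForm (x : ℂ) {X : Set ℂ} (hX : x ∉ X) :
    DifferentiableOn ℂ (windingForm x) X := fun t ht =>
  (((differentiableAt_id.sub_const x).inv
    (sub_ne_zero.2 fun h => hX (by simpa [← h] using ht))).const_mul _).differentiableWithinAt

/-- The winding number around `z i` of a class in `H₁(ℂ ∖ {z₁, …, z_N})`, as a complex number. -/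
noncomputable def windingNumber {N : ℕ} (z : Fin N → ℂ) (i : Fin N) : H₁ (punctured z) ∅ →+ ℂ :=
  H₁.lift (chainIntegralHom (windingForm (z i))) (chainIntegralHom_eq_zero (isOpen_punctured z)
    (differentiableOn_windingForm _ fun h => h i rfl))

/-- The winding number of `t - z i` around `0` for a class in the homology of the bundle. -/
noncomputable def windingTotal {N : ℕ} (U : Set (Fin N → ℂ)) (i : Fin N) :
    H₁ (puncturedTotal U) ∅ →+ ℂ :=
  H₁.lift ((chainIntegralHom (windingForm 0)).comp
      (push₁ fun p : (Fin N → ℂ) × ℂ => p.2 - p.1 i)) fun c hc =>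
    chainIntegralHom_eq_zero (X := {0}ᶜ) isOpen_compl_singleton
      (differentiableOn_windingForm _ (by simp)) _
      (push₁_mem_boundaries (X := puncturedTotal U) (A := ∅)
        (f := fun p : (Fin N → ℂ) × ℂ => p.2 - p.1 i) (by fun_prop)
        (fun p hp => Set.mem_compl_singleton_iff.2 (sub_ne_zero.2 (hp.2 i))) (fun _ h => h) hc)

theorem AddMonoidHom.eq_on_chains {E M : Type*} [NormedAddCommGroup E] [NormedSpace ℝ E]
    [AddCommGroup M] {X : Set E} (L L' : ((unitInterval → E) →₀ ℤ) →+ M)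
    (h : ∀ γ, IsSmoothPath X γ → L (Finsupp.single γ 1) = L' (Finsupp.single γ 1))
    {c : (unitInterval → E) →₀ ℤ} (hc : c ∈ chains₁ X) : L c = L' c :=
  sub_eq_zero.1 (eq_zero_of_forall_single (L - L') fun γ hγ => by simp [h γ (hc γ hγ)])

theorem puncturedIncl_mk {N : ℕ} {U : Set (Fin N → ℂ)} {z : Fin N → ℂ} (hz : z ∈ U)
    (c : cycles₁ (punctured z) ∅) : ∃ h, puncturedIncl U z hz (H₁.mk c)
      = H₁.mk ⟨push₁ (fun t => (z, t)) c, h⟩ := ⟨_, rfl⟩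

theorem relativeIncl_mk {N : ℕ} {U : Set (Fin N → ℂ)} {z : Fin N → ℂ} (hz : z ∈ U)
    (c : cycles₁ (Set.univ : Set ℂ) (Set.range z)) : ∃ h, relativeIncl U z hz (H₁.mk c)
      = H₁.mk ⟨push₁ (fun t => (z, t)) c, h⟩ := ⟨_, rfl⟩

/-- The winding numbers of a class in a fibre can be computed in the homology of the bundle. -/
theorem windingTotal_puncturedIncl {N : ℕ} {U : Set (Fin N → ℂ)} {z : Fin N → ℂ} (hz : z ∈ U)
    (i : Fin N) (σ : H₁ (punctured z) ∅) :
    windingTotal U i (puncturedIncl U z hz σ) = windingNumber z i σ := by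
  obtain ⟨c, rfl⟩ := σ.mk_surjective
  obtain ⟨h, e⟩ := puncturedIncl_mk hz c
  rw [e, windingTotal, windingNumber, H₁.lift_mk, H₁.lift_mk]
  refine AddMonoidHom.eq_on_chains (X := punctured z) (((chainIntegralHom (windingForm 0)).comp
      (push₁ fun p : (Fin N → ℂ) × ℂ => p.2 - p.1 i)).comp (push₁ (fun t : ℂ => (z, t)))) _
      (fun γ hγ => ?_) c.2.1
  obtain ⟨⟨g, hg, hgγ⟩, -⟩ := hγ
  simp only [AddMonoidHom.comp_apply, push₁_single, chainIntegralHom_single]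
  rw [pathIntegral_eq (g := fun t => g t - z i) (by fun_prop)
    (fun t => by simp [hgγ]), pathIntegral_eq hg hgγ]
  simp [windingForm]

theorem IsHorizontal.windingNumber_eq {N : ℕ} {σ : (z : Conf N) → H₁ (punctured z.1) ∅}
    (hσ : IsHorizontal σ) (i : Fin N) (z z' : Conf N) :
    windingNumber z.1 i (σ z) = windingNumber z'.1 i (σ z') := by
  refine IsLocallyConstant.apply_eq_of_preconnectedSpace
    (f := fun z : Conf N => windingNumber z.1 i (σ z)) ?_ z z'
  refine (IsLocallyConstant.iff_eventually_eq _).2 fun z₀ => ?_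
  obtain ⟨r, hr, -, h⟩ := hσ z₀
  filter_upwards [continuous_subtype_val.continuousAt.preimage_mem_nhds
    (Metric.ball_mem_nhds z₀.1 hr)] with z hz
  rw [← windingTotal_puncturedIncl (U := Metric.ball z₀.1 r) hz,
    h z z₀ hz (Metric.mem_ball_self hr),
    windingTotal_puncturedIncl]

/-! ### Multiplicities of boundary points -/

/-- The value of a `0`-chain on a function. -/
noncomputable def zeroChainEval {E M : Type*} [AddCommGroup M] (χ : E → M) : (E →₀ ℤ) →+ M :=
  Finsupp.liftAddHom fun x => zmultiplesHom M (χ x)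

theorem zeroChainEval_single {E M : Type*} [AddCommGroup M] (χ : E → M) (x : E) (n : ℤ) :
    zeroChainEval χ (Finsupp.single x n) = n • χ x := by simp [zeroChainEval]

theorem zeroChainEval_apply {E M : Type*} [AddCommGroup M] (χ : E → M) (c : E →₀ ℤ) :
    zeroChainEval χ c = c.sum fun x n => n • χ x := by
  simp only [zeroChainEval, Finsupp.liftAddHom_apply]
  exact Finsupp.sum_congr fun γ _ => by simp

/-- A function on points that is constant along the smooth paths in `A` can be evaluated on the
boundaries of classes in `H₁(X, A)`. -/
noncomputable def boundaryEval {E M : Type*} [NormedAddCommGroup E] [NormedSpace ℝ E]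
    [AddCommGroup M] (X : Set E) {A : Set E} (χ : E → M)
    (hχ : ∀ γ, IsSmoothPath A γ → χ (γ 1) = χ (γ 0)) : H₁ X A →+ M :=
  H₁.lift ((zeroChainEval χ).comp (boundary₁ E)) fun _ hc =>
    eq_zero_of_mem_boundaries _ (fun s _ => by simp [boundary₁_boundary₂])
      (fun γ hγ => by simp [boundary₁_single, zeroChainEval_single, hχ γ hγ]) hc

theorem IsSmoothPath.continuous {E : Type*} [NormedAddCommGroup E] [NormedSpace ℝ E] {X : Set E}
    {γ : unitInterval → E} (h : IsSmoothPath X γ) : Continuous γ := by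
  obtain ⟨⟨g, hg, hgγ⟩, -⟩ := h
  have : γ = fun t : unitInterval => g t := funext fun t => (hgγ t).symm
  rw [this]
  exact hg.continuous.comp continuous_subtype_val

/-- Along a path of points of configurations, the label of the point does not change. -/
theorem label_eq_of_path {N : ℕ} {U : Set (Fin N → ℂ)} (hU : U ⊆ {z | Function.Injective z})
    {γ : unitInterval → (Fin N → ℂ) × ℂ} (hγ : Continuous γ) (hA : ∀ t, γ t ∈ pointsTotal U)
    (i : Fin N) : (γ 1).2 = (γ 1).1 i ↔ (γ 0).2 = (γ 0).1 i := by
  have hc : ∀ j, IsClosed {t | (γ t).2 = (γ t).1 j} := fun j =>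
    isClosed_eq (by fun_prop) (by fun_prop)
  have hcl : IsClopen {t | (γ t).2 = (γ t).1 i} := by
    refine ⟨hc i, ?_⟩
    have : {t | (γ t).2 = (γ t).1 i}ᶜ = ⋃ j : {j // j ≠ i}, {t | (γ t).2 = (γ t).1 j} := by
      ext t
      simp only [Set.mem_compl_iff, Set.mem_ofPred_eq, Set.mem_iUnion]
      constructor
      · intro h
        obtain ⟨j, hj⟩ := (hA t).2
        exact ⟨⟨j, fun e => h (by rw [← hj, e])⟩, hj.symm⟩
      · rintro ⟨⟨j, hj⟩, h⟩ h'
        exact hj (hU (hA t).1 (h.symm.trans h'))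
    rw [← isClosed_compl_iff, this]
    exact isClosed_iUnion_of_finite fun j => hc j
  rcases isClopen_iff.1 hcl with h | h
  · have h0 := Set.eq_empty_iff_forall_notMem.1 h
    exact iff_of_false (h0 1) (h0 0)
  · have h0 := Set.eq_univ_iff_forall.1 h
    exact iff_of_true (h0 1) (h0 0)

open Classical in
/-- The multiplicity of `z i` in the boundary of a class in `H₁(ℂ, {z₁, …, z_N})`. -/
noncomputable def boundaryMult {N : ℕ} (z : Conf N) (i : Fin N) :
    H₁ (Set.univ : Set ℂ) (Set.range z.1) →+ ℤ :=
  boundaryEval _ (fun t => if t = z.1 i then 1 else 0) fun γ hγ => by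
    have := label_eq_of_path (U := {z.1}) (Set.singleton_subset_iff.2 z.2)
      (γ := fun t => (z.1, γ t)) (by have := hγ.continuous; fun_prop)
      (fun t => ⟨rfl, hγ.2 t⟩) i
    simp only at this
    simp [this]

open Classical in
/-- The multiplicity of the points labelled `i` in the boundary of a class in the homology of
the bundle of pairs. -/
noncomputable def boundaryMultTotal {N : ℕ} {U : Set (Fin N → ℂ)}
    (hU : U ⊆ {z | Function.Injective z}) (i : Fin N) :
    H₁ (U ×ˢ (Set.univ : Set ℂ)) (pointsTotal U) →+ ℤ :=
  boundaryEval _ (fun p => if p.2 = p.1 i then 1 else 0) fun γ hγ => by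
    have := label_eq_of_path hU hγ.continuous hγ.2 i
    simp [this]

theorem boundaryMultTotal_relativeIncl {N : ℕ} {U : Set (Fin N → ℂ)}
    (hU : U ⊆ {z | Function.Injective z}) {z : Conf N} (hz : z.1 ∈ U) (i : Fin N)
    (τ : H₁ (Set.univ : Set ℂ) (Set.range z.1)) :
    boundaryMultTotal hU i (relativeIncl U z.1 hz τ) = boundaryMult z i τ := by
  obtain ⟨c, rfl⟩ := τ.mk_surjective
  obtain ⟨h, e⟩ := relativeIncl_mk hz c
  rw [e, boundaryMultTotal, boundaryMult, boundaryEval, boundaryEval,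
    H₁.lift_mk, H₁.lift_mk]
  refine AddMonoidHom.eq_on_chains (X := Set.univ)
    (((zeroChainEval fun p : (Fin N → ℂ) × ℂ => if p.2 = p.1 i then (1 : ℤ) else 0).comp
      (boundary₁ _)).comp (push₁ fun t : ℂ => (z.1, t))) _
      (fun γ hγ => ?_) c.2.1
  simp [push₁_single, boundary₁_single, zeroChainEval_single]

theorem IsHorizontalRel.boundaryMult_eq {N : ℕ}
    {τ : (z : Conf N) → H₁ (Set.univ : Set ℂ) (Set.range z.1)}
    (hτ : IsHorizontalRel τ) (i : Fin N) (z z' : Conf N) :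
    boundaryMult z i (τ z) = boundaryMult z' i (τ z') := by
  refine IsLocallyConstant.apply_eq_of_preconnectedSpace
    (f := fun z : Conf N => boundaryMult z i (τ z)) ?_ z z'
  refine (IsLocallyConstant.iff_eventually_eq _).2 fun z₀ => ?_
  obtain ⟨r, hr, hU, h⟩ := hτ z₀
  filter_upwards [continuous_subtype_val.continuousAt.preimage_mem_nhds
    (Metric.ball_mem_nhds z₀.1 hr)] with z hz
  rw [← boundaryMultTotal_relativeIncl hU hz, h z z₀ hz (Metric.mem_ball_self hr),
    boundaryMultTotal_relativeIncl]

/-- The boundary of a relative cycle is `∑ i, boundaryMult z i • z i`. -/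
theorem zeroChainEval_boundary {N : ℕ} {M : Type*} [AddCommGroup M] (z : Conf N) (χ : ℂ → M)
    (c : cycles₁ (Set.univ : Set ℂ) (Set.range z.1)) :
    zeroChainEval χ (boundary₁ ℂ c.1) = ∑ i, boundaryMult z i (H₁.mk c) • χ (z.1 i) := by
  have h1 : ∀ i, boundaryMult z i (H₁.mk c) = boundary₁ ℂ c.1 (z.1 i) := fun i => by
    rw [boundaryMult, boundaryEval, H₁.lift_mk, AddMonoidHom.comp_apply, zeroChainEval_apply]
    simp +contextual [Finsupp.sum, eq_comm]
  classical
  rw [zeroChainEval_apply, Finsupp.sum_of_support_subset (s := Finset.univ.image z.1),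
    Finset.sum_image (fun i _ j _ h => z.2 h)]
  · exact Finset.sum_congr rfl fun i _ => by rw [h1]
  · intro x hx
    obtain ⟨i, rfl⟩ := c.2.2 x hx
    simp
  · simp

/-! ### Horizontal families of circles and of segments -/

/-- The circle of centre `x` and radius `ε`, as a smooth path. -/
noncomputable def circlePath (x : ℂ) (ε : ℝ) : unitInterval → ℂ := fun t =>
  x + ε * Complex.exp (2 * Real.pi * Complex.I * (t : ℝ))

theorem norm_circlePath_sub (x : ℂ) (ε : ℝ) (hε : 0 ≤ ε) (t : ℝ) :
    ‖x + ε * Complex.exp (2 * Real.pi * Complex.I * t) - x‖ = ε := by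
  have : 2 * (Real.pi : ℂ) * Complex.I * t = ((2 * Real.pi * t : ℝ) : ℂ) * Complex.I := by
    push_cast; ring
  rw [add_sub_cancel_left, norm_mul, this, Complex.norm_exp_ofReal_mul_I]
  simp [abs_of_nonneg hε]

theorem circlePath_add_mem_punctured {N : ℕ} {z : Fin N → ℂ} {a : Fin N} {ε : ℝ} (hε : 0 < ε)
    (h : ∀ j, j ≠ a → ε < ‖z j - z a‖) (t : ℝ) :
    z a + ε * Complex.exp (2 * Real.pi * Complex.I * t) ∈ punctured z := by
  intro j hj
  have h1 := norm_circlePath_sub (z a) ε hε.le t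
  rw [hj] at h1
  by_cases hja : j = a
  · subst hja; simp at h1; exact hε.ne h1
  · exact (h j hja).ne' h1

theorem single_circlePath_mem_cycles {N : ℕ} {z : Fin N → ℂ} {a : Fin N} {ε : ℝ} (hε : 0 < ε)
    (h : ∀ j, j ≠ a → ε < ‖z j - z a‖) :
    Finsupp.single (circlePath (z a) ε) 1 ∈ cycles₁ (punctured z) ∅ := by
  refine ⟨single_mem_chains₁ ⟨⟨fun t => z a + ε * Complex.exp (2 * Real.pi * Complex.I * t), ?_,
    fun _ => rfl⟩, fun t => circlePath_add_mem_punctured hε h t⟩ 1, ?_⟩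
  · have : ContDiff ℝ ∞ (fun t : ℝ => (t : ℂ)) := Complex.ofRealCLM.contDiff
    fun_prop
  · have : circlePath (z a) ε 1 = circlePath (z a) ε 0 := by simp [circlePath]
    simp [boundary₁_single, this]

/-- The class of a small positive circle around `z a`. -/
noncomputable def circleClass {N : ℕ} (z : Fin N → ℂ) (a : Fin N) (ε : ℝ) (hε : 0 < ε)
    (h : ∀ j, j ≠ a → ε < ‖z j - z a‖) : H₁ (punctured z) ∅ :=
  H₁.mk ⟨_, single_circlePath_mem_cycles hε h⟩

theorem pathIntegral_circlePath (f : ℂ → ℂ) (x : ℂ) (ε : ℝ) :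
    pathIntegral f (circlePath x ε) = ∮ t in C(x, ε), f t := by
  have h1 : ContDiff ℝ ∞ (fun t : ℝ => (t : ℂ)) := Complex.ofRealCLM.contDiff
  rw [pathIntegral_eq (g := fun t => circleMap x ε (2 * Real.pi * t))
    ((contDiff_circleMap x ε).comp (by fun_prop)) (fun t => by
      simp only [circleMap, circlePath]; push_cast; ring_nf), circleIntegral]
  have h2 := intervalIntegral.smul_integral_comp_mul_left (a := 0) (b := 1)
    (f := fun θ => deriv (circleMap x ε) θ • f (circleMap x ε θ)) (2 * Real.pi)
  rw [mul_zero, mul_one] at h2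
  rw [← h2, ← intervalIntegral.integral_smul]
  refine intervalIntegral.integral_congr fun t _ => ?_
  have h3 : HasDerivAt (fun t : ℝ => circleMap x ε (2 * Real.pi * t))
      ((2 * Real.pi) • (circleMap 0 ε (2 * Real.pi * t) * Complex.I)) t := by
    have h4 : HasDerivAt (fun t : ℝ => 2 * Real.pi * t) (2 * Real.pi) t := by
      simpa using (hasDerivAt_id t).const_mul (2 * Real.pi)
    exact (hasDerivAt_circleMap x ε (2 * Real.pi * t)).scomp t h4
  simp only [h3.deriv, deriv_circleMap, smul_eq_mul, Complex.real_smul]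
  ring

theorem windingNumber_circleClass {N : ℕ} (z : Fin N → ℂ) (a i : Fin N) (ε : ℝ) (hε : 0 < ε)
    (h : ∀ j, j ≠ a → ε < ‖z j - z a‖) :
    windingNumber z i (circleClass z a ε hε h) = if i = a then 1 else 0 := by
  rw [circleClass, windingNumber, H₁.lift_mk, chainIntegralHom_single, pathIntegral_circlePath]
  simp only [windingForm]
  rw [circleIntegral.integral_const_mul]
  split_ifs with hi
  · subst hi
    rw [circleIntegral.integral_sub_center_inv _ hε.ne', inv_mul_cancel₀ Complex.two_pi_I_ne_zero]
  · have := h i hi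
    rw [Complex.circleIntegral_eq_zero_of_differentiable_on_off_countable hε.le
      Set.countable_empty, mul_zero]
    · refine ContinuousOn.inv₀ (by fun_prop) fun t ht e => ?_
      rw [sub_eq_zero.1 e, Metric.mem_closedBall, dist_eq_norm] at ht
      linarith
    · rintro t ⟨ht, -⟩
      refine (differentiableAt_id.sub_const _).inv fun e => ?_
      rw [sub_eq_zero.1 e, Metric.mem_ball, dist_eq_norm] at ht
      linarith

theorem lineMap_mem_ball {N : ℕ} {z₀ z z' : Fin N → ℂ} {r : ℝ} (hz : z ∈ Metric.ball z₀ r)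
    (hz' : z' ∈ Metric.ball z₀ r) {s : ℝ} (hs : s ∈ Set.Icc (0 : ℝ) 1) :
    z + (s : ℂ) • (z' - z) ∈ Metric.ball z₀ r := by
  have := (convex_ball z₀ r).add_smul_sub_mem hz hz' hs
  simpa using this

theorem exists_radius {N : ℕ} (z : Conf N) (a : Fin N) :
    ∃ ε : ℝ, 0 < ε ∧ ∀ j, j ≠ a → 2 * ε ≤ ‖z.1 j - z.1 a‖ := by
  by_cases hne : (Finset.univ.erase a).Nonempty
  · obtain ⟨j, hj, hmin⟩ := Finset.exists_min_image _ (fun j => ‖z.1 j - z.1 a‖) hne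
    have : 0 < ‖z.1 j - z.1 a‖ := norm_pos_iff.2 (sub_ne_zero.2 fun e =>
      (Finset.mem_erase.1 hj).1 (z.2 e))
    exact ⟨‖z.1 j - z.1 a‖ / 2, by positivity, fun k hk => by
      have := hmin k (Finset.mem_erase.2 ⟨hk, Finset.mem_univ _⟩)
      linarith⟩
  · refine ⟨1, one_pos, fun j hj => ?_⟩
    exact (hne ⟨j, Finset.mem_erase.2 ⟨hj, Finset.mem_univ _⟩⟩).elim

/-- A radius at most half the distance from `z a` to the other points. -/
noncomputable def radius {N : ℕ} (z : Conf N) (a : Fin N) : ℝ := (exists_radius z a).choose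

theorem radius_pos {N : ℕ} (z : Conf N) (a : Fin N) : 0 < radius z a :=
  (exists_radius z a).choose_spec.1

theorem two_mul_radius_le {N : ℕ} (z : Conf N) {a j : Fin N} (h : j ≠ a) :
    2 * radius z a ≤ ‖z.1 j - z.1 a‖ :=
  (exists_radius z a).choose_spec.2 j h

theorem radius_lt {N : ℕ} (z : Conf N) {a j : Fin N} (h : j ≠ a) :
    radius z a < ‖z.1 j - z.1 a‖ := by
  linarith [two_mul_radius_le z h, radius_pos z a]

theorem norm_sub_sub_le {N : ℕ} {z₀ z : Fin N → ℂ} {r : ℝ} (hz : z ∈ Metric.ball z₀ r)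
    (j a : Fin N) : ‖(z j - z a) - (z₀ j - z₀ a)‖ ≤ 2 * r := by
  have h : ∀ k, ‖z k - z₀ k‖ ≤ r := fun k =>
    (norm_le_pi_norm (z - z₀) k).trans (by rw [← dist_eq_norm]; exact (Metric.mem_ball.1 hz).le)
  have e : (z j - z a) - (z₀ j - z₀ a) = (z j - z₀ j) - (z a - z₀ a) := by ring
  rw [e]
  linarith [norm_sub_le (z j - z₀ j) (z a - z₀ a), h j, h a]

/-- The small circles around the `a`-th point form a horizontal family. -/
theorem isHorizontal_circleClass {N : ℕ} (a : Fin N) : IsHorizontal fun z : Conf N =>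
    circleClass z.1 a (radius z a) (radius_pos z a) (fun _ h => radius_lt z h) := by
  intro z₀
  obtain ⟨ρ, hρ, hball⟩ := Metric.isOpen_iff.1 (isOpen_conf N) z₀.1 z₀.2
  -- a circle of radius at most `δ + r` avoids the points at distance at least `2 δ - 2 r`
  set δ := radius z₀ a
  have hδ : 0 < δ := radius_pos z₀ a
  set r := min ρ (δ / 4)
  have hr : 0 < r := lt_min hρ (by linarith)
  have hrδ : r ≤ δ / 4 := min_le_right _ _
  refine ⟨r, hr, (Metric.ball_subset_ball (min_le_left _ _)).trans hball,
    fun z z' hz hz' => ?_⟩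
  obtain ⟨h, e⟩ := puncturedIncl_mk hz
    ⟨_, single_circlePath_mem_cycles (radius_pos z a) (fun _ h => radius_lt z h)⟩
  obtain ⟨h', e'⟩ := puncturedIncl_mk hz'
    ⟨_, single_circlePath_mem_cycles (radius_pos z' a) (fun _ h => radius_lt z' h)⟩
  simp only [circleClass, e, e', H₁.mk_eq_mk_iff, push₁_single]
  set ε := radius z a
  set ε' := radius z' a
  let Z : ℝ → Fin N → ℂ := fun s => z.1 + (s : ℂ) • (z'.1 - z.1)
  let H : ℝ × ℝ → (Fin N → ℂ) × ℂ := fun p => (Z p.1, Z p.1 a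
    + ((ε + p.1 * (ε' - ε) : ℝ) : ℂ) * Complex.exp (2 * Real.pi * Complex.I * p.2))
  have hofReal : ContDiff ℝ ∞ (fun t : ℝ => (t : ℂ)) := Complex.ofRealCLM.contDiff
  have hZ : ContDiff ℝ ∞ Z := by
    simp only [Z]
    exact contDiff_const.add (hofReal.smul contDiff_const)
  have hZa : ContDiff ℝ ∞ fun s => Z s a := contDiff_pi.1 hZ a
  have hH : ContDiff ℝ ∞ H := by
    refine (hZ.comp contDiff_fst).prodMk ((hZa.comp contDiff_fst).add ?_)
    exact (hofReal.comp (by fun_prop)).mul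
      ((contDiff_const.mul (hofReal.comp contDiff_snd)).cexp)
  have hsq := square_mem_boundaries (A := ∅) (X := puncturedTotal (Metric.ball z₀.1 r)) hH ?_
  · have e1 : (fun t : unitInterval => H (t, 1)) = fun t : unitInterval => H (t, 0) := by
      funext t; simp [H]
    have e2 : (fun t : unitInterval => H (0, t)) = (fun t => (z.1, t)) ∘ circlePath (z.1 a) ε := by
      funext t; simp [H, Z, circlePath]
    have e3 : (fun t : unitInterval => H (1, t))
        = (fun t => (z'.1, t)) ∘ circlePath (z'.1 a) ε' := by
      funext t; simp [H, Z, circlePath]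
    rw [e1, e2, e3, add_sub_cancel_right, ← neg_mem_iff, neg_sub] at hsq
    exact hsq
  · intro s hs u hu
    have hZs : Z s ∈ Metric.ball z₀.1 r := lineMap_mem_ball hz hz' hs
    refine ⟨hZs, circlePath_add_mem_punctured ?_ ?_ u⟩
    · have h1 : 0 < ε := radius_pos z a
      have h2 : 0 < ε' := radius_pos z' a
      have := (convex_Ioi (0 : ℝ)).add_smul_sub_mem h1 h2 hs
      simpa using this
    · intro j hj
      have hle : ∀ {w : Conf N}, w.1 ∈ Metric.ball z₀.1 r →
          radius w a ≤ ‖z₀.1 j - z₀.1 a‖ / 2 + r := fun {w} hw => by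
        have := norm_sub_norm_le (w.1 j - w.1 a) (z₀.1 j - z₀.1 a)
        linarith [two_mul_radius_le w hj, norm_sub_sub_le hw j a]
      have h1 : ε + s * (ε' - ε) ≤ ‖z₀.1 j - z₀.1 a‖ / 2 + r := by
        have := (convex_Iic (‖z₀.1 j - z₀.1 a‖ / 2 + r)).add_smul_sub_mem (hle hz) (hle hz') hs
        simpa using this
      have h2 := norm_sub_norm_le (z₀.1 j - z₀.1 a) (Z s j - Z s a)
      rw [norm_sub_rev (z₀.1 j - z₀.1 a)] at h2
      have h3 : ε + s * (ε' - ε) < ‖Z s j - Z s a‖ := by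
        linarith [norm_sub_sub_le hZs j a, two_mul_radius_le z₀ hj]
      exact h3

theorem isSmoothPath_segmentPath {X : Set ℂ} {e : ℂ × ℂ} (h : segment ℝ e.1 e.2 ⊆ X) :
    IsSmoothPath X (segmentPath e) := by
  have hofReal : ContDiff ℝ ∞ (fun t : ℝ => (t : ℂ)) := Complex.ofRealCLM.contDiff
  refine ⟨⟨fun t => e.1 + (t : ℂ) * (e.2 - e.1), by fun_prop, fun _ => rfl⟩, fun t => h ?_⟩
  rw [segment_eq_image']
  exact ⟨t, t.2, by simp [segmentPath]⟩

theorem single_segmentPath_mem_cycles {N : ℕ} (z : Fin N → ℂ) (b c : Fin N) :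
    Finsupp.single (segmentPath (z b, z c)) 1 ∈ cycles₁ (Set.univ : Set ℂ) (Set.range z) := by
  classical
  refine ⟨single_mem_chains₁ (isSmoothPath_segmentPath (Set.subset_univ _)) 1, fun x hx => ?_⟩
  rw [boundary₁_single] at hx
  rcases Finset.mem_union.1 (Finsupp.support_sub hx) with h | h <;>
    have := Finset.mem_singleton.1 (Finsupp.support_single_subset h) <;>
    simp [this, segmentPath]

/-- The class of the segment from `z b` to `z c`. -/
noncomputable def segmentClass {N : ℕ} (z : Fin N → ℂ) (b c : Fin N) :
    H₁ (Set.univ : Set ℂ) (Set.range z) := H₁.mk ⟨_, single_segmentPath_mem_cycles z b c⟩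

theorem boundaryMult_segmentClass {N : ℕ} (z : Conf N) (b c i : Fin N) :
    boundaryMult z i (segmentClass z.1 b c)
      = (if i = c then 1 else 0) - (if i = b then 1 else 0) := by
  rw [segmentClass, boundaryMult, boundaryEval, H₁.lift_mk]
  simp [boundary₁_single, zeroChainEval_single, segmentPath, z.2.eq_iff, eq_comm]

/-- The segments joining two of the points form a horizontal family. -/
theorem isHorizontalRel_segmentClass {N : ℕ} (b c : Fin N) :
    IsHorizontalRel fun z : Conf N => segmentClass z.1 b c := by
  intro z₀
  obtain ⟨r, hr, hball⟩ := Metric.isOpen_iff.1 (isOpen_conf N) z₀.1 z₀.2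
  refine ⟨r, hr, hball, fun z z' hz hz' => ?_⟩
  obtain ⟨h, e⟩ := relativeIncl_mk hz ⟨_, single_segmentPath_mem_cycles z.1 b c⟩
  obtain ⟨h', e'⟩ := relativeIncl_mk hz' ⟨_, single_segmentPath_mem_cycles z'.1 b c⟩
  simp only [segmentClass, e, e', H₁.mk_eq_mk_iff, push₁_single]
  let Z : ℝ → Fin N → ℂ := fun s => z.1 + (s : ℂ) • (z'.1 - z.1)
  let H : ℝ × ℝ → (Fin N → ℂ) × ℂ := fun p =>
    (Z p.1, Z p.1 b + (p.2 : ℂ) * (Z p.1 c - Z p.1 b))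
  have hofReal : ContDiff ℝ ∞ (fun t : ℝ => (t : ℂ)) := Complex.ofRealCLM.contDiff
  have hZ : ContDiff ℝ ∞ Z := by
    simp only [Z]
    exact contDiff_const.add (hofReal.smul contDiff_const)
  have hZi : ∀ i, ContDiff ℝ ∞ fun p : ℝ × ℝ => Z p.1 i := fun i =>
    (contDiff_pi.1 hZ i).comp contDiff_fst
  have hH : ContDiff ℝ ∞ H := (hZ.comp contDiff_fst).prodMk
    ((hZi b).add ((hofReal.comp contDiff_snd).mul ((hZi c).sub (hZi b))))
  have hsq := square_mem_boundaries (A := pointsTotal (Metric.ball z₀.1 r))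
    (X := Metric.ball z₀.1 r ×ˢ (Set.univ : Set ℂ)) hH
    (fun s hs u _ => ⟨lineMap_mem_ball hz hz' hs, trivial⟩)
  have hside : ∀ (u : ℝ) (i : Fin N), (∀ s, H (s, u) = (Z s, Z s i)) →
      Finsupp.single (fun t : unitInterval => H (t, u)) (1 : ℤ) ∈ boundaries₁
        (Metric.ball z₀.1 r ×ˢ (Set.univ : Set ℂ)) (pointsTotal (Metric.ball z₀.1 r)) :=
    fun u i hi => single_mem_boundaries ⟨⟨fun t => H (t, u), hH.comp (by fun_prop),
      fun _ => rfl⟩, fun t => by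
        change H (t, u) ∈ _
        rw [hi]; exact ⟨lineMap_mem_ball hz hz' t.2, ⟨i, rfl⟩⟩⟩
  have h0 := hside 0 b (fun s => by simp [H])
  have h1 := hside 1 c (fun s => by simp [H])
  have e2 : (fun t : unitInterval => H (0, t))
      = (fun t => (z.1, t)) ∘ segmentPath (z.1 b, z.1 c) := by
    funext t; simp [H, Z, segmentPath]
  have e3 : (fun t : unitInterval => H (1, t))
      = (fun t => (z'.1, t)) ∘ segmentPath (z'.1 b, z'.1 c) := by
    funext t; simp [H, Z, segmentPath]
  rw [e2, e3] at hsq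
  convert neg_mem (add_mem (sub_mem hsq h0) h1) using 1
  abel

/-! ### The pairing of the integrals -/

/-- The integral of a form with primitive `G` over a chain is the value of `G` on its boundary. -/
theorem chainIntegral_eq_zeroChainEval {f G : ℂ → ℂ} {X : Set ℂ} (hf : ContinuousOn f X)
    (hG : ∀ x ∈ X, HasDerivAt G (f x) x) {c : (unitInterval → ℂ) →₀ ℤ} (hc : c ∈ chains₁ X) :
    chainIntegral f c = zeroChainEval G (boundary₁ ℂ c) := by
  rw [← chainIntegralHom_apply]
  refine AddMonoidHom.eq_on_chains _ ((zeroChainEval G).comp (boundary₁ ℂ)) (fun γ hγ => ?_) hc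
  obtain ⟨⟨g, hg, hgγ⟩, hX⟩ := hγ
  have hX' : ∀ s ∈ Set.Icc (0 : ℝ) 1, g s ∈ X := fun s hs => by rw [hgγ ⟨s, hs⟩]; exact hX _
  rw [chainIntegralHom_single, pathIntegral_eq hg hgγ,
    intervalIntegral.integral_eq_sub_of_hasDerivAt (f := fun s => G (g s)) (fun s hs => ?_)
      (intervalIntegrable_path hf hg hX')]
  · simp [boundary₁_single, zeroChainEval_single, ← hgγ]
  · rw [Set.uIcc_of_le zero_le_one] at hs
    exact (hG _ (hX' s hs)).comp s (hg.differentiable (by simp) s).hasDerivAt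

theorem chainIntegral_const_mul (a : ℂ) (f : ℂ → ℂ) (c : (unitInterval → ℂ) →₀ ℤ) :
    chainIntegral (fun t => a * f t) c = a * chainIntegral f c := by
  simp only [chainIntegral, Finsupp.mul_sum]
  refine Finsupp.sum_congr fun γ _ => ?_
  simp only [pathIntegral, mul_assoc, intervalIntegral.integral_const_mul]
  ring

theorem chainIntegral_sum_const_mul {ι : Type*} (s : Finset ι) (a : ι → ℂ) {f : ι → ℂ → ℂ}
    {X : Set ℂ} (hf : ∀ i ∈ s, ContinuousOn (f i) X) {c : (unitInterval → ℂ) →₀ ℤ}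
    (hc : c ∈ chains₁ X) :
    chainIntegral (fun t => ∑ i ∈ s, a i * f i t) c = ∑ i ∈ s, a i * chainIntegral (f i) c := by
  rw [← chainIntegral_sum s (f := fun i t => a i * f i t)
    (fun i hi => continuousOn_const.mul (hf i hi)) hc]
  exact Finset.sum_congr rfl fun i _ => chainIntegral_const_mul _ _ _

theorem chainIntegral_congr {f f' : ℂ → ℂ} {X : Set ℂ} (h : ∀ t ∈ X, f t = f' t)
    {c : (unitInterval → ℂ) →₀ ℤ} (hc : c ∈ chains₁ X) :
    chainIntegral f c = chainIntegral f' c := by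
  refine Finset.sum_congr rfl fun γ hγ => ?_
  obtain ⟨⟨g, hg, hgγ⟩, hX⟩ := hc γ hγ
  simp only
  rw [pathIntegral_eq hg hgγ, pathIntegral_eq hg hgγ]
  congr 1
  refine intervalIntegral.integral_congr fun s hs => ?_
  rw [Set.uIcc_of_le zero_le_one] at hs
  simp only [h (g s) (by rw [hgγ ⟨s, hs⟩]; exact hX _)]

theorem chainIntegral_add {f f' : ℂ → ℂ} {X : Set ℂ} (hf : ContinuousOn f X)
    (hf' : ContinuousOn f' X) {c : (unitInterval → ℂ) →₀ ℤ} (hc : c ∈ chains₁ X) :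
    chainIntegral (fun t => f t + f' t) c = chainIntegral f c + chainIntegral f' c := by
  have := chainIntegral_sum (Finset.univ : Finset Bool) (f := fun b => cond b f f')
    (fun b _ => by cases b <;> assumption) hc
  simpa using this.symm

open Polynomial in
/-- The divided difference of a polynomial is a polynomial in two variables. -/
theorem exists_dividedDifference (p : ℂ[X]) : ∃ (n : ℕ) (u : ℕ → ℂ[X]), ∀ s t : ℂ,
    p.eval t - p.eval s = (t - s) * ∑ k ∈ Finset.range n, (u k).eval s * t ^ k := by
  induction p using Polynomial.recOnHorner with
  | M0 => exact ⟨0, 0, by simp⟩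
  | MC p a _ _ ih =>
    obtain ⟨n, u, h⟩ := ih
    exact ⟨n, u, fun s t => by rw [← h]; simp⟩
  | MX p _ ih =>
    obtain ⟨n, u, h⟩ := ih
    refine ⟨n + 1, fun k => k.casesOn p u, fun s t => ?_⟩
    rw [Finset.sum_range_succ', mul_add]
    have e : (t - s) * ∑ k ∈ Finset.range n, (u k).eval s * t ^ (k + 1)
        = t * ((t - s) * ∑ k ∈ Finset.range n, (u k).eval s * t ^ k) := by
      simp only [Finset.mul_sum]
      exact Finset.sum_congr rfl fun k _ => by ring
    simp only [e, ← h, eval_mul, eval_X, pow_zero]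
    change eval t p * t - eval s p * s = _ + (t - s) * (eval s p * 1)
    ring

theorem phiIntegrand_mul_sub {N m : ℕ} (hm : 0 < m) (z : Fin N → ℂ) (b : Fin N) (t : ℂ) :
    phiIntegrand m z b t * (t - z b) = ∏ i, (t - z i) ^ m := by
  rw [phiIntegrand, mul_assoc, ← pow_succ, Nat.sub_add_cancel hm,
    Finset.prod_erase_mul _ _ (Finset.mem_univ b)]

/-- The function `f t K(s, t)` with `K(s, t) = ∑ b, 1 / ((s - z b) (t - z b))` is, up to the
factor `-m`, the result of applying the logarithmic derivation `∂_s + ∂_t - f'(s) / f(s)` to the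
divided difference `q` of `f = ∏ i, (t - z i) ^ m`. -/
theorem sum_inv_mul_phiIntegrand {N m : ℕ} (hm : 0 < m) {z : Fin N → ℂ} {n : ℕ}
    {u : ℕ → Polynomial ℂ}
    (hu : ∀ s t : ℂ, (∏ i, (t - z i) ^ m) - ∏ i, (s - z i) ^ m
      = (t - s) * ∑ k ∈ Finset.range n, (u k).eval s * t ^ k)
    {s : ℂ} (hs : s ∈ punctured z) (t : ℂ) :
    (m : ℂ) * ∑ b, (s - z b)⁻¹ * phiIntegrand m z b t
      = -(∑ k ∈ Finset.range n, (u k).eval s * (k * t ^ (k - 1))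
        + ∑ k ∈ Finset.range n, (u k).derivative.eval s * t ^ k
        - (m * ∑ b, phiIntegrand m z b s) * (∏ i, (s - z i) ^ m)⁻¹
          * ∑ k ∈ Finset.range n, (u k).eval s * t ^ k) := by
  have hcont : Set.EqOn
      (fun t => (m : ℂ) * ∑ b, (s - z b)⁻¹ * phiIntegrand m z b t)
      (fun t => -(∑ k ∈ Finset.range n, (u k).eval s * (k * t ^ (k - 1))
        + ∑ k ∈ Finset.range n, (u k).derivative.eval s * t ^ k
        - (m * ∑ b, phiIntegrand m z b s) * (∏ i, (s - z i) ^ m)⁻¹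
          * ∑ k ∈ Finset.range n, (u k).eval s * t ^ k)) {s}ᶜ := by
    intro t hts
    have hts' : t - s ≠ 0 := sub_ne_zero.2 hts
    have hf0 := prod_ne_zero_of_punctured m hs
    have hft := hasDerivAt_prod_pow m z t
    have hfs := hasDerivAt_prod_pow m z s
    have hq := hu s t
    -- differentiate the identity defining `q` in `t` and in `s`
    have hqt : HasDerivAt (fun t => ∑ k ∈ Finset.range n, (u k).eval s * t ^ k)
        (∑ k ∈ Finset.range n, (u k).eval s * (k * t ^ (k - 1))) t :=
      HasDerivAt.fun_sum fun k _ => (hasDerivAt_pow k t).const_mul _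
    have hqs : HasDerivAt (fun s => ∑ k ∈ Finset.range n, (u k).eval s * t ^ k)
        (∑ k ∈ Finset.range n, (u k).derivative.eval s * t ^ k) s :=
      HasDerivAt.fun_sum fun k _ => ((u k).hasDerivAt s).mul_const _
    have e1 := (hft.sub_const (∏ i, (s - z i) ^ m)).unique
      (((((hasDerivAt_id t).sub_const s).mul hqt).congr_of_eventuallyEq
        (Filter.Eventually.of_forall fun t => hu s t)))
    have e2 := (hfs.const_sub (∏ i, (t - z i) ^ m)).unique
      (((((hasDerivAt_id s).const_sub t).mul hqs).congr_of_eventuallyEq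
        (Filter.Eventually.of_forall fun s => hu s t)))
    simp only [id, one_mul] at e1 e2
    have e3 : (t - s) * ∑ b, (s - z b)⁻¹ * phiIntegrand m z b t
        = (∏ i, (t - z i) ^ m) * ∑ b, (s - z b)⁻¹ - ∑ b, phiIntegrand m z b t := by
      rw [Finset.mul_sum, Finset.mul_sum, ← Finset.sum_sub_distrib]
      refine Finset.sum_congr rfl fun b _ => ?_
      have hb : s - z b ≠ 0 := sub_ne_zero.2 (hs b)
      rw [← phiIntegrand_mul_sub hm z b t]
      field_simp
      ring
    have e4 : (∏ i, (s - z i) ^ m) * ∑ b, (s - z b)⁻¹ = ∑ b, phiIntegrand m z b s := by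
      rw [Finset.mul_sum]
      refine Finset.sum_congr rfl fun b _ => ?_
      have hb : s - z b ≠ 0 := sub_ne_zero.2 (hs b)
      rw [← phiIntegrand_mul_sub hm z b s]
      field_simp
    have e5 : ∑ b, (s - z b)⁻¹ = (∏ i, (s - z i) ^ m)⁻¹ * ∑ b, phiIntegrand m z b s := by
      rw [← e4]; field_simp
    rw [e5] at e3
    have e6 : (∏ i, (s - z i) ^ m)⁻¹ * (∏ i, (s - z i) ^ m) = 1 := inv_mul_cancel₀ hf0
    simp only
    generalize (∏ i, (s - z i) ^ m)⁻¹ = g at *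
    apply mul_left_cancel₀ hts'
    generalize (∏ i, (t - z i) ^ m) = F at *
    generalize (∏ i, (s - z i) ^ m) = f at *
    linear_combination (m : ℂ) * e3 - e1 - e2 + (m * ∑ b, phiIntegrand m z b s) * g * hq
      + (m * ∑ b, phiIntegrand m z b s) * e6
  -- the division by `t - s` is harmless, as both sides are continuous in `t`
  have hq : Continuous fun t : ℂ => ∑ k ∈ Finset.range n, (u k).eval s * t ^ k := by fun_prop
  have hp : ∀ b, Continuous (phiIntegrand m z b) := continuous_phiIntegrand m z
  exact congrFun (Continuous.ext_on (dense_compl_singleton s) (by fun_prop) (by fun_prop) hcont) t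

/-- The pairing of the integrals over a cycle `c` of `ℂ ∖ {z₁, …, z_N}` and over a relative cycle
`d` of `(ℂ, {z₁, …, z_N})`: integrating `sum_inv_mul_phiIntegrand` over `d` shows that the
`1`-form `∑ b, psiIntegrand m z b s ds ∫_d phiIntegrand m z b` is, up to an exact form, a linear
combination of the forms `ds / (s - z i)`. -/
theorem sum_chainIntegral_mul_chainIntegral {N m : ℕ} (hm : 0 < m) (z : Conf N)
    (c : cycles₁ (punctured z.1) ∅) (d : cycles₁ (Set.univ : Set ℂ) (Set.range z.1)) :
    ∑ b, (2 * Real.pi * Complex.I)⁻¹ * chainIntegral (psiIntegrand m z.1 b) c.1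
        * chainIntegral (phiIntegrand m z.1 b) d.1
      = -(m : ℂ)⁻¹ * ∑ i, (boundaryMult z i (H₁.mk d) : ℂ) * windingNumber z.1 i (H₁.mk c) := by
  have hm0 : (m : ℂ) ≠ 0 := by exact_mod_cast hm.ne'
  obtain ⟨n, u, hu⟩ := exists_dividedDifference (∏ i, (Polynomial.X - Polynomial.C (z.1 i)) ^ m)
  simp only [Polynomial.eval_prod, Polynomial.eval_pow, Polynomial.eval_sub, Polynomial.eval_X,
    Polynomial.eval_C] at hu
  set Y : Fin N → ℂ := fun b => chainIntegral (phiIntegrand m z.1 b) d.1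
  let Q : ℂ → ℂ := fun s => ∑ k ∈ Finset.range n, (u k).eval s * chainIntegral (fun t => t ^ k) d.1
  let Q' : ℂ → ℂ := fun s =>
    ∑ k ∈ Finset.range n, (u k).derivative.eval s * chainIntegral (fun t => t ^ k) d.1
  have hQ : ∀ s, HasDerivAt Q (Q' s) s := fun s =>
    HasDerivAt.fun_sum fun k _ => ((u k).hasDerivAt s).mul_const _
  let g : ℂ → ℂ := fun s => (∏ i, (s - z.1 i) ^ m)⁻¹
  let g' : ℂ → ℂ := fun s => -(m * ∑ b, phiIntegrand m z.1 b s) / (∏ i, (s - z.1 i) ^ m) ^ 2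
  have hg : ∀ s ∈ punctured z.1, HasDerivAt g (g' s) s := fun s hs =>
    (hasDerivAt_prod_pow m z.1 s).inv (prod_ne_zero_of_punctured m hs)
  -- the identity after integration over `d`
  have h1 : ∀ s ∈ punctured z.1, ∑ b, Y b * psiIntegrand m z.1 b s
      = -(m : ℂ)⁻¹ * ((∑ i, (boundaryMult z i (H₁.mk d) : ℂ) * (s - z.1 i)⁻¹)
        + (g' s * Q s + g s * Q' s)) := by
    intro s hs
    have hf0 := prod_ne_zero_of_punctured m hs
    have ha : chainIntegral (fun t => ∑ b, (s - z.1 b)⁻¹ * phiIntegrand m z.1 b t) d.1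
        = ∑ b, (s - z.1 b)⁻¹ * Y b :=
      chainIntegral_sum_const_mul _ _ (fun b _ => (continuous_phiIntegrand m z.1 b).continuousOn)
        d.2.1
    have hb : chainIntegral (fun t => ∑ k ∈ Finset.range n, (u k).eval s * (k * t ^ (k - 1))) d.1
        = ∑ i, (boundaryMult z i (H₁.mk d) : ℂ) *
          ((∏ i, (s - z.1 i) ^ m) * (s - z.1 i)⁻¹) := by
      rw [chainIntegral_eq_zeroChainEval (X := Set.univ)
        (G := fun t => ∑ k ∈ Finset.range n, (u k).eval s * t ^ k)
        (Continuous.continuousOn (by fun_prop))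
        (fun t _ => HasDerivAt.fun_sum fun k _ => (hasDerivAt_pow k t).const_mul _) d.2.1,
        zeroChainEval_boundary]
      refine Finset.sum_congr rfl fun i _ => ?_
      rw [zsmul_eq_mul]
      congr 1
      have h2 := hu s (z.1 i)
      have h3 : ∏ j, (z.1 i - z.1 j) ^ m = 0 :=
        Finset.prod_eq_zero (Finset.mem_univ i) (by simp [hm.ne'])
      have h4 : s - z.1 i ≠ 0 := sub_ne_zero.2 (hs i)
      rw [h3] at h2
      rw [eq_mul_inv_iff_mul_eq₀ h4]
      linear_combination h2
    have hc : chainIntegral (fun t => ∑ k ∈ Finset.range n, (u k).derivative.eval s * t ^ k) d.1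
        = Q' s :=
      chainIntegral_sum_const_mul _ _ (fun k _ => (continuous_pow k).continuousOn) d.2.1
    have hd : chainIntegral (fun t => ∑ k ∈ Finset.range n, (u k).eval s * t ^ k) d.1
        = Q s :=
      chainIntegral_sum_const_mul _ _ (fun k _ => (continuous_pow k).continuousOn) d.2.1
    have he : (m : ℂ) * ∑ b, (s - z.1 b)⁻¹ * Y b
        = -(∑ i, (boundaryMult z i (H₁.mk d) : ℂ) *
          ((∏ i, (s - z.1 i) ^ m) * (s - z.1 i)⁻¹) + Q' s
          - (m * ∑ b, phiIntegrand m z.1 b s) * (∏ i, (s - z.1 i) ^ m)⁻¹ * Q s) := by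
      rw [← ha, ← hb, ← hc, ← hd, ← chainIntegral_const_mul, ← chainIntegral_const_mul,
        chainIntegral_congr (fun t _ => sum_inv_mul_phiIntegrand hm hu hs t) d.2.1]
      have hq : ∀ v : ℕ → ℂ, ContinuousOn
          (fun t : ℂ => ∑ k ∈ Finset.range n, v k * t ^ k) Set.univ := fun v =>
        Continuous.continuousOn (by fun_prop)
      have hq' : ContinuousOn
          (fun t : ℂ => ∑ k ∈ Finset.range n, (u k).eval s * (k * t ^ (k - 1))) Set.univ :=
        Continuous.continuousOn (by fun_prop)
      have hR := hq fun k => (u k).derivative.eval s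
      have hQR : ContinuousOn (fun t : ℂ => ∑ k ∈ Finset.range n, (u k).eval s * (k * t ^ (k - 1))
          + ∑ k ∈ Finset.range n, (u k).derivative.eval s * t ^ k) Set.univ := hq'.add hR
      have hS : ContinuousOn (fun t : ℂ => -1 * ((m * ∑ b, phiIntegrand m z.1 b s)
          * (∏ i, (s - z.1 i) ^ m)⁻¹ * ∑ k ∈ Finset.range n, (u k).eval s * t ^ k)) Set.univ :=
        Continuous.continuousOn (by fun_prop)
      rw [← chainIntegral_add hq' hR d.2.1, sub_eq_add_neg, ← neg_one_mul (chainIntegral _ _),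
        ← chainIntegral_const_mul (-1), ← chainIntegral_add hQR hS d.2.1,
        ← neg_one_mul (chainIntegral _ _), ← chainIntegral_const_mul (-1)]
      refine chainIntegral_congr (X := Set.univ) (fun t _ => ?_) d.2.1
      ring
    have hi : ∑ i, (boundaryMult z i (H₁.mk d) : ℂ) *
          ((∏ i, (s - z.1 i) ^ m) * (s - z.1 i)⁻¹) = (∏ i, (s - z.1 i) ^ m) *
          ∑ i, (boundaryMult z i (H₁.mk d) : ℂ) * (s - z.1 i)⁻¹ := by
      rw [Finset.mul_sum]; exact Finset.sum_congr rfl fun i _ => by ring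
    have hj : ∑ b, Y b * psiIntegrand m z.1 b s
        = (∏ i, (s - z.1 i) ^ m)⁻¹ * ∑ b, (s - z.1 b)⁻¹ * Y b := by
      rw [Finset.mul_sum]
      exact Finset.sum_congr rfl fun b _ => by rw [psiIntegrand]; ring
    rw [hi] at he
    rw [hj, eq_comm, neg_mul, neg_eq_iff_eq_neg, inv_mul_eq_iff_eq_mul₀ hm0]
    simp only [g, g']
    generalize (∑ i, (boundaryMult z i (H₁.mk d) : ℂ) * (s - z.1 i)⁻¹) = S at *
    generalize (∑ b, (s - z.1 b)⁻¹ * Y b) = T at *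
    generalize (∏ i, (s - z.1 i) ^ m) = f at *
    have : (m : ℂ) * -(f⁻¹ * T) = -f⁻¹ * (m * T) := by ring
    rw [this, he]
    field_simp
    ring
  have hcont : ContinuousOn (fun s => g' s * Q s + g s * Q' s) (punctured z.1) := by
    have hg0 : ∀ s ∈ punctured z.1, (∏ i, (s - z.1 i) ^ m) ≠ 0 := fun s hs =>
      prod_ne_zero_of_punctured m hs
    have hphi : ∀ b, Continuous (phiIntegrand m z.1 b) := continuous_phiIntegrand m z.1
    have h1 : ContinuousOn g (punctured z.1) := ContinuousOn.inv₀ (by fun_prop) hg0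
    have h2 : ContinuousOn g' (punctured z.1) := ContinuousOn.div (by fun_prop) (by fun_prop)
      fun s hs => pow_ne_zero 2 (hg0 s hs)
    have h3 : Continuous Q := by fun_prop
    have h4 : Continuous Q' := by fun_prop
    exact (h2.mul h3.continuousOn).add (h1.mul h4.continuousOn)
  -- `g' Q + g Q'` is the derivative of `g Q`, so its integral over the closed chain `c` vanishes
  have hexact : chainIntegral (fun s => g' s * Q s + g s * Q' s) c.1 = 0 := by
    rw [chainIntegral_eq_zeroChainEval hcont (fun s hs => (hg s hs).mul (hQ s)) c.2.1]
    have : boundary₁ ℂ c.1 = 0 := by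
      rw [← Finsupp.support_eq_empty]
      exact Finset.eq_empty_of_forall_notMem fun x hx => c.2.2 x hx
    rw [this, map_zero]
  have hw : ∀ i, ContinuousOn (fun s => (s - z.1 i)⁻¹) (punctured z.1) := fun i =>
    ContinuousOn.inv₀ (by fun_prop) fun s hs => sub_ne_zero.2 (hs i)
  have hsumw : ContinuousOn (fun s => ∑ i, (boundaryMult z i (H₁.mk d) : ℂ) * (s - z.1 i)⁻¹)
      (punctured z.1) := continuousOn_finsetSum _ fun i _ => continuousOn_const.mul (hw i)
  have hwind : ∀ i, windingNumber z.1 i (H₁.mk c)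
      = (2 * Real.pi * Complex.I)⁻¹ * chainIntegral (fun s => (s - z.1 i)⁻¹) c.1 := fun i => by
    rw [windingNumber, H₁.lift_mk, chainIntegralHom_apply, ← chainIntegral_const_mul]
    rfl
  have hsum : ∑ b, Y b * chainIntegral (psiIntegrand m z.1 b) c.1
      = -(m : ℂ)⁻¹ * ∑ i, (boundaryMult z i (H₁.mk d) : ℂ)
        * chainIntegral (fun s => (s - z.1 i)⁻¹) c.1 := by
    rw [← chainIntegral_sum_const_mul _ _ (fun b _ => continuousOn_psiIntegrand m z.1 b) c.2.1,
      chainIntegral_congr h1 c.2.1, chainIntegral_const_mul,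
      chainIntegral_add hsumw hcont c.2.1, hexact, add_zero,
      chainIntegral_sum_const_mul _ _ (fun i _ => hw i) c.2.1]
  calc _ = (2 * Real.pi * Complex.I)⁻¹ * ∑ b, Y b * chainIntegral (psiIntegrand m z.1 b) c.1 := by
        rw [Finset.mul_sum]
        exact Finset.sum_congr rfl fun b _ => by ring
    _ = _ := by
        rw [hsum]
        simp only [hwind, Finset.mul_sum]
        exact Finset.sum_congr rfl fun i _ => by ring

/-! ### The invariant form on the reflection representation -/

/-- The standard bilinear form `∑ b, v b * w b` on the reflection representation. -/
noncomputable def reflDot (N : ℕ) : reflSpace N →ₗ[ℂ] reflSpace N →ₗ[ℂ] ℂ :=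
  LinearMap.mk₂ ℂ (fun v w => ∑ b, v.1 b * w.1 b)
    (fun _ _ _ => by simp [add_mul, Finset.sum_add_distrib])
    (fun _ _ _ => by simp [Finset.mul_sum, mul_assoc])
    (fun _ _ _ => by simp [mul_add, Finset.sum_add_distrib])
    (fun c v w => by simp [Finset.mul_sum, mul_left_comm])

theorem reflDot_apply {N : ℕ} (v w : reflSpace N) : reflDot N v w = ∑ b, v.1 b * w.1 b := rfl

theorem reflDot_comm {N : ℕ} (v w : reflSpace N) : reflDot N v w = reflDot N w v := by
  simp only [reflDot_apply, mul_comm]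

theorem reflSpace_sum {N : ℕ} (v : reflSpace N) : ∑ b, v.1 b = 0 := v.2

theorem reflRep_apply {N : ℕ} (g : Equiv.Perm (Fin N)) (v : reflSpace N) (b : Fin N) :
    (reflRep N g v).1 b = v.1 (g⁻¹ b) := rfl

theorem reflDot_reflRep {N : ℕ} (g : Equiv.Perm (Fin N)) (v w : reflSpace N) :
    reflDot N (reflRep N g v) (reflRep N g w) = reflDot N v w := by
  simp only [reflDot_apply, reflRep_apply]
  exact Equiv.sum_comp g⁻¹ (fun b => v.1 b * w.1 b)

/-- The vector `ε_i - ε_j`. -/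
noncomputable def rootVec {N : ℕ} (i j : Fin N) : reflSpace N :=
  ⟨Pi.single i 1 - Pi.single j 1, by change ∑ b, _ = (0 : ℂ); simp⟩

theorem reflRep_rootVec {N : ℕ} (g : Equiv.Perm (Fin N)) (i j : Fin N) :
    reflRep N g (rootVec i j) = rootVec (g i) (g j) := by
  ext b
  simp [reflRep_apply, rootVec, Pi.single_apply, Equiv.symm_apply_eq]

theorem rootVec_neg {N : ℕ} (i j : Fin N) : rootVec j i = -rootVec i j := by
  ext b; simp [rootVec]

theorem eq_sum_rootVec {N : ℕ} (l : Fin N) (v : reflSpace N) :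
    v = ∑ i, v.1 i • rootVec i l := by
  apply Subtype.ext
  have h := reflSpace_sum v
  rw [AddSubmonoidClass.coe_finsetSum]
  funext b
  simp [rootVec, Finset.sum_apply, mul_sub, Finset.sum_sub_distrib, h, Pi.single_apply]

/-- Schur's lemma for the reflection representation: an invariant bilinear form is a multiple of
the standard one, because `ε_i - ε_j` is orthogonal to the vectors fixed by the transposition of
`i` and `j`. -/
theorem invariant_form_eq {N : ℕ} (hN : 2 ≤ N)
    (B : reflSpace N →ₗ[ℂ] reflSpace N →ₗ[ℂ] ℂ)
    (hB : ∀ g v w, B (reflRep N g v) (reflRep N g w) = B v w) :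
    ∃ K : ℂ, ∀ v w, B v w = K * reflDot N v w := by
  let l : Fin N := ⟨N - 1, by omega⟩
  let o : Fin N := ⟨0, by omega⟩
  have hol : o ≠ l := by simp [o, l, Fin.ext_iff]; omega
  have h1 : ∀ (i j : Fin N) (w : reflSpace N), i ≠ j →
      B (rootVec i j) w = (w.1 i - w.1 j) / 2 * B (rootVec i j) (rootVec i j) := by
    intro i j w hij
    set w' := w - ((w.1 i - w.1 j) / 2) • rootVec i j with hw'
    have hfix : reflRep N (Equiv.swap i j) w' = w' := by
      ext b
      rw [reflRep_apply, Equiv.swap_inv]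
      by_cases hbi : b = i
      · subst hbi
        simp [hw', rootVec, hij, hij.symm]; ring
      by_cases hbj : b = j
      · subst hbj
        simp [hw', rootVec, hij, hij.symm]; ring
      rw [Equiv.swap_apply_of_ne_of_ne hbi hbj]
    have h2 := hB (Equiv.swap i j) (rootVec i j) w'
    rw [hfix, reflRep_rootVec, Equiv.swap_apply_left, Equiv.swap_apply_right, rootVec_neg,
      map_neg, LinearMap.neg_apply, neg_eq_self] at h2
    have h3 : w = w' + ((w.1 i - w.1 j) / 2) • rootVec i j := by simp [hw']
    conv_lhs => rw [h3, map_add, h2, zero_add, map_smul, smul_eq_mul]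
  have h2 : ∀ i, i ≠ l → B (rootVec i l) (rootVec i l) = B (rootVec o l) (rootVec o l) := by
    intro i hi
    have := hB (Equiv.swap o i) (rootVec o l) (rootVec o l)
    rwa [reflRep_rootVec, Equiv.swap_apply_left,
      Equiv.swap_apply_of_ne_of_ne hol.symm hi.symm] at this
  refine ⟨B (rootVec o l) (rootVec o l) / 2, fun v w => ?_⟩
  have h3 : ∀ i, B (rootVec i l) w = (w.1 i - w.1 l) / 2 * B (rootVec o l) (rootVec o l) := by
    intro i
    by_cases hi : i = l
    · have : rootVec l l = (0 : reflSpace N) := by ext b; simp [rootVec]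
      simp [hi, this]
    · rw [h1 i l w hi, h2 i hi]
  conv_lhs => rw [eq_sum_rootVec l v]
  rw [map_sum, LinearMap.sum_apply]
  simp only [map_smul, LinearMap.smul_apply, h3, smul_eq_mul]
  have h4 : ∑ i, v.1 i * w.1 l = 0 := by rw [← Finset.sum_mul, reflSpace_sum, zero_mul]
  calc _ = B (rootVec o l) (rootVec o l) / 2 * ((∑ i, v.1 i * w.1 i) - ∑ i, v.1 i * w.1 l) := by
        rw [← Finset.sum_sub_distrib, Finset.mul_sum]
        exact Finset.sum_congr rfl fun i _ => by ring
    _ = _ := by rw [h4, sub_zero, reflDot_apply]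

/-- The pairing defined by an equivariant `θ` is a nonzero multiple of the standard form. -/
theorem exists_pairing_eq {N : ℕ} (hN : 2 ≤ N)
    (θ : Module.Dual ℂ (reflSpace N) ≃ₗ[ℂ] reflSpace N)
    (hθ : ∀ (g : Equiv.Perm (Fin N)) (l : Module.Dual ℂ (reflSpace N)),
      θ ((reflRep N).dual g l) = reflRep N g (θ l)) :
    ∃ K : ℂ, K ≠ 0 ∧ (∀ v w, pairing θ v w = K * reflDot N v w) ∧
      ((∀ v w, pairing θ v w = reflDot N v w) → K = 1) := by
  have hinv : ∀ g w, θ.symm (reflRep N g w) = (reflRep N).dual g (θ.symm w) := fun g w => by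
    rw [LinearEquiv.symm_apply_eq, hθ, LinearEquiv.apply_symm_apply]
  obtain ⟨K, hK⟩ := invariant_form_eq hN (LinearMap.flip θ.symm.toLinearMap) fun g v w => by
    simp only [LinearMap.flip_apply, LinearEquiv.coe_coe, hinv, Representation.dual_apply,
      Module.Dual.transpose_apply]
    change θ.symm w (reflRep N g⁻¹ (reflRep N g v)) = θ.symm w v
    rw [← Module.End.mul_apply, ← map_mul, inv_mul_cancel, map_one, Module.End.one_apply]
  let l : Fin N := ⟨N - 1, by omega⟩
  let o : Fin N := ⟨0, by omega⟩
  have hol : o ≠ l := by simp [o, l, Fin.ext_iff]; omega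
  have hdot : reflDot N (rootVec o l) (rootVec o l) = 2 := by
    rw [reflDot_apply]
    simp only [rootVec, Pi.sub_apply, Pi.single_apply]
    rw [Finset.sum_eq_add o l hol (fun b _ hb => by simp [hb.1, hb.2]) (by simp) (by simp)]
    simp [hol, hol.symm]
    norm_num
  refine ⟨K, ?_, hK, fun h => ?_⟩
  · rintro rfl
    have : θ.symm (rootVec o l) = 0 := LinearMap.ext fun v => by simpa using hK v (rootVec o l)
    rw [LinearEquiv.map_eq_zero_iff] at this
    simp [this] at hdot
  · have h1 := h (rootVec o l) (rootVec o l)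
    have h2 : pairing θ (rootVec o l) (rootVec o l) = _ := hK (rootVec o l) (rootVec o l)
    rw [h1, hdot] at h2
    linear_combination -h2 / 2

/-- A pair of dual families of `N - 1` vectors detects the zero vector. -/
theorem eq_zero_of_dual_families {N : ℕ} {l : Fin N} {u v : Fin N → reflSpace N} {k : ℂ}
    (hk : k ≠ 0) (h : ∀ a b, a ≠ l → b ≠ l → reflDot N (u a) (v b) = if a = b then k else 0)
    {w : reflSpace N} (hw : ∀ a, a ≠ l → reflDot N (u a) w = 0) : w = 0 := by
  -- the pairings with the `u a` map a space of dimension at most `N - 1` onto `ℂ^(N - 1)`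
  let ι := {a : Fin N // a ≠ l}
  let R : reflSpace N →ₗ[ℂ] ι → ℂ := LinearMap.pi fun a =>
    (LinearMap.proj a.1).comp (reflSpace N).subtype
  have hR : Function.Injective R := by
    rw [← LinearMap.ker_eq_bot, LinearMap.ker_eq_bot']
    intro x hx
    have hx' : ∀ a, a ≠ l → x.1 a = 0 := fun a ha => congrFun hx ⟨a, ha⟩
    have hs := reflSpace_sum x
    rw [Finset.sum_eq_single l (fun b _ hb => hx' b hb) (by simp)] at hs
    ext a
    by_cases ha : a = l
    · rw [ha]; exact hs
    · exact hx' a ha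
  let T : reflSpace N →ₗ[ℂ] ι → ℂ := LinearMap.pi fun a => reflDot N (u a)
  have hT : Function.Surjective T := fun y => by
    refine ⟨∑ b : ι, (y b / k) • v b, ?_⟩
    funext a
    simp only [T, LinearMap.pi_apply, map_sum, map_smul, smul_eq_mul]
    rw [Finset.sum_eq_single a (fun b _ hb => ?_) (by simp), h _ _ a.2 a.2, if_pos rfl,
      div_mul_cancel₀ _ hk]
    rw [h _ _ a.2 b.2, if_neg (fun e => hb (Subtype.ext e.symm)), mul_zero]
  have hfin := le_antisymm (LinearMap.finrank_le_finrank_of_injective hR)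
    (LinearMap.finrank_le_finrank_of_surjective hT)
  have hTi := (LinearMap.injective_iff_surjective_of_finrank_eq_finrank hfin).2 hT
  exact hTi (by rw [map_zero]; funext a; exact hw a a.2)

/-! ### The solutions attached to circles and to segments -/

theorem discPow_ne_zero {N : ℕ} (m : ℕ) (z : Conf N) : discPow m z.1 ≠ 0 :=
  Finset.prod_ne_zero_iff.2 fun _ _ => Finset.prod_ne_zero_iff.2 fun _ hj =>
    pow_ne_zero _ (sub_ne_zero.2 fun e => (Finset.mem_Ioi.1 hj).ne (z.2 e))

/-- The pairing of the integrals over two classes depends only on the winding numbers of the first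
and on the boundary of the second; the powers of the discriminant cancel. -/
theorem reflDot_psi_phi {N m : ℕ} (hm : 0 < m) (z : Conf N) (σ : H₁ (punctured z.1) ∅)
    (τ : H₁ (Set.univ : Set ℂ) (Set.range z.1)) :
    reflDot N (psi m hm z σ) (phi m hm z τ)
      = -(m : ℂ)⁻¹ * ∑ i, (boundaryMult z i τ : ℂ) * windingNumber z.1 i σ := by
  have h := sum_chainIntegral_mul_chainIntegral hm z σ.rep τ.rep
  rw [H₁.mk_rep, H₁.mk_rep] at h
  rw [← h, reflDot_apply]
  refine Finset.sum_congr rfl fun b _ => ?_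
  have h0 := discPow_ne_zero m z
  simp only [psi, phi]
  field_simp

theorem differentiableOn_psiIntegrand {N : ℕ} (m : ℕ) (z : Fin N → ℂ) (b : Fin N) :
    DifferentiableOn ℂ (psiIntegrand m z b) (punctured z) := by
  refine DifferentiableOn.mul (DifferentiableOn.inv (by fun_prop)
    (fun t ht => prod_ne_zero_of_punctured m ht)) (DifferentiableOn.inv (by fun_prop) ?_)
  exact fun t ht => sub_ne_zero.2 (ht b)

/-- `psi` can be computed on any cycle in the given class. -/
theorem psi_mk {N m : ℕ} (hm : 0 < m) (z : Conf N) (c : cycles₁ (punctured z.1) ∅) (b : Fin N) :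
    (psi m hm z (H₁.mk c)).1 b = discPow m z.1 *
      ((2 * Real.pi * Complex.I)⁻¹ * chainIntegral (psiIntegrand m z.1 b) c.1) := by
  have h1 := H₁.mk_eq_mk_iff.1 (H₁.mk_rep (H₁.mk c))
  have h2 := chainIntegralHom_eq_zero (isOpen_punctured z.1)
    (differentiableOn_psiIntegrand m z.1 b) _ h1
  rw [map_sub, sub_eq_zero, chainIntegralHom_apply, chainIntegralHom_apply] at h2
  simp only [psi, h2]

/-- `phi` in terms of the values of primitives of the integrands at the points `z i`. -/
theorem phi_apply_eq {N m : ℕ} (hm : 0 < m) (z : Conf N)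
    (τ : H₁ (Set.univ : Set ℂ) (Set.range z.1)) (b : Fin N) {G : ℂ → ℂ}
    (hG : ∀ t, HasDerivAt G (phiIntegrand m z.1 b t) t) :
    (phi m hm z τ).1 b = (discPow m z.1)⁻¹ * ∑ i, boundaryMult z i τ * G (z.1 i) := by
  simp only [phi]
  rw [chainIntegral_eq_zeroChainEval (continuous_phiIntegrand m z.1 b).continuousOn
    (fun t _ => hG t) τ.rep.2.1, zeroChainEval_boundary, H₁.mk_rep]
  simp

/-- The solution given by small circles around the `a`-th point. -/
noncomputable def psiCircle {N m : ℕ} (hm : 0 < m) (a : Fin N) (z : Conf N) : reflSpace N :=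
  psi m hm z (circleClass z.1 a (radius z a) (radius_pos z a) (fun _ h => radius_lt z h))

/-- The solution given by the segments from the `b`-th to the `l`-th point. -/
noncomputable def phiSegment {N m : ℕ} (hm : 0 < m) (l b : Fin N) (z : Conf N) : reflSpace N :=
  phi m hm z (segmentClass z.1 b l)

theorem reflDot_psi_phiSegment {N m : ℕ} (hm : 0 < m) (l b : Fin N) (z : Conf N)
    (σ : H₁ (punctured z.1) ∅) : reflDot N (psi m hm z σ) (phiSegment hm l b z)
      = (m : ℂ)⁻¹ * (windingNumber z.1 b σ - windingNumber z.1 l σ) := by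
  rw [phiSegment, reflDot_psi_phi]
  simp [boundaryMult_segmentClass, sub_mul]
  ring

theorem reflDot_psiCircle_phi {N m : ℕ} (hm : 0 < m) (a : Fin N) (z : Conf N)
    (τ : H₁ (Set.univ : Set ℂ) (Set.range z.1)) : reflDot N (psiCircle hm a z) (phi m hm z τ)
      = -(m : ℂ)⁻¹ * boundaryMult z a τ := by
  rw [psiCircle, reflDot_psi_phi]
  simp [windingNumber_circleClass]

theorem reflDot_psiCircle_phiSegment {N m : ℕ} (hm : 0 < m) {l a b : Fin N} (ha : a ≠ l)
    (z : Conf N) : reflDot N (psiCircle hm a z) (phiSegment hm l b z)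
      = if a = b then (m : ℂ)⁻¹ else 0 := by
  rw [phiSegment, reflDot_psiCircle_phi, boundaryMult_segmentClass]
  split_ifs <;> simp_all

theorem eq_zero_of_reflDot_psiCircle {N m : ℕ} (hm : 0 < m) (l : Fin N) (z : Conf N)
    {w : reflSpace N} (hw : ∀ a, a ≠ l → reflDot N (psiCircle hm a z) w = 0) : w = 0 :=
  eq_zero_of_dual_families (u := fun a => psiCircle hm a z) (v := fun b => phiSegment hm l b z)
    (k := (m : ℂ)⁻¹) (by simpa using hm.ne')
    (fun a b ha _ => reflDot_psiCircle_phiSegment hm ha z) hw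

theorem eq_zero_of_reflDot_phiSegment {N m : ℕ} (hm : 0 < m) (l : Fin N) (z : Conf N)
    {w : reflSpace N} (hw : ∀ b, b ≠ l → reflDot N w (phiSegment hm l b z) = 0) : w = 0 :=
  eq_zero_of_dual_families (u := fun b => phiSegment hm l b z) (v := fun a => psiCircle hm a z)
    (k := (m : ℂ)⁻¹) (l := l) (by simpa using hm.ne')
    (fun b a _ ha => by
      rw [reflDot_comm, reflDot_psiCircle_phiSegment hm ha z]; simp only [eq_comm])
    (fun b hb => by rw [reflDot_comm]; exact hw b hb)

theorem psi_eq_sum_psiCircle {N m : ℕ} (hm : 0 < m) (z : Conf N) (σ : H₁ (punctured z.1) ∅) :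
    psi m hm z σ = ∑ a, windingNumber z.1 a σ • psiCircle hm a z := by
  rcases Nat.eq_zero_or_pos N with rfl | hN
  · ext b; exact b.elim0
  rw [← sub_eq_zero]
  refine eq_zero_of_reflDot_phiSegment hm ⟨0, hN⟩ z fun b _ => ?_
  rw [map_sub, map_sum, LinearMap.sub_apply, LinearMap.sum_apply, reflDot_psi_phiSegment]
  simp only [map_smul, LinearMap.smul_apply, phiSegment, reflDot_psiCircle_phi,
    boundaryMult_segmentClass, smul_eq_mul]
  simp [mul_sub, sub_mul, mul_comm, Finset.sum_sub_distrib]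
  ring

theorem phi_eq_sum_phiSegment {N m : ℕ} (hm : 0 < m) (l : Fin N) (z : Conf N)
    (τ : H₁ (Set.univ : Set ℂ) (Set.range z.1)) :
    phi m hm z τ = ∑ b, (-boundaryMult z b τ : ℂ) • phiSegment hm l b z := by
  rw [← sub_eq_zero]
  refine eq_zero_of_reflDot_psiCircle hm l z fun a ha => ?_
  rw [map_sub, map_sum, reflDot_psiCircle_phi]
  simp [reflDot_psiCircle_phiSegment hm ha, mul_comm]

theorem psiCircle_apply {N m : ℕ} (hm : 0 < m) (a c : Fin N) (z : Conf N) (ε : ℝ) (hε : 0 < ε)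
    (h : ∀ j, j ≠ a → ε < ‖z.1 j - z.1 a‖) :
    (psiCircle hm a z).1 c = discPow m z.1 * ((2 * Real.pi * Complex.I)⁻¹ *
      ∮ t in C(z.1 a, ε), psiIntegrand m z.1 c t) := by
  -- the circles of the two radii have the same winding numbers
  have : psiCircle hm a z = psi m hm z (circleClass z.1 a ε hε h) := by
    rw [psi_eq_sum_psiCircle hm z (circleClass z.1 a ε hε h)]
    simp [windingNumber_circleClass]
  rw [this, circleClass, psi_mk, ← chainIntegralHom_apply, chainIntegralHom_single,
    pathIntegral_circlePath]

theorem phiSegment_apply {N m : ℕ} (hm : 0 < m) (l b c : Fin N) (z : Conf N) :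
    (phiSegment hm l b z).1 c = (discPow m z.1)⁻¹ *
      pathIntegral (phiIntegrand m z.1 c) (segmentPath (z.1 b, z.1 l)) := by
  obtain ⟨G, hG⟩ := convex_univ.exists_forall_hasDerivWithinAt (𝕜 := ℂ)
    (f := phiIntegrand m z.1 c) (by unfold phiIntegrand; fun_prop)
  simp only [Set.mem_univ, hasDerivWithinAt_univ, forall_const] at hG
  rw [phiSegment, phi_apply_eq hm z _ c hG, ← chainIntegralHom_single, chainIntegralHom_apply,
    chainIntegral_eq_zeroChainEval (continuous_phiIntegrand m z.1 c).continuousOn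
      (fun t _ => hG t) (single_segmentPath_mem_cycles z.1 b l).1]
  simp [boundaryMult_segmentClass, boundary₁_single, zeroChainEval_single, segmentPath, sub_mul]

/-! ### Differentiation of functions with values in the reflection representation -/

theorem eventually_injective {N : ℕ} (z : Conf N) :
    ∀ᶠ z' in nhds z.1, Function.Injective z' := (isOpen_conf N).mem_nhds z.2

/-- Functions with values in the reflection representation can be differentiated coordinatewise.
It suffices that the coordinates agree with differentiable functions at the configurations. -/
theorem extendConf_coordinates {N : ℕ} {ψ : Conf N → reflSpace N}
    {F : (Fin N → ℂ) → Fin N → ℂ} (hF : ∀ z : Conf N, F z.1 = (ψ z).1) {z : Conf N}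
    (hd : DifferentiableAt ℂ F z.1) : DifferentiableAt ℂ (extendConf ψ) z.1 ∧
      ∀ v, (fderiv ℂ (extendConf ψ) z.1 v).1 = fderiv ℂ F z.1 v := by
  obtain ⟨P, hP⟩ := (reflSpace N).subtype.exists_leftInverse_of_injective
    (reflSpace N).ker_subtype
  have hP' : ∀ x : reflSpace N, P x.1 = x := fun x => LinearMap.congr_fun hP x
  have h1 : extendConf ψ =ᶠ[nhds z.1] fun z' => P.toContinuousLinearMap (F z') := by
    filter_upwards [eventually_injective z] with z' hz'
    have h2 := hF ⟨z', hz'⟩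
    simp only at h2
    rw [extendConf_apply ψ ⟨z', hz'⟩, h2]
    exact (hP' _).symm
  have h3 : DifferentiableAt ℂ (extendConf ψ) z.1 :=
    (P.toContinuousLinearMap.differentiableAt.comp z.1 hd).congr_of_eventuallyEq h1
  refine ⟨h3, fun v => ?_⟩
  have h4 : (fun z' => (reflSpace N).subtypeL (extendConf ψ z')) =ᶠ[nhds z.1] F := by
    filter_upwards [eventually_injective z] with z' hz'
    rw [extendConf_apply ψ ⟨z', hz'⟩]
    exact (hF ⟨z', hz'⟩).symm
  have h5 := ((reflSpace N).subtypeL.hasFDerivAt.comp z.1 h3.hasFDerivAt).congr_of_eventuallyEq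
    h4.symm
  rw [h5.fderiv]
  rfl

theorem hasFDerivAt_reflDot {N : ℕ} {ψ φ : (Fin N → ℂ) → reflSpace N} {z : Fin N → ℂ}
    {ψ' φ' : (Fin N → ℂ) →L[ℂ] reflSpace N} (hψ : HasFDerivAt ψ ψ' z)
    (hφ : HasFDerivAt φ φ' z) : ∃ L : (Fin N → ℂ) →L[ℂ] ℂ,
      HasFDerivAt (fun z => reflDot N (ψ z) (φ z)) L z ∧
      ∀ v, L v = reflDot N (ψ' v) (φ z) + reflDot N (ψ z) (φ' v) := by
  let p : Fin N → reflSpace N →L[ℂ] ℂ := fun b =>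
    (ContinuousLinearMap.proj b).comp (reflSpace N).subtypeL
  have h := HasFDerivAt.fun_sum (u := Finset.univ) fun b (_ : b ∈ Finset.univ) =>
    ((p b).hasFDerivAt.comp z hψ).mul ((p b).hasFDerivAt.comp z hφ)
  refine ⟨_, h, fun v => ?_⟩
  simp only [sum_apply, reflDot_apply, ← Finset.sum_add_distrib]
  refine Finset.sum_congr rfl fun b _ => ?_
  simp [p]
  ring

theorem differentiableAt_det {E n : Type*} [NormedAddCommGroup E] [NormedSpace ℂ E] [Fintype n]
    [DecidableEq n] {A : E → Matrix n n ℂ} {x : E}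
    (h : ∀ i j, DifferentiableAt ℂ (fun y => A y i j) x) :
    DifferentiableAt ℂ (fun y => (A y).det) x := by
  simp only [Matrix.det_apply']
  exact DifferentiableAt.fun_sum fun σ _ => (differentiableAt_const _).mul
    (HasFDerivAt.finsetProd fun i _ => (h _ _).hasFDerivAt).differentiableAt

/-! ### The Knizhnik–Zamolodchikov operators and duality -/

/-- The operator `κ ∑_{j ≠ i} (s_{ij} + 1) / (z i - z j)` on the reflection representation. -/
noncomputable def kzOperator {N : ℕ} (κ : ℂ) (z : Fin N → ℂ) (i : Fin N) (v : reflSpace N) :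
    reflSpace N :=
  κ • ∑ j ∈ Finset.univ.erase i, (z i - z j)⁻¹ • (reflRep N (Equiv.swap i j) v + v)

/-- The KZ operators are symmetric, since transpositions are orthogonal involutions. -/
theorem reflDot_kzOperator {N : ℕ} (κ : ℂ) (z : Fin N → ℂ) (i : Fin N) (v w : reflSpace N) :
    reflDot N (kzOperator κ z i v) w = reflDot N v (kzOperator κ z i w) := by
  simp only [kzOperator, map_smul, map_sum, LinearMap.smul_apply, LinearMap.sum_apply, map_add,
    LinearMap.add_apply]
  congr 1
  refine Finset.sum_congr rfl fun j _ => ?_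
  rw [← reflDot_reflRep (Equiv.swap i j) (reflRep N (Equiv.swap i j) v) w,
    ← Module.End.mul_apply, ← map_mul, Equiv.swap_mul_self, map_one, Module.End.one_apply]

theorem kzOperator_neg {N : ℕ} (κ : ℂ) (z : Fin N → ℂ) (i : Fin N) (v : reflSpace N) :
    kzOperator (-κ) z i v = -kzOperator κ z i v := by
  exact neg_smul (M := reflSpace N) κ _

theorem mem_KZ_iff {N : ℕ} {κ : ℤ} {ψ : Conf N → reflSpace N} :
    ψ ∈ KZ (reflRep N) κ ↔ ∀ z : Conf N, DifferentiableAt ℂ (extendConf ψ) z.1 ∧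
      ∀ i, fderiv ℂ (extendConf ψ) z.1 (Pi.single i 1) = kzOperator κ z.1 i (ψ z) := by
  constructor
  · rintro ⟨h1, h2⟩ z
    exact ⟨h1.differentiableAt ((isOpen_conf N).mem_nhds z.2), fun i => h2 z i⟩
  · intro h
    exact ⟨fun z hz => (h ⟨z, hz⟩).1.differentiableWithinAt, fun z i => (h z).2 i⟩

/-- Solutions with opposite parameters have constant pairing: the KZ operators are symmetric. -/
theorem reflDot_const_of_mem_KZ {N : ℕ} {κ : ℤ} {ψ φ : Conf N → reflSpace N}
    (hψ : ψ ∈ KZ (reflRep N) κ) (hφ : φ ∈ KZ (reflRep N) (-κ)) (z z' : Conf N) :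
    reflDot N (ψ z) (φ z) = reflDot N (ψ z') (φ z') := by
  rw [mem_KZ_iff] at hψ hφ
  have key : ∀ z : Conf N, HasFDerivAt
      (fun z => reflDot N (extendConf ψ z) (extendConf φ z)) (0 : (Fin N → ℂ) →L[ℂ] ℂ) z.1 := by
    intro z
    obtain ⟨L, hL, hL'⟩ := hasFDerivAt_reflDot (hψ z).1.hasFDerivAt (hφ z).1.hasFDerivAt
    have : L = 0 := by
      refine ContinuousLinearMap.coe_injective (LinearMap.pi_ext' fun i => LinearMap.ext_ring ?_)
      simp only [LinearMap.comp_apply, LinearMap.coe_single, ContinuousLinearMap.coe_coe, hL',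
        (hψ z).2, (hφ z).2, extendConf_apply]
      rw [Int.cast_neg, kzOperator_neg, map_neg, reflDot_kzOperator, add_neg_cancel]
      simp
    rwa [this] at hL
  have h := (isOpen_conf N).is_const_of_fderiv_eq_zero (𝕜 := ℂ) (isPreconnected_injective N)
    (f := fun z => reflDot N (extendConf ψ z) (extendConf φ z))
    (fun z hz => (key ⟨z, hz⟩).differentiableAt.differentiableWithinAt)
    (fun z hz => (key ⟨z, hz⟩).fderiv) z.2 z'.2
  simpa only [extendConf_apply] using h

/-- A function with constant pairings with solutions for `-κ` that span the representation at each
configuration is a solution for `κ`. -/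
theorem mem_KZ_of_dual {N : ℕ} {κ : ℤ} {l : Fin N} {ψ : Conf N → reflSpace N}
    {φ : Fin N → Conf N → reflSpace N} (hφ : ∀ b, φ b ∈ KZ (reflRep N) (-κ))
    (hnd : ∀ (z : Conf N) (w : reflSpace N), (∀ b, b ≠ l → reflDot N w (φ b z) = 0) → w = 0)
    {k : Fin N → ℂ} (h : ∀ (z : Conf N) b, b ≠ l → reflDot N (ψ z) (φ b z) = k b) :
    ψ ∈ KZ (reflRep N) κ := by
  simp only [mem_KZ_iff] at hφ
  -- `ψ` solves a linear system whose coefficients are holomorphic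
  let M : (Fin N → ℂ) → Matrix (Fin N) (Fin N) ℂ := fun z =>
    Matrix.of fun b c => if b = l then 1 else (extendConf (φ b) z).1 c
  let r : Fin N → ℂ := fun b => if b = l then 0 else k b
  have hM : ∀ (z : Conf N) (x : Fin N → ℂ) (b : Fin N), (M z.1 *ᵥ x) b
      = if b = l then ∑ c, x c else ∑ c, (φ b z).1 c * x c := by
    intro z x b
    simp only [Matrix.mulVec, dotProduct, M, Matrix.of_apply, extendConf_apply]
    split_ifs <;> simp
  have hinj : ∀ (z : Conf N) (x : Fin N → ℂ), M z.1 *ᵥ x = 0 → x = 0 := by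
    intro z x hx
    have hs : ∑ c, x c = 0 := by
      have := congrFun hx l
      rwa [hM, if_pos rfl] at this
    have := hnd z ⟨x, hs⟩ fun b hb => by
      have := congrFun hx b
      rw [hM, if_neg hb] at this
      rw [reflDot_comm]
      exact this
    exact congrArg Subtype.val this
  have hdet : ∀ z : Conf N, (M z.1).det ≠ 0 := fun z h0 => by
    obtain ⟨x, hx, hx'⟩ := Matrix.exists_mulVec_eq_zero_iff.2 h0
    exact hx (hinj z x hx')
  have hψM : ∀ z : Conf N, M z.1 *ᵥ (ψ z).1 = r := fun z => by
    funext b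
    rw [hM]
    by_cases hb : b = l
    · simp [hb, r, reflSpace_sum]
    · simp only [hb, if_false, r, ← h z b hb]
      rw [reflDot_comm]; rfl
  -- by Cramer's rule, `ψ` is holomorphic
  let F : (Fin N → ℂ) → Fin N → ℂ := fun z => (M z).det⁻¹ • (M z).cramer r
  have hF : ∀ z : Conf N, F z.1 = (ψ z).1 := fun z => by
    rw [← sub_eq_zero]
    apply hinj z
    rw [Matrix.mulVec_sub, hψM, Matrix.mulVec_smul, Matrix.mulVec_cramer, inv_smul_smul₀ (hdet z),
      sub_self]
  have hMd : ∀ (z : Conf N) b c, DifferentiableAt ℂ (fun z => M z b c) z.1 := fun z b c => by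
    by_cases hb : b = l
    · simp only [M, hb, Matrix.of_apply, if_true]; exact differentiableAt_const _
    · simp only [M, hb, Matrix.of_apply, if_false]
      exact ((ContinuousLinearMap.proj (R := ℂ) (φ := fun _ : Fin N => ℂ) c).comp
        (reflSpace N).subtypeL).differentiableAt.comp z.1 (hφ b z).1
  have hFd : ∀ z : Conf N, DifferentiableAt ℂ F z.1 := fun z => by
    refine differentiableAt_pi.2 fun c => ?_
    simp only [F, Pi.smul_apply, Matrix.cramer_apply, smul_eq_mul]
    refine ((differentiableAt_det (hMd z)).inv (hdet z)).mul (differentiableAt_det fun a b => ?_)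
    by_cases hb : b = c
    · simp [hb]
    · simpa [Matrix.updateCol_apply, hb] using hMd z a b
  have hd : ∀ z : Conf N, DifferentiableAt ℂ (extendConf ψ) z.1 := fun z =>
    (extendConf_coordinates hF (hFd z)).1
  refine mem_KZ_iff.2 fun z => ⟨hd z, fun i => ?_⟩
  rw [← sub_eq_zero]
  -- differentiate the constant pairing with `φ b`
  refine hnd z _ fun b hb => ?_
  obtain ⟨L, hL, hL'⟩ := hasFDerivAt_reflDot (hd z).hasFDerivAt (hφ b z).1.hasFDerivAt
  have hL0 : HasFDerivAt (fun z => reflDot N (extendConf ψ z) (extendConf (φ b) z))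
      (0 : (Fin N → ℂ) →L[ℂ] ℂ) z.1 := by
    refine (hasFDerivAt_const (k b) z.1).congr_of_eventuallyEq ?_
    filter_upwards [eventually_injective z] with z' hz'
    rw [extendConf_apply ψ ⟨z', hz'⟩, extendConf_apply (φ b) ⟨z', hz'⟩, h _ b hb]
  have := hL' (Pi.single i 1)
  rw [hL.unique hL0, (hφ b z).2, Int.cast_neg, kzOperator_neg, map_neg, extendConf_apply,
    extendConf_apply, ← reflDot_kzOperator] at this
  rw [map_sub, LinearMap.sub_apply, sub_eq_add_neg, ← this]
  rfl

/-! ### The solutions given by segments -/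

/-- The Leibniz rule for products, in logarithmic form. -/
theorem HasDerivAt.finsetProd_log {ι : Type*} (s : Finset ι) {f : ι → ℂ → ℂ} {g : ι → ℂ} {x : ℂ}
    (h : ∀ i ∈ s, HasDerivAt (f i) (f i x * g i) x) :
    HasDerivAt (fun w => ∏ i ∈ s, f i w) ((∏ i ∈ s, f i x) * ∑ i ∈ s, g i) x := by
  classical
  induction s using Finset.induction_on with
  | empty => simpa using hasDerivAt_const x (1 : ℂ)
  | insert a s ha ih =>
    have h1 := h a (Finset.mem_insert_self a s)
    have h2 := ih fun i hi => h i (Finset.mem_insert_of_mem hi)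
    simp only [Finset.prod_insert ha, Finset.sum_insert ha]
    exact (h1.mul h2).congr_deriv (by ring)

/-- The point `z` with its `i`-th coordinate moved by `w`. -/
noncomputable def shiftCoord {N : ℕ} (z : Fin N → ℂ) (i : Fin N) (w : ℂ) : Fin N → ℂ :=
  z + w • Pi.single i 1

@[simp] theorem shiftCoord_zero {N : ℕ} (z : Fin N → ℂ) (i : Fin N) : shiftCoord z i 0 = z := by
  simp [shiftCoord]

@[simp] theorem shiftCoord_same {N : ℕ} (z : Fin N → ℂ) (i : Fin N) (w : ℂ) :
    shiftCoord z i w i = z i + w := by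
  simp [shiftCoord]

theorem shiftCoord_of_ne {N : ℕ} (z : Fin N → ℂ) {i j : Fin N} (h : j ≠ i) (w : ℂ) :
    shiftCoord z i w j = z j := by
  simp [shiftCoord, h]

theorem hasDerivAt_shiftCoord {N : ℕ} (z : Fin N → ℂ) (i : Fin N) :
    HasDerivAt (shiftCoord z i) (Pi.single i 1) 0 := by
  have := ((hasDerivAt_id (0 : ℂ)).smul_const (Pi.single i (1 : ℂ) : Fin N → ℂ)).const_add z
  rw [one_smul] at this
  exact this

theorem hasDerivAt_shiftCoord_apply {N : ℕ} (z : Fin N → ℂ) (i j : Fin N) :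
    HasDerivAt (fun w : ℂ => shiftCoord z i w j) (if j = i then 1 else 0) 0 := by
  simpa [Pi.single_apply] using hasDerivAt_pi.1 (hasDerivAt_shiftCoord z i) j

theorem hasDerivAt_discPow {N : ℕ} (m : ℕ) (z : Conf N) (i : Fin N) :
    HasDerivAt (fun w : ℂ => discPow m (shiftCoord z.1 i w))
      (discPow m z.1 * (2 * m * ∑ j ∈ Finset.univ.erase i, (z.1 i - z.1 j)⁻¹)) 0 := by
  have hfac : ∀ a b, a ≠ b → HasDerivAt
      (fun w : ℂ => (shiftCoord z.1 i w a - shiftCoord z.1 i w b) ^ (2 * m))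
      ((z.1 a - z.1 b) ^ (2 * m) * (2 * m *
        (((if a = i then 1 else 0) - if b = i then 1 else 0) * (z.1 a - z.1 b)⁻¹))) 0 := by
    intro a b hab
    have h0 : z.1 a - z.1 b ≠ 0 := sub_ne_zero.2 fun e => hab (z.2 e)
    refine (((hasDerivAt_shiftCoord_apply z.1 i a).sub (hasDerivAt_shiftCoord_apply z.1 i b)).pow
      (2 * m)).congr_deriv ?_
    rcases Nat.eq_zero_or_pos m with rfl | hm
    · simp
    have e : (z.1 a - z.1 b) ^ (2 * m) = (z.1 a - z.1 b) ^ (2 * m - 1) * (z.1 a - z.1 b) := by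
      rw [← pow_succ]; congr 1; omega
    simp only [Pi.sub_apply, shiftCoord_zero, e]
    push_cast
    field_simp
  have h := HasDerivAt.finsetProd_log Finset.univ
    (f := fun a w => ∏ b ∈ Finset.Ioi a,
      (shiftCoord z.1 i w a - shiftCoord z.1 i w b) ^ (2 * m))
    (g := fun a => ∑ b ∈ Finset.Ioi a, (2 * m *
        (((if a = i then 1 else 0) - if b = i then 1 else 0) * (z.1 a - z.1 b)⁻¹)))
    (x := 0) (fun a _ => by
      have := HasDerivAt.finsetProd_log (Finset.Ioi a) (x := 0) (f := fun b w =>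
        (shiftCoord z.1 i w a - shiftCoord z.1 i w b) ^ (2 * m))
        (g := fun b => 2 * m *
          (((if a = i then 1 else 0) - if b = i then 1 else 0) * (z.1 a - z.1 b)⁻¹))
        (fun b hb => by
          simpa using hfac a b (Finset.mem_Ioi.1 hb).ne)
      exact this)
  refine h.congr_deriv ?_
  simp only [shiftCoord_zero]
  unfold discPow
  congr 1
  simp only [← Finset.mul_sum]
  congr 1
  simp only [sub_mul, Finset.sum_sub_distrib, ite_mul, one_mul, zero_mul]
  have h1 : ∑ a, ∑ b ∈ Finset.Ioi a, (if a = i then (z.1 a - z.1 b)⁻¹ else 0)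
      = ∑ b ∈ Finset.Ioi i, (z.1 i - z.1 b)⁻¹ := by
    rw [Finset.sum_eq_single i (fun a _ ha => by simp [ha]) (by simp)]
    simp
  have h2 : ∑ a, ∑ b ∈ Finset.Ioi a, (if b = i then (z.1 a - z.1 b)⁻¹ else 0)
      = -∑ a ∈ Finset.Iio i, (z.1 i - z.1 a)⁻¹ := by
    rw [← Finset.sum_neg_distrib, ← Finset.sum_subset (Finset.subset_univ (Finset.Iio i))]
    · refine Finset.sum_congr rfl fun a ha => ?_
      rw [Finset.sum_ite_eq', if_pos (Finset.mem_Ioi.2 (Finset.mem_Iio.1 ha)), ← inv_neg, neg_sub]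
    · intro a _ ha
      rw [Finset.sum_ite_eq', if_neg (by simpa using ha)]
  rw [h1, h2, sub_neg_eq_add, ← Finset.sum_union
    (Finset.disjoint_left.2 fun a ha hb => lt_asymm (Finset.mem_Ioi.1 ha) (Finset.mem_Iio.1 hb))]
  refine Finset.sum_congr ?_ fun _ _ => rfl
  ext a
  simp [lt_or_lt_iff_ne, eq_comm]

theorem differentiable_mvPolynomial_eval {N : ℕ} (p : MvPolynomial (Fin N) ℂ) :
    Differentiable ℂ fun z : Fin N → ℂ => MvPolynomial.eval z p := by
  induction p using MvPolynomial.induction_on with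
  | C a => simp
  | add p q hp hq => simp only [map_add]; exact hp.fun_add hq
  | mul_X p i hp =>
    simp only [map_mul, MvPolynomial.eval_X]
    exact hp.fun_mul (differentiable_apply i)

/-- The integrands `phiIntegrand` are polynomials in `t` with coefficients holomorphic in `z`. -/
theorem exists_coeff_phiIntegrand {N : ℕ} (m : ℕ) (c : Fin N) :
    ∃ (n : ℕ) (p : ℕ → (Fin N → ℂ) → ℂ), (∀ k, Differentiable ℂ (p k)) ∧
      ∀ z t, phiIntegrand m z c t = ∑ k ∈ Finset.range n, p k z * t ^ k := by
  let P : Polynomial (MvPolynomial (Fin N) ℂ) :=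
    (∏ i ∈ Finset.univ.erase c, (Polynomial.X - Polynomial.C (MvPolynomial.X i)) ^ m)
      * (Polynomial.X - Polynomial.C (MvPolynomial.X c)) ^ (m - 1)
  refine ⟨P.natDegree + 1, fun k z => MvPolynomial.eval z (P.coeff k),
    fun k => differentiable_mvPolynomial_eval _, fun z t => ?_⟩
  rw [← Polynomial.eval₂_eq_sum_range (f := MvPolynomial.eval z) (p := P) t]
  simp [P, phiIntegrand, Polynomial.eval₂_mul, Polynomial.eval₂_finsetProd, Polynomial.eval₂_pow]

/-- A primitive `G` of `phiIntegrand` depending holomorphically on the points, together with its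
derivatives `G'` in the coordinates of the points. -/
theorem exists_primitive_phiIntegrand {N : ℕ} (m : ℕ) (c : Fin N) :
    ∃ (G : (Fin N → ℂ) → ℂ → ℂ) (G' : (Fin N → ℂ) → Fin N → ℂ → ℂ),
      (∀ z, G z 0 = 0) ∧ (∀ z t, HasDerivAt (G z) (phiIntegrand m z c t) t) ∧
      (Differentiable ℂ fun p : (Fin N → ℂ) × ℂ => G p.1 p.2) ∧ (∀ z i, G' z i 0 = 0) ∧
      (∀ z i t d, HasDerivAt (fun w : ℂ => phiIntegrand m (shiftCoord z i w) c t) d 0 →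
        HasDerivAt (G' z i) d t) ∧
      ∀ z i (x : ℂ → ℂ) (x' : ℂ), HasDerivAt x x' 0 →
        HasDerivAt (fun w => G (shiftCoord z i w) (x w))
          (G' z i (x 0) + phiIntegrand m z c (x 0) * x') 0 := by
  obtain ⟨n, p, hp, h⟩ := exists_coeff_phiIntegrand m c
  have hpow : ∀ (k : ℕ) (t : ℂ), HasDerivAt (fun t : ℂ => t ^ (k + 1) / (k + 1)) (t ^ k) t := by
    intro k t
    have h0 : (k : ℂ) + 1 ≠ 0 := by exact_mod_cast k.succ_ne_zero
    refine ((hasDerivAt_pow (k + 1) t).div_const ((k : ℂ) + 1)).congr_deriv ?_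
    rw [Nat.add_sub_cancel]
    push_cast
    field_simp
  have hline : ∀ (z : Fin N → ℂ) i k, HasDerivAt (fun w : ℂ => p k (shiftCoord z i w))
      (fderiv ℂ (p k) z (Pi.single i 1)) 0 := by
    intro z i k
    exact HasFDerivAt.comp_hasDerivAt_of_eq 0 (hp k z).hasFDerivAt (hasDerivAt_shiftCoord z i)
      (by simp)
  refine ⟨fun z t => ∑ k ∈ Finset.range n, p k z * (t ^ (k + 1) / (k + 1)),
    fun z i t => ∑ k ∈ Finset.range n,
      fderiv ℂ (p k) z (Pi.single i 1) * (t ^ (k + 1) / (k + 1)), by simp, fun z t => ?_, ?_,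
    by simp, fun z i t d hd => ?_, fun z i x x' hx => ?_⟩
  · rw [h]
    exact HasDerivAt.fun_sum fun k _ => (hpow k t).const_mul _
  · refine Differentiable.fun_sum fun k _ => ?_
    refine ((hp k).comp differentiable_fst).fun_mul ?_
    fun_prop
  · have h1 : HasDerivAt (fun w : ℂ => phiIntegrand m (shiftCoord z i w) c t)
        (∑ k ∈ Finset.range n, fderiv ℂ (p k) z (Pi.single i 1) * t ^ k) 0 := by
      simp only [h]
      exact HasDerivAt.fun_sum fun k _ => (hline z i k).mul_const _
    rw [hd.unique h1]
    exact HasDerivAt.fun_sum fun k _ => (hpow k t).const_mul _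
  · rw [h, Finset.sum_mul, ← Finset.sum_add_distrib]
    refine HasDerivAt.fun_sum fun k _ => ?_
    refine ((hline z i k).mul ((hpow k (x 0)).comp 0 hx)).congr_deriv ?_
    simp only [Function.comp_apply, shiftCoord_zero]
    ring

/-- The derivative of `phiIntegrand m z c` in `z i`, for `i ≠ c`, is a multiple of the difference of
two of the integrands: only the factor `(t - z i) ^ m` depends on `z i`. -/
theorem hasDerivAt_phiIntegrand_line {N m : ℕ} (hm : 0 < m) (z : Conf N) {i c : Fin N}
    (hic : c ≠ i) (t : ℂ) :
    HasDerivAt (fun w : ℂ => phiIntegrand m (shiftCoord z.1 i w) c t)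
      (m * (z.1 i - z.1 c)⁻¹ * (phiIntegrand m z.1 c t - phiIntegrand m z.1 i t)) 0 := by
  set R : ℂ := (∏ j ∈ (Finset.univ.erase c).erase i, (t - z.1 j) ^ m) * (t - z.1 c) ^ (m - 1)
    with hR
  have h0 : z.1 i - z.1 c ≠ 0 := sub_ne_zero.2 fun e => hic (z.2 e).symm
  have hi : i ∈ Finset.univ.erase c := Finset.mem_erase.2 ⟨hic.symm, Finset.mem_univ _⟩
  have hc : c ∈ Finset.univ.erase i := Finset.mem_erase.2 ⟨hic, Finset.mem_univ _⟩
  have e1 : ∀ w : ℂ, phiIntegrand m (shiftCoord z.1 i w) c t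
      = (t - (z.1 i + w)) ^ m * R := by
    intro w
    have hj : ∀ j, j ≠ i → shiftCoord z.1 i w j = z.1 j := fun j hj =>
      shiftCoord_of_ne _ hj w
    rw [phiIntegrand, ← Finset.mul_prod_erase _ _ hi, hj c hic, hR, mul_assoc]
    congr 2
    · simp
    · exact Finset.prod_congr rfl fun j hj' => by rw [hj j (Finset.mem_erase.1 hj').1]
  have e2 : phiIntegrand m z.1 c t = (t - z.1 i) ^ m * R := by simpa using e1 0
  have e3 : phiIntegrand m z.1 i t = (t - z.1 i) ^ (m - 1) * (t - z.1 c) * R := by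
    rw [phiIntegrand, ← Finset.mul_prod_erase _ _ hc, Finset.erase_right_comm, hR,
      ← Nat.sub_add_cancel hm, pow_succ, Nat.add_sub_cancel]
    ring
  have e4 : (t - z.1 i) ^ m = (t - z.1 i) ^ (m - 1) * (t - z.1 i) := by
    rw [← pow_succ, Nat.sub_add_cancel hm]
  simp only [e1]
  have h1 : HasDerivAt (fun w : ℂ => t - (z.1 i + w)) (-1) 0 := by
    simpa using ((hasDerivAt_id (0 : ℂ)).const_add (z.1 i)).const_sub t
  refine ((h1.pow m).mul_const R).congr_deriv ?_
  rw [e2, e3, e4]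
  simp only [add_zero]
  field_simp
  ring

/-- The derivative in `z i` of the integral of `phiIntegrand m z c` from `z b` to `z l`, `c ≠ i`.
The end points do not contribute, since the integrand vanishes at `z i`. -/
theorem hasDerivAt_segment_integral {N m : ℕ} (hm : 0 < m) {i c : Fin N} (hic : c ≠ i)
    {G : Fin N → (Fin N → ℂ) → ℂ → ℂ} {G' : (Fin N → ℂ) → Fin N → ℂ → ℂ}
    (hG0 : ∀ b z, G b z 0 = 0) (hG : ∀ b z t, HasDerivAt (G b z) (phiIntegrand m z b t) t)
    (hG'0 : ∀ z i, G' z i 0 = 0)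
    (hG' : ∀ z i t d,
      HasDerivAt (fun w : ℂ => phiIntegrand m (shiftCoord z i w) c t) d 0 →
        HasDerivAt (G' z i) d t)
    (hline : ∀ z i (x : ℂ → ℂ) (x' : ℂ), HasDerivAt x x' 0 →
        HasDerivAt (fun w => G c (shiftCoord z i w) (x w))
          (G' z i (x 0) + phiIntegrand m z c (x 0) * x') 0) (z : Conf N) (j : Fin N) :
    HasDerivAt (fun w : ℂ => G c (shiftCoord z.1 i w)
        (shiftCoord z.1 i w j))
      (m * (z.1 i - z.1 c)⁻¹ * (G c z.1 (z.1 j) - G i z.1 (z.1 j))) 0 := by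
  have h1 : ∀ t, G' z.1 i t = m * (z.1 i - z.1 c)⁻¹ * (G c z.1 t - G i z.1 t) := by
    intro t
    have hd : ∀ t, HasDerivAt (fun t => G' z.1 i t - m * (z.1 i - z.1 c)⁻¹ * (G c z.1 t - G i z.1 t))
        0 t := fun t =>
      ((hG' z.1 i t _ (hasDerivAt_phiIntegrand_line hm z hic t)).sub
        (((hG c z.1 t).sub (hG i z.1 t)).const_mul _)).congr_deriv (sub_self _)
    have := is_const_of_deriv_eq_zero (fun t => (hd t).differentiableAt) (fun t => (hd t).deriv) t 0
    simp only [hG'0, hG0, sub_zero, mul_zero] at this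
    exact sub_eq_zero.1 this
  refine (hline z.1 i _ _ (hasDerivAt_shiftCoord_apply z.1 i j)).congr_deriv ?_
  simp only [shiftCoord_zero, h1]
  by_cases hj : j = i
  · have : phiIntegrand m z.1 c (z.1 i) = 0 := by
      rw [phiIntegrand, Finset.prod_eq_zero (Finset.mem_erase.2 ⟨hic.symm, Finset.mem_univ i⟩)
        (by simp [hm.ne']), zero_mul]
    simp [hj, this]
  · simp [hj]

theorem reflSpace_ext_of_ne {N : ℕ} {v w : reflSpace N} (i : Fin N)
    (h : ∀ c, c ≠ i → v.1 c = w.1 c) : v = w := by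
  have h1 : ∑ c, (v.1 c - w.1 c) = 0 := by
    rw [Finset.sum_sub_distrib, reflSpace_sum, reflSpace_sum, sub_zero]
  rw [Finset.sum_eq_single i (fun c _ hc => sub_eq_zero.2 (h c hc)) (by simp)] at h1
  ext c
  by_cases hc : c = i
  · rw [hc]; exact sub_eq_zero.1 h1
  · exact h c hc

theorem kzOperator_apply {N : ℕ} (κ : ℂ) (z : Fin N → ℂ) {i c : Fin N} (hic : c ≠ i)
    (v : reflSpace N) : (kzOperator κ z i v).1 c
      = κ * ((2 * ∑ j ∈ Finset.univ.erase i, (z i - z j)⁻¹) * v.1 c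
        + (z i - z c)⁻¹ * (v.1 i - v.1 c)) := by
  have hc : c ∈ Finset.univ.erase i := Finset.mem_erase.2 ⟨hic, Finset.mem_univ _⟩
  simp only [kzOperator, Submodule.coe_smul, AddSubmonoidClass.coe_finsetSum, Submodule.coe_add,
    Pi.smul_apply, Finset.sum_apply, Pi.add_apply, smul_eq_mul, reflRep_apply, Equiv.swap_inv]
  congr 1
  rw [← Finset.add_sum_erase _ _ hc, ← Finset.add_sum_erase _ _ hc, Equiv.swap_apply_right]
  have : ∀ j ∈ (Finset.univ.erase i).erase c, (z i - z j)⁻¹ * (v.1 (Equiv.swap i j c) + v.1 c)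
      = 2 * (z i - z j)⁻¹ * v.1 c := fun j hj => by
    rw [Equiv.swap_apply_of_ne_of_ne hic (Finset.mem_erase.1 hj).1.symm]
    ring
  rw [Finset.sum_congr rfl this, ← Finset.sum_mul, ← Finset.mul_sum]
  ring

theorem phiSegment_mem_KZ {N m : ℕ} (hm : 0 < m) (l b : Fin N) :
    phiSegment hm l b ∈ KZ (reflRep N) (-m : ℤ) := by
  choose G G' hG0 hG hGd hG'0 hG' hline using exists_primitive_phiIntegrand (N := N) m
  let Y : (Fin N → ℂ) → Fin N → ℂ := fun z c => G c z (z l) - G c z (z b)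
  let F : (Fin N → ℂ) → Fin N → ℂ := fun z c => (discPow m z)⁻¹ * Y z c
  have hF : ∀ z : Conf N, F z.1 = (phiSegment hm l b z).1 := fun z => by
    funext c
    rw [phiSegment, phi_apply_eq hm z _ c (hG c z.1)]
    simp [F, Y, boundaryMult_segmentClass, sub_mul]
  have hGd' : ∀ c j, Differentiable ℂ fun z : Fin N → ℂ => G c z (z j) := fun c j =>
    (hGd c).comp (differentiable_id.prodMk (differentiable_apply j))
  have hdisc : Differentiable ℂ (discPow m : (Fin N → ℂ) → ℂ) := by
    intro z
    refine (HasFDerivAt.finsetProd fun a _ => DifferentiableAt.hasFDerivAt ?_).differentiableAt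
    refine (HasFDerivAt.finsetProd fun b _ => DifferentiableAt.hasFDerivAt ?_).differentiableAt
    fun_prop
  have hFd : ∀ z : Conf N, DifferentiableAt ℂ F z.1 := fun z =>
    differentiableAt_pi.2 fun c => ((hdisc z.1).inv (discPow_ne_zero m z)).mul
      ((hGd' c l).sub (hGd' c b) z.1)
  refine mem_KZ_iff.2 fun z => ?_
  obtain ⟨h1, h2⟩ := extendConf_coordinates hF (hFd z)
  -- the coordinate `c = i` need not be checked, since both sides have coordinate sum zero
  refine ⟨h1, fun i => reflSpace_ext_of_ne i fun c hc => ?_⟩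
  rw [h2, kzOperator_apply _ _ hc, ← hF]
  have hz0 : discPow m z.1 ≠ 0 := discPow_ne_zero m z
  have hYd : HasDerivAt (fun w : ℂ => Y (shiftCoord z.1 i w) c)
      (m * (z.1 i - z.1 c)⁻¹ * (Y z.1 c - Y z.1 i)) 0 :=
    ((hasDerivAt_segment_integral hm hc hG0 hG (hG'0 c) (hG' c) (hline c) z l).sub
      (hasDerivAt_segment_integral hm hc hG0 hG (hG'0 c) (hG' c) (hline c) z b)).congr_deriv
      (by simp only [Y]; ring)
  have hd1 := ((hasDerivAt_discPow m z i).inv (by simpa using hz0)).mul hYd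
  have hd2 : HasDerivAt (fun w : ℂ => F (shiftCoord z.1 i w) c)
      (fderiv ℂ F z.1 (Pi.single i 1) c) 0 :=
    hasDerivAt_pi.1 (HasFDerivAt.comp_hasDerivAt_of_eq 0 (hFd z).hasFDerivAt
      (hasDerivAt_shiftCoord z.1 i) (by simp)) c
  rw [hd2.unique hd1]
  simp only [F, Pi.inv_apply, shiftCoord_zero]
  push_cast
  field_simp
  ring

/-! ### The spaces of solutions -/

instance (N : ℕ) : Nonempty (Conf N) :=
  ⟨⟨fun i => (i : ℂ), fun _ _ h => Fin.ext (Nat.cast_injective h)⟩⟩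

theorem psiCircle_mem_KZ {N m : ℕ} (hN : 2 ≤ N) (hm : 0 < m) (a : Fin N) :
    psiCircle hm a ∈ KZ (reflRep N) (m : ℤ) := by
  have : Nontrivial (Fin N) := Fin.nontrivial_iff_two_le.2 hN
  obtain ⟨l, hl⟩ := exists_ne a
  exact mem_KZ_of_dual (l := l) (fun b => phiSegment_mem_KZ hm l b)
    (fun z w hw => eq_zero_of_reflDot_phiSegment hm l z hw)
    (fun z b _ => reflDot_psiCircle_phiSegment hm hl.symm z)

theorem span_psi_eq_KZ {N m : ℕ} (hN : 2 ≤ N) (hm : 0 < m) :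
    Submodule.span ℂ {ψ : Conf N → reflSpace N |
      ∃ σ : (z : Conf N) → H₁ (punctured z.1) ∅,
        IsHorizontal σ ∧ ψ = fun z => psi m hm z (σ z)} = KZ (reflRep N) (m : ℤ) := by
  let l : Fin N := ⟨N - 1, by omega⟩
  let z₀ : Conf N := Classical.arbitrary _
  apply le_antisymm
  · refine Submodule.span_le.2 ?_
    rintro _ ⟨σ, hσ, rfl⟩
    have : (fun z => psi m hm z (σ z))
        = ∑ a, windingNumber z₀.1 a (σ z₀) • psiCircle (N := N) hm a := by
      funext z
      rw [psi_eq_sum_psiCircle, Finset.sum_apply]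
      exact Finset.sum_congr rfl fun a _ => by rw [hσ.windingNumber_eq a z z₀]; rfl
    rw [this]
    exact sum_mem fun a _ => Submodule.smul_mem _ _ (psiCircle_mem_KZ hN hm a)
  · intro ψ hψ
    -- the coefficients in the dual bases are constant, being pairings of solutions
    have hm0 : (m : ℂ) ≠ 0 := by exact_mod_cast hm.ne'
    have : ψ = ∑ a ∈ Finset.univ.erase l,
        ((m : ℂ) * reflDot N (ψ z₀) (phiSegment hm l a z₀)) • psiCircle hm a := by
      funext z
      rw [← sub_eq_zero, Finset.sum_apply]
      refine eq_zero_of_reflDot_phiSegment hm l z fun b hb => ?_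
      rw [map_sub, map_sum, LinearMap.sub_apply, LinearMap.sum_apply,
        Finset.sum_eq_single b]
      · rw [Pi.smul_apply, map_smul, LinearMap.smul_apply, reflDot_psiCircle_phiSegment hm hb,
          if_pos rfl, smul_eq_mul,
          reflDot_const_of_mem_KZ hψ (phiSegment_mem_KZ hm l b) z z₀]
        field_simp
        ring
      · intro a ha hab
        rw [Pi.smul_apply, map_smul, LinearMap.smul_apply,
          reflDot_psiCircle_phiSegment hm (Finset.mem_erase.1 ha).1, if_neg hab, smul_zero]
      · exact fun h => (h (Finset.mem_erase.2 ⟨hb, Finset.mem_univ b⟩)).elim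
    rw [this]
    exact sum_mem fun a _ => Submodule.smul_mem _ _
      (Submodule.subset_span ⟨_, isHorizontal_circleClass a, rfl⟩)

theorem span_phi_eq_KZ {N m : ℕ} (hN : 2 ≤ N) (hm : 0 < m) :
    Submodule.span ℂ {φ : Conf N → reflSpace N |
      ∃ τ : (z : Conf N) → H₁ (Set.univ : Set ℂ) (Set.range z.1),
        IsHorizontalRel τ ∧ φ = fun z => phi m hm z (τ z)} = KZ (reflRep N) (-m : ℤ) := by
  let l : Fin N := ⟨N - 1, by omega⟩
  let z₀ : Conf N := Classical.arbitrary _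
  apply le_antisymm
  · refine Submodule.span_le.2 ?_
    rintro _ ⟨τ, hτ, rfl⟩
    have : (fun z => phi m hm z (τ z))
        = ∑ b, (-boundaryMult z₀ b (τ z₀) : ℂ) • phiSegment (N := N) hm l b := by
      funext z
      rw [phi_eq_sum_phiSegment hm l, Finset.sum_apply]
      exact Finset.sum_congr rfl fun b _ => by rw [hτ.boundaryMult_eq b z z₀]; rfl
    rw [this]
    exact sum_mem fun b _ => Submodule.smul_mem _ _ (phiSegment_mem_KZ hm l b)
  · intro φ hφ
    -- the coefficients in the dual bases are constant, being pairings of solutions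
    have hm0 : (m : ℂ) ≠ 0 := by exact_mod_cast hm.ne'
    have : φ = ∑ b ∈ Finset.univ.erase l,
        ((m : ℂ) * reflDot N (psiCircle hm b z₀) (φ z₀)) • phiSegment hm l b := by
      funext z
      rw [← sub_eq_zero, Finset.sum_apply]
      refine eq_zero_of_reflDot_psiCircle hm l z fun a ha => ?_
      rw [map_sub, map_sum, Finset.sum_eq_single a]
      · rw [Pi.smul_apply, map_smul, reflDot_psiCircle_phiSegment hm ha,
          if_pos rfl, smul_eq_mul,
          reflDot_const_of_mem_KZ (psiCircle_mem_KZ hN hm a) hφ z z₀]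
        field_simp
        ring
      · intro b _ hab
        rw [Pi.smul_apply, map_smul, reflDot_psiCircle_phiSegment hm ha, if_neg hab.symm,
          smul_zero]
      · exact fun h => (h (Finset.mem_erase.2 ⟨ha, Finset.mem_univ a⟩)).elim
    rw [this]
    exact sum_mem fun b _ => Submodule.smul_mem _ _
      (Submodule.subset_span ⟨_, isHorizontalRel_segmentClass b l, rfl⟩)

/-! ### Intersection numbers and winding numbers -/

theorem mem_segment_iff_exists {a b x : ℂ} :
    x ∈ segment ℝ a b ↔ ∃ s ∈ Set.Icc (0 : ℝ) 1, a + (s : ℂ) * (b - a) = x := by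
  simp [segment_eq_image', Set.mem_image]

/-- If `log (ε u)` is holomorphic along a segment, where `u = (t - q) / (t - p)` and `ε = ±1`, it
computes the integral of the form `du / u`. -/
theorem pathIntegral_windingForm_sub {e : ℂ × ℂ} {p q ε : ℂ} (hε : ε ≠ 0)
    (hp : p ∉ segment ℝ e.1 e.2) (hq : q ∉ segment ℝ e.1 e.2)
    (h : ∀ t ∈ segment ℝ e.1 e.2, ε * ((t - q) / (t - p)) ∈ Complex.slitPlane) :
    pathIntegral (windingForm q) (segmentPath e) - pathIntegral (windingForm p) (segmentPath e)
      = (2 * Real.pi * Complex.I)⁻¹ * (Complex.log (ε * ((e.2 - q) / (e.2 - p)))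
        - Complex.log (ε * ((e.1 - q) / (e.1 - p)))) := by
  have hofReal : ContDiff ℝ ∞ (fun t : ℝ => (t : ℂ)) := Complex.ofRealCLM.contDiff
  have hg : ContDiff ℝ ∞ fun t : ℝ => e.1 + (t : ℂ) * (e.2 - e.1) := by fun_prop
  have hseg : ∀ s ∈ Set.Icc (0 : ℝ) 1, e.1 + (s : ℂ) * (e.2 - e.1) ∈ segment ℝ e.1 e.2 :=
    fun s hs => mem_segment_iff_exists.2 ⟨s, hs, rfl⟩
  have hne : ∀ x ∉ segment ℝ e.1 e.2, ∀ t ∈ segment ℝ e.1 e.2, t - x ≠ 0 := fun x hx t ht e =>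
    hx (sub_eq_zero.1 e ▸ ht)
  have hw : ∀ x ∉ segment ℝ e.1 e.2, ContinuousOn (windingForm x) (segment ℝ e.1 e.2) :=
    fun x hx => (differentiableOn_windingForm x hx).continuousOn
  rw [pathIntegral_eq (γ := segmentPath e) hg (fun _ => rfl),
    pathIntegral_eq (γ := segmentPath e) hg (fun _ => rfl),
    ← intervalIntegral.integral_sub (intervalIntegrable_path (hw q hq) hg hseg)
      (intervalIntegrable_path (hw p hp) hg hseg),
    intervalIntegral.integral_eq_sub_of_hasDerivAt
      (f := fun s : ℝ => (2 * Real.pi * Complex.I)⁻¹ *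
        Complex.log (ε * ((e.1 + (s : ℂ) * (e.2 - e.1) - q) / (e.1 + (s : ℂ) * (e.2 - e.1) - p))))
      (fun s hs => ?_) ((intervalIntegrable_path (hw q hq) hg hseg).sub
      (intervalIntegrable_path (hw p hp) hg hseg))]
  · simp [mul_sub]
  · rw [Set.uIcc_of_le zero_le_one] at hs
    have ht := hseg s hs
    have hd : HasDerivAt (fun s : ℝ => e.1 + (s : ℂ) * (e.2 - e.1)) (e.2 - e.1) s := by
      simpa using ((hasDerivAt_id s).ofReal_comp.mul_const (e.2 - e.1)).const_add e.1
    have hlog := (((hd.sub_const q).div (hd.sub_const p) (hne p hp _ ht)).const_mul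
      ε).clog_real (h _ ht)
    refine (hlog.const_mul _).congr_deriv ?_
    have h1 := hne p hp _ ht
    have h2 := hne q hq _ ht
    simp only [windingForm, hd.deriv, Pi.div_apply]
    generalize e.1 + (s : ℂ) * (e.2 - e.1) = t at *
    field_simp

/-- A crossing of `e` with the segment from `p` to `q` is the jump of the principal branch of
`log ((t - q) / (t - p))`, whose branch cut is this segment. -/
theorem crossingIndex_eq {e f : ℂ × ℂ} (h : GeneralPosition e f) :
    (crossingIndex e f : ℂ) = pathIntegral (windingForm f.2) (segmentPath e)
      - pathIntegral (windingForm f.1) (segmentPath e)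
      - (2 * Real.pi * Complex.I)⁻¹ * (Complex.log ((e.2 - f.2) / (e.2 - f.1))
        - Complex.log ((e.1 - f.2) / (e.1 - f.1))) := by
  obtain ⟨a, b⟩ := e
  obtain ⟨p, q⟩ := f
  obtain ⟨ha, hb, hp, hq⟩ := h
  simp only at ha hb hp hq ⊢
  by_cases hdis : Disjoint (segment ℝ a b) (segment ℝ p q)
  · rw [crossingIndex, if_pos hdis, pathIntegral_windingForm_sub (ε := 1) one_ne_zero hp hq]
    · simp
    · intro t ht
      rw [one_mul, Complex.mem_slitPlane_iff_not_le_zero]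
      intro hle
      have htp : t - p ≠ 0 := fun e => hp (sub_eq_zero.1 e ▸ ht)
      -- a point where the quotient is `-r ≤ 0` divides the segment from `p` to `q` as `1 : r`
      obtain ⟨hre, him⟩ := Complex.le_def.1 hle
      set u := (t - q) / (t - p) with hu
      have hu' : u = ((u.re : ℝ) : ℂ) := Complex.ext rfl (by simpa using him)
      have hr : (0 : ℝ) < 1 - u.re := by have : u.re ≤ 0 := hre; linarith
      have hr' : (1 : ℂ) - (u.re : ℂ) ≠ 0 := by exact_mod_cast hr.ne'
      have h1 : t - q = (u.re : ℂ) * (t - p) := by rw [← hu', hu, div_mul_cancel₀ _ htp]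
      refine Set.disjoint_left.1 hdis ht (mem_segment_iff_exists.2
        ⟨(1 - u.re)⁻¹, ⟨by positivity, inv_le_one_of_one_le₀ (by
          have : u.re ≤ 0 := hre; linarith)⟩, ?_⟩)
      push_cast
      field_simp
      linear_combination -h1
  · obtain ⟨x, hx, hx'⟩ := Set.not_disjoint_iff.1 hdis
    have hd : q - p ≠ 0 := fun e => by
      rw [sub_eq_zero.1 e, segment_same] at hx'
      rw [Set.mem_singleton_iff.1 hx', ← sub_eq_zero.1 e] at hx
      exact hq ((sub_eq_zero.1 e) ▸ hx)
    -- the affine coordinate `y` in which `p` is `0` and `q` is `1`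
    let y : ℂ → ℂ := fun t => (t - p) / (q - p)
    have hyt : ∀ t, t = p + y t * (q - p) := fun t => by
      simp only [y]; field_simp; ring
    obtain ⟨s₀, hs₀, rfl⟩ := mem_segment_iff_exists.1 hx
    obtain ⟨γ, hγ, hγx⟩ := mem_segment_iff_exists.1 hx'
    have hline : ∀ s : ℝ, y (a + (s : ℂ) * (b - a)) = y a + (s : ℂ) * (y b - y a) := fun s => by
      simp only [y]; field_simp; ring
    have hy₀ : y a + (s₀ : ℂ) * (y b - y a) = γ := by
      rw [← hline, ← hγx]; simp only [y]; field_simp; ring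
    have him₀ : (y a).im + s₀ * ((y b).im - (y a).im) = 0 := by
      have := congrArg Complex.im hy₀
      simpa using this
    have hre₀ : (y a).re + s₀ * ((y b).re - (y a).re) = γ := by
      have := congrArg Complex.re hy₀
      simpa using this
    have hs0 : 0 < s₀ := hs₀.1.lt_of_ne fun e => ha (by rw [← e] at hx'; simpa using hx')
    have hs1 : s₀ < 1 := hs₀.2.lt_of_ne fun e => hb (by rw [e] at hx'; simpa using hx')
    have hγ0 : 0 < γ := hγ.1.lt_of_ne fun e => hp (by rw [← hγx, ← e] at hx; simpa using hx)
    have hγ1 : γ < 1 := hγ.2.lt_of_ne fun e => hq (by rw [← hγx, e] at hx; simpa using hx)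
    -- if `e` were parallel to the line through `p` and `q`, it would be contained in this line, and
    -- one of the two segments would contain an endpoint of the other
    have hslope : (y b).im - (y a).im ≠ 0 := by
      intro hsl
      have hia : (y a).im = 0 := by rw [hsl, mul_zero, add_zero] at him₀; exact him₀
      have hib : (y b).im = 0 := by linarith
      have hval : ∀ c : ℝ, (∃ s ∈ Set.Icc (0 : ℝ) 1, (y a).re + s * ((y b).re - (y a).re) = c) →
          p + c * (q - p) ∈ segment ℝ a b := by
        rintro c ⟨s, hs, hc⟩
        refine mem_segment_iff_exists.2 ⟨s, hs, ?_⟩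
        rw [hyt (a + s * (b - a)), hline]
        congr 2
        apply Complex.ext <;> simp [hia, hib, hc]
      rcases lt_or_ge (y a).re 0 with h0 | h0
      · have hden : 0 < γ - (y a).re := by linarith
        have h1 : 0 ≤ -(y a).re / (γ - (y a).re) := div_nonneg (by linarith) hden.le
        have h2 : -(y a).re / (γ - (y a).re) ≤ 1 := (div_le_one hden).2 (by linarith)
        have h3 : s₀ * ((y b).re - (y a).re) = γ - (y a).re := by linarith
        have := hval 0 ⟨s₀ * (-(y a).re / (γ - (y a).re)), ⟨mul_nonneg hs0.le h1, by nlinarith⟩, by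
          calc _ = (y a).re + -(y a).re / (γ - (y a).re) * (s₀ * ((y b).re - (y a).re)) := by ring
            _ = 0 := by rw [h3, div_mul_cancel₀ _ hden.ne']; ring⟩
        exact hp (by simpa using this)
      · have h1 : 1 < (y a).re := by
          by_contra hle
          refine ha (mem_segment_iff_exists.2 ⟨(y a).re, ⟨h0, not_lt.1 hle⟩, ?_⟩)
          conv_rhs => rw [hyt a]
          congr 2
          exact Complex.ext (by simp) (by simp [hia])
        have hden : 0 < (y a).re - γ := by linarith
        have h2 : 0 ≤ ((y a).re - 1) / ((y a).re - γ) := div_nonneg (by linarith) hden.le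
        have h3 : ((y a).re - 1) / ((y a).re - γ) ≤ 1 := (div_le_one hden).2 (by linarith)
        have h4 : s₀ * ((y b).re - (y a).re) = -((y a).re - γ) := by linarith
        have := hval 1 ⟨s₀ * (((y a).re - 1) / ((y a).re - γ)),
          ⟨mul_nonneg hs0.le h2, by nlinarith⟩, by
          calc _ = (y a).re + ((y a).re - 1) / ((y a).re - γ) * (s₀ * ((y b).re - (y a).re)) := by
                ring
            _ = 1 := by rw [h4, mul_neg, div_mul_cancel₀ _ hden.ne']; ring⟩
        exact hq (by simpa using this)
    have hu : ∀ t, t - p ≠ 0 → (t - q) / (t - p) = 1 - (y t)⁻¹ := fun t ht => by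
      simp only [y]; field_simp; ring
    have huim : ∀ t, t - p ≠ 0 → ((t - q) / (t - p)).im = (y t).im / Complex.normSq (y t) :=
      fun t ht => by rw [hu t ht]; simp [Complex.inv_im, neg_div]
    have hya : a - p ≠ 0 := fun e => hp (sub_eq_zero.1 e ▸ left_mem_segment ℝ a b)
    have hyb : b - p ≠ 0 := fun e => hp (sub_eq_zero.1 e ▸ right_mem_segment ℝ a b)
    have hna : 0 < Complex.normSq (y a) := Complex.normSq_pos.2 (div_ne_zero hya hd)
    have hnb : 0 < Complex.normSq (y b) := Complex.normSq_pos.2 (div_ne_zero hyb hd)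
    -- the branch of the logarithm with the opposite cut is holomorphic along `e`
    have hint := pathIntegral_windingForm_sub (e := (a, b)) (p := p) (q := q) (ε := -1)
      (by norm_num) hp hq (fun t ht => by
        rw [neg_one_mul, Complex.mem_slitPlane_iff]
        by_contra! hle
        have htp : t - p ≠ 0 := fun e => hp (sub_eq_zero.1 e ▸ ht)
        obtain ⟨hre, him⟩ := hle
        rw [Complex.neg_re, Left.neg_nonpos_iff] at hre
        rw [Complex.neg_im, neg_eq_zero] at him
        obtain ⟨s, hs, rfl⟩ := mem_segment_iff_exists.1 ht
        have hn : 0 < Complex.normSq (y (a + s * (b - a))) :=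
          Complex.normSq_pos.2 (div_ne_zero htp hd)
        rw [huim _ htp, div_eq_zero_iff, or_iff_left hn.ne', hline] at him
        have him' : (y a).im + s * ((y b).im - (y a).im) = 0 := by simpa using him
        have hss : s = s₀ := mul_right_cancel₀ hslope (by linarith)
        rw [hu _ htp, hline, hss, hy₀, ← Complex.ofReal_inv] at hre
        have h1 : 1 < γ⁻¹ := (one_lt_inv₀ hγ0).2 hγ1
        simp at hre
        linarith)
    have hcross : (b - a).re * (q - p).im - (b - a).im * (q - p).re
        = -(Complex.normSq (q - p) * ((y b).im - (y a).im)) := by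
      have hba : b - a = (y b - y a) * (q - p) := by simp only [y]; field_simp; ring
      rw [hba]
      simp only [Complex.mul_re, Complex.mul_im, Complex.normSq_apply, Complex.sub_re,
        Complex.sub_im]
      ring
    have hnd : 0 < Complex.normSq (q - p) := Complex.normSq_pos.2 hd
    have hpi : (2 * Real.pi * Complex.I)⁻¹ * (2 * Real.pi * Complex.I) = 1 :=
      inv_mul_cancel₀ Complex.two_pi_I_ne_zero
    have hlogpos : ∀ u : ℂ, 0 < u.im → Complex.log (-1 * u) = Complex.log u - Real.pi * Complex.I :=
      fun u hu => by
        rw [neg_one_mul, Complex.log, Complex.log, norm_neg,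
          Complex.arg_neg_eq_arg_sub_pi_of_im_pos hu]
        push_cast; ring
    have hlogneg : ∀ u : ℂ, u.im < 0 → Complex.log (-1 * u) = Complex.log u + Real.pi * Complex.I :=
      fun u hu => by
        rw [neg_one_mul, Complex.log, Complex.log, norm_neg,
          Complex.arg_neg_eq_arg_add_pi_of_im_neg hu]
        push_cast; ring
    rw [hint, crossingIndex, if_neg hdis]
    simp only [hcross]
    rcases lt_or_gt_of_ne hslope with hneg | hpos
    · have h1 : 0 < (y a).im := by nlinarith
      have h2 : (y b).im < 0 := by nlinarith
      rw [hlogpos ((a - q) / (a - p)) (by rw [huim a hya]; positivity),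
        hlogneg ((b - q) / (b - p)) (by rw [huim b hyb]; exact div_neg_of_neg_of_pos h2 hnb),
        sign_pos (by nlinarith)]
      simp only [SignType.coe_one, Int.cast_one]
      linear_combination -hpi
    · have h1 : (y a).im < 0 := by nlinarith
      have h2 : 0 < (y b).im := by nlinarith
      rw [hlogpos ((b - q) / (b - p)) (by rw [huim b hyb]; positivity),
        hlogneg ((a - q) / (a - p)) (by rw [huim a hya]; exact div_neg_of_neg_of_pos h1 hna),
        sign_neg (by nlinarith)]
      simp only [SignType.coe_neg_one, Int.cast_neg, Int.cast_one]
      linear_combination hpi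

/-- The number of crossings of polygonal cycles in general position is determined by the winding
numbers of the first one and the boundary of the second one. -/
theorem IsIntersectionNumber.eq_sum {N : ℕ} {z : Conf N} {σ : H₁ (punctured z.1) ∅}
    {τ : H₁ (Set.univ : Set ℂ) (Set.range z.1)} {k : ℤ} (h : IsIntersectionNumber σ τ k) :
    (k : ℂ) = ∑ i, (boundaryMult z i τ : ℂ) * windingNumber z.1 i σ := by
  obtain ⟨c, d, hc, hd, rfl, rfl, hgp, rfl⟩ := h
  let C : ℂ → ℂ := fun x => chainIntegralHom (windingForm x) (polygonChain c)
  have hbc : boundary₁ ℂ (polygonChain c) = 0 :=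
    Finsupp.support_eq_empty.1 (Finset.eq_empty_of_forall_notMem fun x hx => hc.2 x hx)
  -- the jumps of the logarithm cancel in the sum over the closed polygon
  have hC : ∀ f ∈ d.support,
      zeroChainEval (fun e => (crossingIndex e f : ℂ)) c = C f.2 - C f.1 := by
    intro f hf
    let l : ℂ → ℂ := fun t => (2 * Real.pi * Complex.I)⁻¹ * Complex.log ((t - f.2) / (t - f.1))
    let L : ((unitInterval → ℂ) →₀ ℤ) →+ ℂ := chainIntegralHom (windingForm f.2)
      - chainIntegralHom (windingForm f.1) - (zeroChainEval l).comp (boundary₁ ℂ)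
    have h1 : (zeroChainEval (fun e => (crossingIndex e f : ℂ))
        - L.comp (Finsupp.mapDomain.addMonoidHom segmentPath)) c = 0 := by
      refine eq_zero_of_forall_single _ fun e he => ?_
      simp [L, l, zeroChainEval_single, Finsupp.mapDomain_single, chainIntegralHom_single,
        boundary₁_single, crossingIndex_eq (hgp e he f hf), segmentPath]
      ring
    have h2 : L (polygonChain c) = C f.2 - C f.1 := by simp [L, C, hbc]
    rw [← h2]
    exact sub_eq_zero.1 h1
  have hd' : zeroChainEval (fun f => C f.2 - C f.1) d
      = zeroChainEval C (boundary₁ ℂ (polygonChain d)) := by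
    have : zeroChainEval (fun f : ℂ × ℂ => C f.2 - C f.1) = ((zeroChainEval C).comp
        (boundary₁ ℂ)).comp (Finsupp.mapDomain.addMonoidHom segmentPath) := by
      refine Finsupp.addHom_ext fun f n => ?_
      simp [zeroChainEval_single, Finsupp.mapDomain_single, boundary₁_single, segmentPath, mul_sub]
    exact DFunLike.congr_fun this d
  have hz := zeroChainEval_boundary z C ⟨_, hd⟩
  rw [← hd', zeroChainEval_apply] at hz
  simp only [zsmul_eq_mul] at hz
  refine Eq.trans ?_ hz
  rw [Finsupp.sum_comm]
  simp only [Finsupp.sum, Int.cast_sum]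
  refine Finset.sum_congr rfl fun f hf => ?_
  rw [← hC f hf, zeroChainEval_apply, Finsupp.sum, Finset.mul_sum]
  refine Finset.sum_congr rfl fun e _ => ?_
  push_cast
  rw [zsmul_eq_mul]
  ring

/-! ### Polygonal representatives -/

theorem boundary₁_mem_of_mem_boundaries {E : Type*} [NormedAddCommGroup E] [NormedSpace ℝ E]
    {X A : Set E} {c : (unitInterval → E) →₀ ℤ} (hc : c ∈ boundaries₁ X A) :
    ∀ x ∈ (boundary₁ E c).support, x ∈ A := by
  classical
  obtain ⟨_, ⟨d, -, rfl⟩, e, he, rfl⟩ := AddSubgroup.mem_sup.1 hc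
  rw [map_add, boundary₁_boundary₂, zero_add]
  intro x hx
  rcases Finset.mem_union.1 (Finsupp.support_sub hx) with h | h
  · obtain ⟨γ, hγ, rfl⟩ := Finset.mem_image.1 (Finsupp.mapDomain_support h)
    exact (he γ hγ).2 1
  · obtain ⟨γ, hγ, rfl⟩ := Finset.mem_image.1 (Finsupp.mapDomain_support h)
    exact (he γ hγ).2 0

theorem H₁.exists_mk_eq {E : Type*} [NormedAddCommGroup E] [NormedSpace ℝ E] {X A : Set E}
    {c : cycles₁ X A} {d : (unitInterval → E) →₀ ℤ} (hd : d ∈ chains₁ X)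
    (h : (c : (unitInterval → E) →₀ ℤ) - d ∈ boundaries₁ X A) :
    ∃ hd : d ∈ cycles₁ X A, H₁.mk c = H₁.mk ⟨d, hd⟩ := by
  classical
  refine ⟨⟨hd, fun x hx => ?_⟩, H₁.mk_eq_mk_iff.2 h⟩
  have e : boundary₁ E d = boundary₁ E c.1 - boundary₁ E (c.1 - d) := by rw [map_sub]; abel
  rw [e] at hx
  rcases Finset.mem_union.1 (Finsupp.support_sub hx) with h' | h'
  exacts [c.2.2 x h', boundary₁_mem_of_mem_boundaries h x h']

/-- Formal combinations of segments contained in `X`. -/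
def polygons (X : Set ℂ) : AddSubgroup ((ℂ × ℂ) →₀ ℤ) where
  carrier := {c | ∀ e ∈ c.support, segment ℝ e.1 e.2 ⊆ X}
  zero_mem' := by simp
  add_mem' := by
    classical
    intro a b ha hb e he
    rcases Finset.mem_union.1 (Finsupp.support_add he) with h | h
    exacts [ha e h, hb e h]
  neg_mem' := by intro a ha e he; exact ha e (by simpa using he)

theorem single_mem_polygons {X : Set ℂ} {e : ℂ × ℂ} (h : segment ℝ e.1 e.2 ⊆ X) :
    Finsupp.single e 1 ∈ polygons X := by
  intro e' he'
  rw [Finset.mem_singleton.1 (Finsupp.support_single_subset he')]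
  exact h

theorem polygonChain_mem_chains {X : Set ℂ} {c : (ℂ × ℂ) →₀ ℤ} (hc : c ∈ polygons X) :
    polygonChain c ∈ chains₁ X := by
  classical
  intro γ hγ
  obtain ⟨e, he, rfl⟩ := Finset.mem_image.1 (Finsupp.mapDomain_support hγ)
  exact isSmoothPath_segmentPath (hc e he)

/-- In a set that contains the cone over a path with apex `p`, the path is homologous to the two
segments joining its ends to `p`. -/
theorem single_sub_cone_mem_boundaries {X A : Set ℂ} {g : ℝ → ℂ} (hg : ContDiff ℝ ∞ g) {p : ℂ}
    (hX : ∀ u ∈ Set.Icc (0 : ℝ) 1, segment ℝ (g u) p ⊆ X) :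
    Finsupp.single (fun t : unitInterval => g t) (1 : ℤ)
      - Finsupp.single (segmentPath (g 0, p)) 1 + Finsupp.single (segmentPath (g 1, p)) 1
      ∈ boundaries₁ X A := by
  have hofReal : ContDiff ℝ ∞ (fun t : ℝ => (t : ℂ)) := Complex.ofRealCLM.contDiff
  have h1 := square_mem_boundaries (X := X) (A := A)
    (h := fun q : ℝ × ℝ => g q.2 + (q.1 : ℂ) * (p - g q.2)) (by fun_prop)
    (fun s hs u hu => hX u hu (mem_segment_iff_exists.2 ⟨s, hs, rfl⟩))
  have h2 := single_const_mem_boundaries (A := A)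
    (hX 0 (Set.left_mem_Icc.2 zero_le_one) (right_mem_segment ℝ _ p))
  convert sub_mem h2 h1 using 1
  simp only [Complex.ofReal_one, one_mul, add_sub_cancel, Complex.ofReal_zero, zero_mul, add_zero]
  unfold segmentPath
  abel

/-- In an open set, every chain is homologous to a polygonal one. -/
theorem chains₁_le_sup_polygons {X : Set ℂ} (hX : IsOpen X) (A : Set ℂ) :
    chains₁ X ≤ boundaries₁ X A
      ⊔ (polygons X).map (Finsupp.mapDomain.addMonoidHom segmentPath) := by
  set P := boundaries₁ X A ⊔ (polygons X).map (Finsupp.mapDomain.addMonoidHom segmentPath) with hP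
  have hseg : ∀ e : ℂ × ℂ, segment ℝ e.1 e.2 ⊆ X → Finsupp.single (segmentPath e) 1 ∈ P :=
    fun e he => AddSubgroup.mem_sup_right ⟨_, single_mem_polygons he, by
      simp [Finsupp.mapDomain_single]⟩
  suffices key : ∀ γ, IsSmoothPath X γ → Finsupp.single γ 1 ∈ P by
    intro c hc
    rw [← QuotientAddGroup.eq_zero_iff]
    exact eq_zero_of_forall_single (QuotientAddGroup.mk' P) fun γ hγ =>
      (QuotientAddGroup.eq_zero_iff _).2 (key γ (hc γ hγ))
  rintro γ hγ
  have hcont := hγ.continuous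
  obtain ⟨⟨g, hg, hgγ⟩, hγX⟩ := hγ
  choose! r hr hball using fun x hx => Metric.isOpen_iff.1 hX x hx
  -- subdivide the path into pieces each contained in a ball inside `X`
  obtain ⟨t, ht0, htm, ⟨n, hn⟩, hcov⟩ := exists_monotone_Icc_subset_open_cover_unitInterval
    (c := fun x : X => γ ⁻¹' Metric.ball x.1 (r x.1))
    (fun x => Metric.isOpen_ball.preimage hcont)
    (fun u _ => Set.mem_iUnion.2 ⟨⟨γ u, hγX u⟩, Metric.mem_ball_self (hr _ (hγX u))⟩)
  have hgX : ∀ s ∈ Set.Icc (0 : ℝ) 1, g s ∈ X := fun s hs => by rw [hgγ ⟨s, hs⟩]; exact hγX _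
  have hind : ∀ k, Finsupp.single (fun u : unitInterval => g (0 + u * ((t k : ℝ) - 0))) 1 ∈ P := by
    intro k
    induction k with
    | zero =>
      rw [ht0]
      simpa using AddSubgroup.mem_sup_left (single_const_mem_boundaries (hgX 0 (by simp)))
    | succ k ih =>
      have hle : (t k : ℝ) ≤ t (k + 1) := htm k.le_succ
      have h1 := subdivide_mem_boundaries (X := X) (A := A) hg (t k).2.1 hle
        (fun s hs => hgX s ⟨hs.1, hs.2.trans (t (k + 1)).2.2⟩)
      obtain ⟨x, hx⟩ := hcov k
      have hb : ∀ u ∈ Set.Icc (0 : ℝ) 1,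
          g ((t k : ℝ) + u * ((t (k + 1) : ℝ) - t k)) ∈ Metric.ball x.1 (r x.1) := fun u hu => by
        have h0 : (t k : ℝ) ≤ (t k : ℝ) + u * ((t (k + 1) : ℝ) - t k) := by nlinarith [hu.1]
        have h1 : (t k : ℝ) + u * ((t (k + 1) : ℝ) - t k) ≤ t (k + 1) := by nlinarith [hu.2]
        have hI : (t k : ℝ) + u * ((t (k + 1) : ℝ) - t k) ∈ unitInterval :=
          ⟨(t k).2.1.trans h0, h1.trans (t (k + 1)).2.2⟩
        rw [hgγ ⟨_, hI⟩]
        exact hx (a := ⟨_, hI⟩) ⟨h0, h1⟩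
      have hsub : ∀ u ∈ Set.Icc (0 : ℝ) 1, segment ℝ (g ((t k : ℝ) + u * ((t (k + 1) : ℝ) - t k)))
          (g ((t k : ℝ) + 1 * ((t (k + 1) : ℝ) - t k))) ⊆ X := fun u hu =>
        ((convex_ball _ _).segment_subset (hb u hu) (hb 1 (by simp))).trans (hball _ x.2)
      have h2 := single_sub_cone_mem_boundaries (A := A) (X := X)
        (g := fun u => g ((t k : ℝ) + u * ((t (k + 1) : ℝ) - t k))) (hg.comp (by fun_prop)) hsub
      have h3 := hseg (_, _) (hsub 0 (by simp))
      have h4 := hseg (_, _) (hsub 1 (by simp))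
      have := add_mem (add_mem (AddSubgroup.mem_sup_left h1) ih)
        (sub_mem (add_mem (AddSubgroup.mem_sup_left h2) h3) h4)
      convert this using 1
      abel
  have := hind n
  rw [hn n le_rfl] at this
  simpa [hgγ] using this

/-- Homology classes of an open set have polygonal representatives. -/
theorem exists_polygon_eq {X : Set ℂ} (hX : IsOpen X) (σ : H₁ X ∅) :
    ∃ c ∈ polygons X, ∃ hc, σ = H₁.mk ⟨polygonChain c, hc⟩ := by
  obtain ⟨b, hb, _, ⟨c, hc, rfl⟩, h⟩ := AddSubgroup.mem_sup.1
    (chains₁_le_sup_polygons hX ∅ σ.rep.2.1)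
  refine ⟨c, hc, ?_⟩
  rw [← H₁.mk_rep σ]
  refine H₁.exists_mk_eq (polygonChain_mem_chains hc) ?_
  rw [← h]
  exact (add_sub_cancel_right b (polygonChain c)).symm ▸ hb

/-- A relative cycle is homologous to the cone over its boundary with any apex `p`. -/
theorem exists_cone_eq {A : Set ℂ} (τ : H₁ (Set.univ : Set ℂ) A) (p : ℂ) :
    ∃ d : (ℂ × ℂ) →₀ ℤ, (∀ f ∈ d.support, f.1 ∈ A ∧ f.2 = p) ∧
      ∃ hd, τ = H₁.mk ⟨polygonChain d, hd⟩ := by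
  classical
  let L : ((unitInterval → ℂ) →₀ ℤ) →+ ((ℂ × ℂ) →₀ ℤ) :=
    (Finsupp.mapDomain.addMonoidHom fun x => (x, p)).comp (boundary₁ ℂ)
  refine ⟨-L τ.rep, fun f hf => ?_, ?_⟩
  · rw [Finsupp.support_neg] at hf
    obtain ⟨x, hx, rfl⟩ := Finset.mem_image.1 (Finsupp.mapDomain_support hf)
    exact ⟨τ.rep.2.2 x hx, rfl⟩
  · rw [← H₁.mk_rep τ]
    refine H₁.exists_mk_eq (polygonChain_mem_chains fun e _ => Set.subset_univ _) ?_
    rw [H₁.mk_rep, ← QuotientAddGroup.eq_zero_iff]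
    refine eq_zero_of_forall_single ((QuotientAddGroup.mk' (boundaries₁ Set.univ A)).comp
      (AddMonoidHom.id _ - (Finsupp.mapDomain.addMonoidHom segmentPath).comp (-L)))
      fun γ hγ => ?_
    obtain ⟨⟨g, hg, hgγ⟩, -⟩ := τ.rep.2.1 γ hγ
    refine (QuotientAddGroup.eq_zero_iff _).2 ?_
    have := single_sub_cone_mem_boundaries (X := Set.univ) (A := A) hg (p := p)
      (fun _ _ => Set.subset_univ _)
    convert this using 1
    have h0 : g 0 = γ 0 := hgγ 0
    have h1 : g 1 = γ 1 := hgγ 1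
    simp only [L, AddMonoidHom.sub_apply, AddMonoidHom.comp_apply, AddMonoidHom.neg_apply,
      boundary₁_single, map_sub, map_neg, AddMonoidHom.id_apply,
      Finsupp.mapDomain.addMonoidHom_apply, Finsupp.mapDomain_single, h0, h1, hgγ]
    abel

/-- Finitely many points span finitely many lines, which do not cover the plane. -/
theorem exists_notMem_lines (F : Finset ℂ) :
    ∃ p : ℂ, ∀ v ∈ F, ∀ w ∈ F, p ∉ affineSpan ℝ ({v, w} : Set ℂ) := by
  have h : ∀ v w : ℂ, ∀ᵐ p : ℂ, p ∉ affineSpan ℝ ({v, w} : Set ℂ) := fun v w => by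
    refine MeasureTheory.measure_eq_zero_iff_ae_notMem.1
      (MeasureTheory.Measure.addHaar_affineSubspace _ _ fun htop => ?_)
    have h1 := collinear_iff_finrank_le_one.1 (collinear_pair ℝ v w)
    rw [← direction_affineSpan, htop, AffineSubspace.direction_top, finrank_top,
      Complex.finrank_real_complex] at h1
    omega
  have hall : ∀ᵐ p : ℂ, ∀ v ∈ F, ∀ w ∈ F, p ∉ affineSpan ℝ ({v, w} : Set ℂ) :=
    (MeasureTheory.ae_ball_iff F.countable_toSet).2 fun v _ =>
      (MeasureTheory.ae_ball_iff F.countable_toSet).2 fun w _ => h v w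
  exact hall.exists

/-- Polygonal representatives in general position exist: the apex of the cone representing `τ` is
chosen off the lines through the vertices of the polygon representing `σ` and the points `z i`. -/
theorem exists_isIntersectionNumber {N : ℕ} {z : Fin N → ℂ} (σ : H₁ (punctured z) ∅)
    (τ : H₁ (Set.univ : Set ℂ) (Set.range z)) : ∃ k, IsIntersectionNumber σ τ k := by
  classical
  obtain ⟨c, hcX, hc, hσ⟩ := exists_polygon_eq (isOpen_punctured z) σ
  let F : Finset ℂ := Finset.univ.image z ∪ (c.support.image Prod.fst ∪ c.support.image Prod.snd)
  obtain ⟨p, hp⟩ := exists_notMem_lines F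
  obtain ⟨d, hdp, hd, hτ⟩ := exists_cone_eq τ p
  refine ⟨_, c, d, hc, hd, hσ, hτ, fun e he f hf => ?_, rfl⟩
  obtain ⟨⟨i, hi⟩, hfp⟩ := hdp f hf
  have hseg : ∀ a b x : ℂ, x ∈ segment ℝ a b → x ≠ a → b ∈ affineSpan ℝ ({a, x} : Set ℂ) := by
    intro a b x hx hne
    obtain ⟨s, -, rfl⟩ := mem_segment_iff_exists.1 hx
    have hs : (s : ℂ) ≠ 0 := fun h => hne (by simp [h])
    convert AffineMap.lineMap_mem_affineSpan_pair s⁻¹ a (a + s * (b - a)) using 1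
    simp only [AffineMap.lineMap_apply, vsub_eq_sub, vadd_eq_add, Complex.real_smul,
      Complex.ofReal_inv]
    field_simp
    ring
  have hzF : f.1 ∈ F := Finset.mem_union_left _ (Finset.mem_image.2 ⟨i, Finset.mem_univ i, hi⟩)
  have h1F : e.1 ∈ F := Finset.mem_union_right _ (Finset.mem_union_left _
    (Finset.mem_image_of_mem _ he))
  have h2F : e.2 ∈ F := Finset.mem_union_right _ (Finset.mem_union_right _
    (Finset.mem_image_of_mem _ he))
  have hfe : f.1 ∉ segment ℝ e.1 e.2 := fun h => hcX e he h i hi.symm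
  have hvert : ∀ v ∈ F, v ∈ segment ℝ e.1 e.2 → v ∉ segment ℝ f.1 f.2 := fun v hv hve hvf =>
    hp f.1 hzF v hv (hfp ▸ hseg _ _ _ hvf fun h => hfe (h ▸ hve))
  refine ⟨hvert _ h1F (left_mem_segment ℝ _ _), hvert _ h2F (right_mem_segment ℝ _ _), hfe,
    fun h => hp e.1 h1F e.2 h2F ?_⟩
  rw [← hfp]
  exact convexHull_subset_affineSpan _ (by rwa [convexHull_pair])

/-- The intersection number is the boundary of `τ` weighted with the winding numbers of `σ`. -/
theorem intersectionNumber_eq_sum {N : ℕ} (z : Conf N) (σ : H₁ (punctured z.1) ∅)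
    (τ : H₁ (Set.univ : Set ℂ) (Set.range z.1)) :
    (intersectionNumber σ τ : ℂ) = ∑ i, (boundaryMult z i τ : ℂ) * windingNumber z.1 i σ := by
  rw [intersectionNumber, dif_pos (exists_isIntersectionNumber σ τ)]
  exact (exists_isIntersectionNumber σ τ).choose_spec.eq_sum

/-! ### The pairing of solutions and the intersection pairing -/

theorem mainTheorem7 (N : ℕ) (hN : 2 ≤ N)
    (θ : Module.Dual ℂ (reflSpace N) ≃ₗ[ℂ] reflSpace N)
    (hθ : ∀ (g : Equiv.Perm (Fin N)) (l : Module.Dual ℂ (reflSpace N)),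
      θ ((reflRep N).dual g l) = reflRep N g (θ l)) :
    ∃ C : ℂ, C ≠ 0 ∧
      ((∀ v w : reflSpace N, pairing θ v w = ∑ b, v.1 b * w.1 b) → C = -1) ∧
      ∀ (m : ℕ) (hm : 0 < m),
        -- the canonical pairing of solution spaces is well defined
        (∀ ψ ∈ KZ (reflRep N) (m : ℤ), ∀ φ ∈ KZ (reflRep N) (-m : ℤ), ∀ z z' : Conf N,
          pairing θ (ψ z) (φ z) = pairing θ (ψ z') (φ z')) ∧
        -- horizontal cycles give solutions, and these span the solution spaces
        Submodule.span ℂ {ψ : Conf N → reflSpace N |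
            ∃ σ : (z : Conf N) → H₁ (punctured z.1) ∅,
              IsHorizontal σ ∧ ψ = fun z => psi m hm z (σ z)} = KZ (reflRep N) (m : ℤ) ∧
        Submodule.span ℂ {φ : Conf N → reflSpace N |
            ∃ τ : (z : Conf N) → H₁ (Set.univ : Set ℂ) (Set.range z.1),
              IsHorizontalRel τ ∧ φ = fun z => phi m hm z (τ z)} = KZ (reflRep N) (-m : ℤ) ∧
        -- the pairing of solutions is proportional to the intersection pairing
        (∀ (σ : (z : Conf N) → H₁ (punctured z.1) ∅)
          (τ : (z : Conf N) → H₁ (Set.univ : Set ℂ) (Set.range z.1)),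
          IsHorizontal σ → IsHorizontalRel τ → ∀ z : Conf N,
            pairing θ (psi m hm z (σ z)) (phi m hm z (τ z))
              = C * (1 / (m : ℂ)) * (intersectionNumber (σ z) (τ z) : ℂ)) ∧
        -- the bases given by small circles around `z_a` and by segments from `z_b` to `z_N`
        ∃ ψ φ : Fin N → Conf N → reflSpace N,
          (∀ a, ψ a ∈ KZ (reflRep N) (m : ℤ)) ∧ (∀ b, φ b ∈ KZ (reflRep N) (-m : ℤ)) ∧
          (∀ (a c : Fin N) (z : Conf N) (ε : ℝ), 0 < ε →
            (∀ j, j ≠ a → ε < ‖z.1 j - z.1 a‖) →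
            (ψ a z).1 c = discPow m z.1 * ((2 * Real.pi * Complex.I)⁻¹ *
              ∮ t in C(z.1 a, ε), psiIntegrand m z.1 c t)) ∧
          (∀ (b c : Fin N) (z : Conf N),
            (φ b z).1 c = (discPow m z.1)⁻¹ *
              pathIntegral (phiIntegrand m z.1 c)
                (segmentPath (z.1 b, z.1 ⟨N - 1, by omega⟩))) ∧
          ∀ a b : Fin N, a ≠ ⟨N - 1, by omega⟩ → b ≠ ⟨N - 1, by omega⟩ → ∀ z : Conf N,
            pairing θ (ψ a z) (φ b z) = -C * (1 / (m : ℂ)) * (if a = b then 1 else 0) := by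
  obtain ⟨K, hK0, hK, hK1⟩ := exists_pairing_eq hN θ hθ
  refine ⟨-K, neg_ne_zero.2 hK0, fun h => by rw [hK1 h], fun m hm =>
    ⟨fun ψ hψ φ hφ z z' => ?_, span_psi_eq_KZ hN hm, span_phi_eq_KZ hN hm,
      fun σ τ _ _ z => ?_, psiCircle hm, phiSegment hm ⟨N - 1, by omega⟩, psiCircle_mem_KZ hN hm,
      phiSegment_mem_KZ hm _, psiCircle_apply hm, phiSegment_apply hm _,
      fun a b ha _ z => ?_⟩⟩
  · rw [hK, hK, reflDot_const_of_mem_KZ hψ hφ z z']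
  · rw [hK, reflDot_psi_phi, intersectionNumber_eq_sum]
    ring
  · rw [hK, reflDot_psiCircle_phiSegment hm ha]
    split_ifs <;> ring
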